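/- Let $L,Q,R$ be natural numbers with $R\ge 2$ and $Q<L$, and let $\mathbf Q\in\mathbb C^{L\times Q}$ be a matrix of rank $Q$ none of whose rows is zero. Consider the Rayleigh block-fading SIMO channel with $R$ receive antennas, block length $L$, signal-to-noise ratio $\rho>0$ and input-output relation $$\mathbf y_m=\sqrt{\rho}\,\operatorname{diag}(\mathbf h_m)\,\mathbf x+\mathbf n_m,\qquad \mathbf h_m=\mathbf Q\mathbf s_m,\qquad m=1,\dots,R,$$ where the input $\mathbf x\in\mathbb C^L$, the vectors $\mathbf s_m\sim\mathcal{CN}(\mathbf 0,\mathbf I_Q)$ and the noise vectors $\mathbf n_m\sim\mathcal{CN}(\mathbf 0,\mathbf I_L)$ $(m=1,\dots,R)$ are mutually independent. Neither transmitter nor receiver knows the realizations of the $\mathbf s_m$. Put $\mathbf y=(\mathbf y_1,\dots,\mathbf y_R)$. The (noncoherent) capacity is $$C(\rho)=\frac1L\,\sup I(\mathbf x;\mathbf y),$$ where $I$ is mutual information in bits and the supremum is over all probability distributions of $\mathbf x$ on $\mathbb C^L$ with $\mathbb E[\|\mathbf x\|^2]\le L$. Write $\log$ for the logarithm to base $2$.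 Assume Property (A): there is a set $\mathcal K\subseteq\{1,\dots,L\}$ with $|\mathcal K|=\min\big(\lceil (QR-1)/(R-1)\rceil,\,L\big)$ such that every $Q$ rows of $\mathbf Q$ with (distinct) indices in $\mathcal K$ are linearly independent. Then, as $\rho\to\infty$, $$C(\rho)\ \ge\ \begin{cases}(1-1/L)\log\rho+\mathcal O(1), & \text{if } \frac{QR-1}{R-1}\le L,\\[2pt] R\,(1-Q/L)\log\rho+\mathcal O(1), & \text{otherwise.}\end{cases}$$ Moreover, if $R=2$ and $L\ge 2Q-1$, then the pre-log $\lim_{\rho\to\infty}C(\rho)/\log\rho$ exists and equals $1-1/L$. -/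

import Mathlib

open MeasureTheory ProbabilityTheory Filter Topology Asymptotics
open scoped ENNReal NNReal Matrix

noncomputable section

namespace SIMO

/-- The circularly symmetric complex Gaussian law `CN(0,1)`: independent real and imaginary
parts, each `N(0, 1/2)`. -/
def complexGaussian : Measure ℂ :=
  ((gaussianReal 0 (1 / 2)).prod (gaussianReal 0 (1 / 2))).map
    (fun p : ℝ × ℝ => (⟨p.1, p.2⟩ : ℂ))

/-- The law of an `R`-tuple of independent `CN(0, I_n)` vectors in `ℂ^n`. -/
def complexGaussianVectors (R n : ℕ) : Measure (Fin R → Fin n → ℂ) :=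
  Measure.pi fun _ => Measure.pi fun _ => complexGaussian

/-- The input-output relation of one block at signal-to-noise ratio `ρ`:
`y_m = √ρ diag(h_m) x + n_m` with `h_m = A s_m`, for the receive antennas `m`. -/
def output {L Q R : ℕ} (A : Matrix (Fin L) (Fin Q) ℂ) (ρ : ℝ)
    (x : Fin L → ℂ) (s : Fin R → Fin Q → ℂ) (n : Fin R → Fin L → ℂ) : Fin R → Fin L → ℂ :=
  fun m => ((Real.sqrt ρ : ℝ) : ℂ) • (Matrix.diagonal (A *ᵥ s m) *ᵥ x) + n m

/-- The joint law of `(x, y)` when the input `x` has law `μ` and `x`, the fading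
`s_1, …, s_R` and the noise `n_1, …, n_R` are independent. -/
def jointLaw {L Q : ℕ} (A : Matrix (Fin L) (Fin Q) ℂ) (R : ℕ) (ρ : ℝ)
    (μ : Measure (Fin L → ℂ)) : Measure ((Fin L → ℂ) × (Fin R → Fin L → ℂ)) :=
  (μ.prod ((complexGaussianVectors R Q).prod (complexGaussianVectors R L))).map
    (fun p => (p.1, output A ρ p.1 p.2.1 p.2.2))

/-- The mutual information, in bits, of a pair with joint law `γ`: the relative entropy of `γ`
with respect to the product of its marginals. -/
def mutualInformation {α β : Type*} [MeasurableSpace α] [MeasurableSpace β]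
    (γ : Measure (α × β)) : ℝ≥0∞ :=
  InformationTheory.klDiv γ (γ.fst.prod γ.snd) / ENNReal.ofReal (Real.log 2)

/-- The input distributions on `ℂ^L` with average power `E[‖x‖²] ≤ L`. -/
def admissibleInputs (L : ℕ) : Set (Measure (Fin L → ℂ)) :=
  {μ | IsProbabilityMeasure μ ∧ ∫⁻ x, ∑ i, ‖x i‖ₑ ^ 2 ∂μ ≤ (L : ℝ≥0∞)}

/-- The noncoherent capacity `C(ρ) = (1/L) sup I(x; y)`, in bits per channel use, of the channel
with `R` receive antennas and `h_m ~ CN(0, A Aᴴ)`. -/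
def capacity {L Q : ℕ} (A : Matrix (Fin L) (Fin Q) ℂ) (R : ℕ) (ρ : ℝ) : ℝ≥0∞ :=
  (⨆ μ ∈ admissibleInputs L, mutualInformation (jointLaw A R ρ μ)) / (L : ℝ≥0∞)

/-- Property (A): there is a set of `min(⌈(QR-1)/(R-1)⌉, L)` row indices such that every `Q`
rows with index in this set are linearly independent. -/
def PropertyA {L Q : ℕ} (A : Matrix (Fin L) (Fin Q) ℂ) (R : ℕ) : Prop :=
  ∃ K : Finset (Fin L),
    K.card = min ⌈((Q : ℝ) * R - 1) / ((R : ℝ) - 1)⌉₊ L ∧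
    ∀ S ⊆ K, S.card = Q → LinearIndependent ℂ (fun i : S => A.row i)

end SIMO

end

/-! A noiseless block is the polynomial map `(x, s) ↦ (x_i (A s_m)_i)_{m,i}`, and the information
grows like `log ρ` times the number of complex input coordinates that this map lets one recover
while the fading is unknown too. The scaling `x ↦ c x`, `s ↦ c⁻¹ s` leaves the map unchanged, so at
most `L - 1` coordinates count. The first lower bound attains this number.

Both directions rest on `log r ≤ r - 1` rather than on entropies
(`le_klDiv_of_lintegral_exp_div_le`, `klDiv_le_of_lintegral_exp_mul_le`): the likelihood ratio is
compared with `exp (B - h)` or `exp (B + h)`, where `B` is the main term and `h ≥ 0` has expectation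
bounded in `ρ`. Here `h` may involve fading, noise and independent auxiliary randomness, which
replaces any explicit computation of output densities.

Lower bound (`exists_le_klDiv_inputLaw`). Entries of `x` in a set `P` are uniform on an annulus, the
others are pilots equal to one. If the linearized equations are injective at the all-ones input and
some fading `s₀`, then `n = |P| + R Q` of the observations have nonzero Jacobian determinant there.
This determinant is polynomial in `s`, so its logarithm is integrable and it vanishes almost
nowhere. Changing variables to these observations (`setLIntegral_regularPoints_le`), a Gaussian of
unit width occupies weighted volume of order `ρ^(-n)`. Smearing the fading over a ball of radius
`ρ^(-1/2)` returns `ρ^(R Q)`, and `|P| log ρ` remains.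

Property (A) supplies the injectivity (`exists_fadings_constant`). If `A s_m` vanishes on all rows
of `K` outside a window of `|K| - Q + 1` rows, then an input perturbation solving the linearized
equations is constant on that window. Overlapping windows propagate constancy to `R (|K| - Q) + 1`
rows, and the ceiling in the hypothesis is what makes them reach all of `K`.

Upper bound (`exists_klDiv_jointLaw_le`), for every admissible input. The output is compared with a
mixture over scaled inputs: `L - 1` entries have Gaussian weights of variance `ρ`, each costing `log
ρ`, and one has the heavy tail `(1 + |z|)^(-(2 + 2ε))`. The cost of that last entry is cancelled, up
to `ε log ρ`, by averaging over a random scalar moved from fading to input. -/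

noncomputable section

namespace SIMO

/-! ### Variational bounds on the relative entropy -/

section KullbackLeibler

variable {Ω Ω' : Type*} [MeasurableSpace Ω] [MeasurableSpace Ω']

/-- If `γ` has density `f` with respect to `ν`, then `f` is positive and finite `γ`-almost
everywhere and its logarithm is the log-likelihood ratio. -/
lemma ae_llr_eq_log_of_withDensity {γ ν : Measure Ω'} [IsProbabilityMeasure γ]
    [IsProbabilityMeasure ν] {f : Ω' → ℝ≥0∞} (hf : Measurable f) (hγ : γ = ν.withDensity f) :
    ∀ᵐ z ∂γ, llr γ ν z = Real.log (f z).toReal ∧ f z ≠ 0 ∧ f z ≠ ∞ := by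
  have hac : γ ≪ ν := hγ ▸ withDensity_absolutelyContinuous _ _
  have hfin : ∫⁻ z, f z ∂ν ≠ ∞ := by
    have h1 : γ Set.univ = 1 := measure_univ
    rw [hγ, withDensity_apply _ MeasurableSet.univ, Measure.restrict_univ] at h1
    simp [h1]
  have h1 : ∀ᵐ z ∂γ, γ.rnDeriv ν z = f z := by
    refine hac.ae_le ?_
    have := Measure.rnDeriv_withDensity ν hf
    rw [← hγ] at this
    exact this
  have h2 : ∀ᵐ z ∂γ, f z ≠ ∞ := hac.ae_le ((ae_lt_top hf hfin).mono fun _ h => h.ne)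
  have h3 : ∀ᵐ z ∂γ, f z ≠ 0 := by
    rw [hγ, ae_withDensity_iff hf]
    exact ae_of_all _ fun _ h => h
  filter_upwards [h1, h2, h3] with z hz1 hz2 hz3
  exact ⟨by rw [llr, hz1], hz3, hz2⟩

lemma integrable_of_lintegral_ofReal_le {P : Measure Ω} {h : Ω → ℝ} (hm : Measurable h)
    (h0 : ∀ ω, 0 ≤ h ω) {H : ℝ} (hH : ∫⁻ ω, ENNReal.ofReal (h ω) ∂P ≤ ENNReal.ofReal H) :
    Integrable h P := by
  refine ⟨hm.aestronglyMeasurable, ?_⟩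
  rw [hasFiniteIntegral_iff_ofReal (ae_of_all _ h0)]
  exact hH.trans_lt ENNReal.ofReal_lt_top

lemma integral_le_of_lintegral_ofReal_le {P : Measure Ω} {h : Ω → ℝ} (hm : Measurable h)
    (h0 : ∀ ω, 0 ≤ h ω) {H : ℝ} (hH0 : 0 ≤ H)
    (hH : ∫⁻ ω, ENNReal.ofReal (h ω) ∂P ≤ ENNReal.ofReal H) : ∫ ω, h ω ∂P ≤ H := by
  rw [integral_eq_lintegral_of_nonneg_ae (ae_of_all _ h0) hm.aestronglyMeasurable]
  exact ENNReal.toReal_le_of_le_ofReal hH0 hH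

/-- A Donsker–Varadhan type lower bound, in which the test function may depend on additional
randomness. -/
theorem le_klDiv_of_lintegral_exp_div_le {P : Measure Ω} [IsProbabilityMeasure P]
    {γ ν : Measure Ω'} [IsProbabilityMeasure γ] [IsProbabilityMeasure ν] {π : Ω → Ω'}
    (hπ : Measurable π) (hmap : P.map π = γ) {f : Ω' → ℝ≥0∞} (hf : Measurable f)
    (hγ : γ = ν.withDensity f) {h : Ω → ℝ} (hm : Measurable h) (h0 : ∀ ω, 0 ≤ h ω)
    {B C H : ℝ} (hC0 : 0 ≤ C) (hH0 : 0 ≤ H)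
    (hH : ∫⁻ ω, ENNReal.ofReal (h ω) ∂P ≤ ENNReal.ofReal H)
    (hC : ∫⁻ ω, ENNReal.ofReal (Real.exp (B - h ω)) * (f (π ω))⁻¹ ∂P ≤ ENNReal.ofReal C) :
    ENNReal.ofReal (B - H + 1 - C) ≤ InformationTheory.klDiv γ ν := by
  by_cases hllri : Integrable (llr γ ν) γ
  swap
  -- Without integrability the divergence is `∞`.
  · simp [InformationTheory.klDiv_of_not_integrable hllri]
  have hac : γ ≪ ν := hγ ▸ withDensity_absolutelyContinuous _ _
  rw [InformationTheory.klDiv_of_ac_of_integrable hac hllri]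
  refine ENNReal.ofReal_le_ofReal ?_
  have hae := ae_llr_eq_log_of_withDensity hf hγ
  rw [← hmap] at hae
  have hae := ae_of_ae_map hπ.aemeasurable hae
  set r : Ω → ℝ := fun ω => Real.exp (B - h ω) * ((f (π ω)).toReal)⁻¹ with hr
  have hrm : Measurable r := by fun_prop
  have hr0 : ∀ ω, 0 ≤ r ω := fun ω => by positivity
  have hrC : ∫⁻ ω, ENNReal.ofReal (r ω) ∂P ≤ ENNReal.ofReal C := by
    refine le_trans (lintegral_mono_ae ?_) hC
    filter_upwards [hae] with ω hω
    rw [hr, ENNReal.ofReal_mul (Real.exp_pos _).le, ENNReal.ofReal_inv_of_pos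
      (ENNReal.toReal_pos hω.2.1 hω.2.2), ENNReal.ofReal_toReal hω.2.2]
  have hhi := integrable_of_lintegral_ofReal_le hm h0 hH
  have hri := integrable_of_lintegral_ofReal_le hrm hr0 hrC
  have hhb := integral_le_of_lintegral_ofReal_le hm h0 hH0 hH
  have hrb := integral_le_of_lintegral_ofReal_le hrm hr0 hC0 hrC
  have hllr : ∫ z, llr γ ν z ∂γ = ∫ ω, llr γ ν (π ω) ∂P := by
    conv_lhs => rw [← hmap]
    rw [integral_map hπ.aemeasurable]
    · rw [hmap]
    · exact (measurable_llr _ _).aestronglyMeasurable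
  have hlint : Integrable (fun ω => llr γ ν (π ω)) P := by
    have : Integrable (llr γ ν) (P.map π) := by rw [hmap]; exact hllri
    exact this.comp_measurable hπ
  have key : ∫ ω, (B - h ω + 1 - r ω) ∂P ≤ ∫ ω, llr γ ν (π ω) ∂P := by
    refine integral_mono_ae ?_ hlint ?_
    · exact (((integrable_const B).sub hhi).add (integrable_const 1)).sub hri
    · filter_upwards [hae] with ω hω
      rw [hmap] at hω
      have hpos := ENNReal.toReal_pos hω.2.1 hω.2.2
      have hrpos : 0 < r ω := by rw [hr]; positivity
      -- With `r = exp (B - h) / f` this is the pointwise bound `B - h + 1 - r ≤ log f`, which only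
      -- has to be integrated.
      have := Real.log_le_sub_one_of_pos hrpos
      rw [hr, Real.log_mul (Real.exp_pos _).ne' (inv_pos.2 hpos).ne', Real.log_exp,
        Real.log_inv] at this
      simp only [hr] at *
      rw [hω.1]
      linarith
  have hcalc : ∫ ω, (B - h ω + 1 - r ω) ∂P = B - ∫ ω, h ω ∂P + 1 - ∫ ω, r ω ∂P := by
    have i1 : Integrable (fun ω => B - h ω) P := (integrable_const B).sub hhi
    have i2 : Integrable (fun ω => B - h ω + 1) P := i1.add (integrable_const 1)
    rw [integral_sub i2 hri, integral_add i1 (integrable_const 1),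
      integral_sub (integrable_const B) hhi]
    simp
  rw [hllr]
  simp only [probReal_univ]
  linarith

/-- The dual upper bound, in which the comparison function may depend on additional randomness. -/
theorem klDiv_le_of_lintegral_exp_mul_le {P : Measure Ω} [IsProbabilityMeasure P]
    {γ ν : Measure Ω'} [IsProbabilityMeasure γ] [IsProbabilityMeasure ν] {π : Ω → Ω'}
    (hπ : Measurable π) (hmap : P.map π = γ) {f : Ω' → ℝ≥0∞} (hf : Measurable f)
    (hγ : γ = ν.withDensity f) {h : Ω → ℝ} (hm : Measurable h) (h0 : ∀ ω, 0 ≤ h ω)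
    {B C H : ℝ} (hC0 : 0 ≤ C) (hH0 : 0 ≤ H)
    (hH : ∫⁻ ω, ENNReal.ofReal (h ω) ∂P ≤ ENNReal.ofReal H)
    (hC : ∫⁻ ω, ENNReal.ofReal (Real.exp (-(B + h ω))) * f (π ω) ∂P ≤ ENNReal.ofReal C) :
    InformationTheory.klDiv γ ν ≤ ENNReal.ofReal (B + H + C - 1) := by
  have hac : γ ≪ ν := hγ ▸ withDensity_absolutelyContinuous _ _
  have hae' := ae_llr_eq_log_of_withDensity hf hγ
  have hae := hae'
  rw [← hmap] at hae
  have hae := ae_of_ae_map hπ.aemeasurable hae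
  rw [hmap] at hae
  set r : Ω → ℝ := fun ω => Real.exp (-(B + h ω)) * (f (π ω)).toReal with hr
  have hrm : Measurable r := by fun_prop
  have hr0 : ∀ ω, 0 ≤ r ω := fun ω => by positivity
  have hrC : ∫⁻ ω, ENNReal.ofReal (r ω) ∂P ≤ ENNReal.ofReal C := by
    refine le_trans (lintegral_mono_ae ?_) hC
    filter_upwards [hae] with ω hω
    rw [hr, ENNReal.ofReal_mul (Real.exp_pos _).le, ENNReal.ofReal_toReal hω.2.2]
  have hhi := integrable_of_lintegral_ofReal_le hm h0 hH
  have hri := integrable_of_lintegral_ofReal_le hrm hr0 hrC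
  have hhb := integral_le_of_lintegral_ofReal_le hm h0 hH0 hH
  have hrb := integral_le_of_lintegral_ofReal_le hrm hr0 hC0 hrC
  have hub : ∀ᵐ ω ∂P, llr γ ν (π ω) ≤ B + h ω + r ω - 1 := by
    filter_upwards [hae] with ω hω
    have hpos := ENNReal.toReal_pos hω.2.1 hω.2.2
    have hrpos : 0 < r ω := by rw [hr]; positivity
    have := Real.log_le_sub_one_of_pos hrpos
    rw [hr, Real.log_mul (Real.exp_pos _).ne' hpos.ne', Real.log_exp] at this
    simp only [hr] at *
    rw [hω.1]
    linarith
  -- the inverse density is integrable, which controls the negative part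
  set q : Ω → ℝ := fun ω => ((f (π ω)).toReal)⁻¹ with hq
  have hqm : Measurable q := by fun_prop
  have hq0 : ∀ ω, 0 ≤ q ω := fun ω => by positivity
  have hfi : Measurable fun z => (f z)⁻¹ := hf.inv
  have hqC : ∫⁻ ω, ENNReal.ofReal (q ω) ∂P ≤ ENNReal.ofReal 1 := by
    have h1 : ∫⁻ ω, ENNReal.ofReal (q ω) ∂P ≤ ∫⁻ ω, (f (π ω))⁻¹ ∂P := by
      refine lintegral_mono_ae ?_
      filter_upwards [hae] with ω hω
      rw [hq, ENNReal.ofReal_inv_of_pos (ENNReal.toReal_pos hω.2.1 hω.2.2),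
        ENNReal.ofReal_toReal hω.2.2]
    have h2 : ∫⁻ ω, (f (π ω))⁻¹ ∂P = ∫⁻ z, (f z)⁻¹ ∂γ := by
      rw [← hmap, lintegral_map hfi hπ]
    have h3 : ∫⁻ z, (f z)⁻¹ ∂γ ≤ 1 := by
      rw [hγ, lintegral_withDensity_eq_lintegral_mul _ hf hfi]
      calc ∫⁻ z, (f * fun z => (f z)⁻¹) z ∂ν ≤ ∫⁻ _, 1 ∂ν := by
            refine lintegral_mono fun z => ?_
            exact ENNReal.mul_inv_le_one (f z)
        _ = 1 := by simp
    simpa using h1.trans (h2.trans_le h3)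
  have hqi := integrable_of_lintegral_ofReal_le hqm hq0 hqC
  have hlb : ∀ᵐ ω ∂P, -q ω ≤ llr γ ν (π ω) := by
    filter_upwards [hae] with ω hω
    have hpos := ENNReal.toReal_pos hω.2.1 hω.2.2
    have := Real.log_le_sub_one_of_pos (inv_pos.2 hpos)
    rw [Real.log_inv] at this
    simp only [hq]
    rw [hω.1]
    linarith
  have hubi : Integrable (fun ω => B + h ω + r ω - 1) P :=
    (((integrable_const B).add hhi).add hri).sub (integrable_const 1)
  have hlint : Integrable (fun ω => llr γ ν (π ω)) P := by
    refine Integrable.mono' (g := fun ω => |B + h ω + r ω - 1| + q ω) (hubi.abs.add hqi)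
      ((measurable_llr γ ν).comp hπ).aestronglyMeasurable ?_
    filter_upwards [hub, hlb] with ω h1 h2
    rw [Real.norm_eq_abs, abs_le]
    have := le_abs_self (B + h ω + r ω - 1)
    have := hq0 ω
    have := abs_nonneg (B + h ω + r ω - 1)
    constructor <;> linarith
  have hllri : Integrable (llr γ ν) γ := by
    rw [← hmap, integrable_map_measure _ hπ.aemeasurable]
    · rw [hmap]; exact hlint
    · exact (measurable_llr _ _).aestronglyMeasurable
  rw [InformationTheory.klDiv_of_ac_of_integrable hac hllri]
  refine ENNReal.ofReal_le_ofReal ?_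
  have hllr : ∫ z, llr γ ν z ∂γ = ∫ ω, llr γ ν (π ω) ∂P := by
    conv_lhs => rw [← hmap]
    rw [integral_map hπ.aemeasurable]
    · rw [hmap]
    · exact (measurable_llr _ _).aestronglyMeasurable
  have key : ∫ ω, llr γ ν (π ω) ∂P ≤ ∫ ω, (B + h ω + r ω - 1) ∂P :=
    integral_mono_ae hlint hubi hub
  have hcalc : ∫ ω, (B + h ω + r ω - 1) ∂P = B + ∫ ω, h ω ∂P + ∫ ω, r ω ∂P - 1 := by
    have i1 : Integrable (fun ω => B + h ω) P := (integrable_const B).add hhi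
    have i2 : Integrable (fun ω => B + h ω + r ω) P := i1.add hri
    rw [integral_sub i2 (integrable_const 1), integral_add i1 hri,
      integral_add (integrable_const B) hhi]
    simp
  rw [hllr]
  simp only [probReal_univ]
  linarith

end KullbackLeibler

end SIMO

end

noncomputable section

namespace SIMO

/-! ### Densities of product measures and complex Gaussian vectors -/

section PiDensity

variable {ι : Type*} [Fintype ι] {α : ι → Type*} [∀ i, MeasurableSpace (α i)]

/-- Tonelli's theorem for a product of functions of the separate coordinates. -/
theorem lintegral_pi_prod (μ : ∀ i, Measure (α i)) [∀ i, SigmaFinite (μ i)]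
    {f : ∀ i, α i → ℝ≥0∞} (hf : ∀ i, Measurable (f i)) :
    ∫⁻ x, ∏ i, f i (x i) ∂(Measure.pi μ) = ∏ i, ∫⁻ t, f i t ∂(μ i) := by
  classical
  have key : ∀ (s : Finset ι), (∫⋯∫⁻_s, (fun x => ∏ i ∈ s, f i (x i)) ∂μ)
      = fun _ => ∏ i ∈ s, ∫⁻ t, f i t ∂(μ i) := by
    intro s
    induction s using Finset.induction_on with
    | empty => ext x; simp
    | insert a s ha ih =>
      rw [lmarginal_insert' _ (by fun_prop) ha]
      have h1 : (fun x : ∀ i, α i => ∫⁻ t, ∏ i ∈ insert a s, f i (Function.update x a t i) ∂μ a)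
          = fun x => (∫⁻ t, f a t ∂μ a) * ∏ i ∈ s, f i (x i) := by
        ext x
        rw [← lintegral_mul_const _ (hf a)]
        refine lintegral_congr fun t => ?_
        rw [Finset.prod_insert ha, Function.update_self]
        congr 1
        refine Finset.prod_congr rfl fun i hi => ?_
        rw [Function.update_of_ne]
        rintro rfl
        exact ha hi
      rw [h1]
      ext x
      rw [Finset.prod_insert ha, ← congrFun ih x]
      simp only [lmarginal]
      rw [lintegral_const_mul]
      refine (Finset.measurable_prod s fun i _ => (hf i).comp (measurable_pi_apply i)).comp ?_
      exact measurable_updateFinset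
  -- The identity `key` between marginals has to be evaluated at a point, so an empty product space
  -- is treated apart. There some factor is empty and both sides vanish.
  rcases isEmpty_or_nonempty (∀ i, α i) with h | h
  · obtain ⟨i, hi⟩ : ∃ i, IsEmpty (α i) := by
      by_contra hc
      push Not at hc
      exact h.false fun i => (hc i).some
    have : ∏ i, ∫⁻ t, f i t ∂(μ i) = 0 :=
      Finset.prod_eq_zero (Finset.mem_univ i) (by simp)
    rw [this]
    simp
  · obtain ⟨x⟩ := h
    rw [lintegral_eq_lmarginal_univ x, key]

theorem pi_withDensity (μ : ∀ i, Measure (α i)) [∀ i, SigmaFinite (μ i)]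
    {f : ∀ i, α i → ℝ≥0∞} (hf : ∀ i, Measurable (f i))
    [∀ i, SigmaFinite ((μ i).withDensity (f i))] :
    Measure.pi (fun i => (μ i).withDensity (f i))
      = (Measure.pi μ).withDensity (fun x => ∏ i, f i (x i)) := by
  refine Measure.pi_eq fun s hs => ?_
  rw [withDensity_apply _ (MeasurableSet.univ_pi hs), Measure.restrict_pi_pi,
    lintegral_pi_prod _ hf]
  exact Finset.prod_congr rfl fun i _ => (withDensity_apply _ (hs i)).symm

end PiDensity

theorem complexGaussian_eq_withDensity :
    complexGaussian
      = (volume : Measure ℂ).withDensity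
        (fun z => ENNReal.ofReal (Real.pi⁻¹ * Real.exp (-‖z‖ ^ 2))) := by
  have hv : (1 / 2 : ℝ≥0) ≠ 0 := by norm_num
  have hg : (gaussianReal 0 (1 / 2)).prod (gaussianReal 0 (1 / 2))
      = (volume : Measure (ℝ × ℝ)).withDensity
        (fun p => ENNReal.ofReal (Real.pi⁻¹ * Real.exp (-(p.1 ^ 2 + p.2 ^ 2)))) := by
    rw [gaussianReal_of_var_ne_zero _ hv,
      prod_withDensity (measurable_gaussianPDF _ _) (measurable_gaussianPDF _ _),
      Measure.volume_eq_prod]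
    congr 1
    ext p
    rw [gaussianPDF, gaussianPDF, ← ENNReal.ofReal_mul (gaussianPDFReal_nonneg _ _ _)]
    congr 1
    rw [gaussianPDFReal, gaussianPDFReal]
    push_cast
    have h1 : (2 * Real.pi * (1 / 2)) = Real.pi := by ring
    have h2 : (2 * (1 / 2) : ℝ) = 1 := by norm_num
    rw [h1, h2, sub_zero, sub_zero, mul_mul_mul_comm, ← Real.exp_add, ← mul_inv,
      Real.mul_self_sqrt Real.pi_pos.le]
    congr 2
    ring
  have he : (fun p : ℝ × ℝ => (⟨p.1, p.2⟩ : ℂ)) = Complex.measurableEquivRealProd.symm := rfl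
  rw [complexGaussian, hg, he]
  ext s hs
  rw [MeasurableEquiv.map_apply, withDensity_apply _ hs, withDensity_apply _
    (Complex.measurableEquivRealProd.symm.measurable hs),
    ← (Complex.volume_preserving_equiv_real_prod.symm).setLIntegral_comp_preimage hs
      (by fun_prop)]
  refine lintegral_congr fun p => ?_
  congr 4
  rw [Complex.sq_norm, Complex.normSq_apply]
  change _ = p.1 * p.1 + p.2 * p.2
  ring

instance : IsProbabilityMeasure complexGaussian := by
  have : Measurable (fun p : ℝ × ℝ => (⟨p.1, p.2⟩ : ℂ)) :=
    Complex.measurableEquivRealProd.symm.measurable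
  exact Measure.isProbabilityMeasure_map this.aemeasurable

instance (R n : ℕ) : IsProbabilityMeasure (complexGaussianVectors R n) := by
  unfold complexGaussianVectors; infer_instance

/-- The sum of the squared moduli of the entries. -/
def sqNorm {R n : ℕ} (y : Fin R → Fin n → ℂ) : ℝ := ∑ m, ∑ i, ‖y m i‖ ^ 2

lemma sqNorm_nonneg {R n : ℕ} (y : Fin R → Fin n → ℂ) : 0 ≤ sqNorm y := by
  unfold sqNorm; positivity

lemma sq_norm_apply_le_sqNorm {R n : ℕ} (y : Fin R → Fin n → ℂ) (m : Fin R) (i : Fin n) :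
    ‖y m i‖ ^ 2 ≤ sqNorm y :=
  (Finset.single_le_sum (f := fun i => ‖y m i‖ ^ 2) (fun i _ => by positivity)
    (Finset.mem_univ i)).trans
    (Finset.single_le_sum (f := fun m => ∑ i, ‖y m i‖ ^ 2) (fun m _ => by positivity)
      (Finset.mem_univ m))

@[fun_prop]
lemma continuous_sqNorm {R n : ℕ} : Continuous (sqNorm (R := R) (n := n)) := by
  unfold sqNorm; fun_prop

@[fun_prop]
lemma measurable_sqNorm {R n : ℕ} : Measurable (sqNorm (R := R) (n := n)) :=
  continuous_sqNorm.measurable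

/-- The density of `complexGaussianVectors`. -/
def gaussianDensity (R n : ℕ) (y : Fin R → Fin n → ℂ) : ℝ≥0∞ :=
  ENNReal.ofReal ((Real.pi⁻¹) ^ (R * n) * Real.exp (-sqNorm y))

@[fun_prop]
lemma measurable_gaussianDensity (R n : ℕ) : Measurable (gaussianDensity R n) := by
  unfold gaussianDensity; fun_prop

lemma gaussianDensity_pos {R n : ℕ} (y : Fin R → Fin n → ℂ) : 0 < gaussianDensity R n y := by
  unfold gaussianDensity
  have := Real.pi_pos
  exact ENNReal.ofReal_pos.2 (by positivity)

lemma gaussianDensity_le_exp {R n : ℕ} (y : Fin R → Fin n → ℂ) :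
    gaussianDensity R n y ≤ ENNReal.ofReal (Real.exp (-sqNorm y)) := by
  refine ENNReal.ofReal_le_ofReal (mul_le_of_le_one_left (Real.exp_pos _).le ?_)
  refine pow_le_one₀ (inv_nonneg.2 Real.pi_pos.le) (inv_le_one_of_one_le₀ ?_)
  linarith [Real.pi_gt_three]

lemma gaussianDensity_le_one {R n : ℕ} (y : Fin R → Fin n → ℂ) : gaussianDensity R n y ≤ 1 := by
  refine (gaussianDensity_le_exp y).trans ?_
  rw [← ENNReal.ofReal_one]
  exact ENNReal.ofReal_le_ofReal (Real.exp_le_one_iff.2 (neg_nonpos.2 (sqNorm_nonneg y)))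

theorem complexGaussianVectors_eq_withDensity (R n : ℕ) :
    complexGaussianVectors R n = volume.withDensity (gaussianDensity R n) := by
  set g : ℂ → ℝ≥0∞ := fun z => ENNReal.ofReal (Real.pi⁻¹ * Real.exp (-‖z‖ ^ 2)) with hg
  have hgm : Measurable g := by fun_prop
  have h1 : IsProbabilityMeasure ((volume : Measure ℂ).withDensity g) := by
    rw [← complexGaussian_eq_withDensity]; infer_instance
  have h2 : (Measure.pi fun _ : Fin n => complexGaussian)
      = (volume : Measure (Fin n → ℂ)).withDensity (fun x => ∏ i, g (x i)) := by
    rw [complexGaussian_eq_withDensity, pi_withDensity _ fun _ => hgm]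
    rfl
  have h3 : IsProbabilityMeasure
      ((volume : Measure (Fin n → ℂ)).withDensity (fun x => ∏ i, g (x i))) := by
    rw [← h2]; infer_instance
  have hgm' : Measurable fun x : Fin n → ℂ => ∏ i, g (x i) := by fun_prop
  rw [complexGaussianVectors, h2, pi_withDensity _ fun _ => hgm']
  change volume.withDensity _ = _
  congr 1
  ext y
  have hp := Real.pi_pos
  simp only [hg, gaussianDensity]
  have hrow (m : Fin R) : ∏ i, ENNReal.ofReal (Real.pi⁻¹ * Real.exp (-‖y m i‖ ^ 2))
      = ENNReal.ofReal (∏ i, (Real.pi⁻¹ * Real.exp (-‖y m i‖ ^ 2))) :=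
    (ENNReal.ofReal_prod_of_nonneg fun i _ => by positivity).symm
  rw [Finset.prod_congr rfl fun m _ => hrow m, ← ENNReal.ofReal_prod_of_nonneg (fun i _ => by positivity)]
  congr 1
  simp_rw [Finset.prod_mul_distrib, Finset.prod_const, ← Real.exp_sum]
  rw [sqNorm]
  simp [← pow_mul, mul_comm]

lemma integrable_sq_norm_complexGaussian :
    Integrable (fun z : ℂ => ‖z‖ ^ 2) complexGaussian := by
  have hm : Measurable (fun p : ℝ × ℝ => (⟨p.1, p.2⟩ : ℂ)) :=
    Complex.measurableEquivRealProd.symm.measurable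
  rw [complexGaussian, integrable_map_measure (by fun_prop) hm.aemeasurable]
  have h1 : Integrable (fun x : ℝ => x ^ 2) (gaussianReal 0 (1 / 2)) :=
    (memLp_id_gaussianReal 2).integrable_sq
  have h2 := (h1.comp_fst (gaussianReal 0 (1 / 2))).add (h1.comp_snd (gaussianReal 0 (1 / 2)))
  refine h2.congr (ae_of_all _ fun p => ?_)
  simp only [Function.comp, Pi.add_apply, Complex.sq_norm, Complex.normSq_mk]
  ring

lemma integrable_sqNorm (R n : ℕ) :
    Integrable (sqNorm (R := R) (n := n)) (complexGaussianVectors R n) := by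
  unfold sqNorm complexGaussianVectors
  refine integrable_finsetSum _ fun m _ => integrable_finsetSum _ fun i _ => ?_
  have h1 : Integrable (fun v : Fin n → ℂ => ‖v i‖ ^ 2)
      (Measure.pi fun _ : Fin n => complexGaussian) :=
    integrable_comp_eval (μ := fun _ : Fin n => complexGaussian) integrable_sq_norm_complexGaussian
  exact integrable_comp_eval
    (μ := fun _ : Fin R => Measure.pi fun _ : Fin n => complexGaussian) (i := m) h1

lemma lintegral_sqNorm_ne_top (R n : ℕ) :
    ∫⁻ s, ENNReal.ofReal (sqNorm s) ∂(complexGaussianVectors R n) ≠ ∞ :=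
  (hasFiniteIntegral_iff_ofReal (ae_of_all _ sqNorm_nonneg)).1 (integrable_sqNorm R n).2 |>.ne

/-- Expectations of a translated Gaussian vector as Lebesgue integrals. -/
lemma lintegral_add_complexGaussianVectors {R n : ℕ} (v : Fin R → Fin n → ℂ)
    {g : (Fin R → Fin n → ℂ) → ℝ≥0∞} (hg : Measurable g) :
    ∫⁻ z, g (v + z) ∂(complexGaussianVectors R n)
      = ∫⁻ y, gaussianDensity R n (y - v) * g y := by
  rw [complexGaussianVectors_eq_withDensity,
    lintegral_withDensity_eq_lintegral_mul _ (measurable_gaussianDensity R n) (by fun_prop),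
    ← lintegral_add_left_eq_self (μ := volume) (fun y => gaussianDensity R n (y - v) * g y) v]
  refine lintegral_congr fun z => ?_
  simp

end SIMO

end

noncomputable section

namespace SIMO

/-! ### Densities of the channel -/

section Channel

set_option linter.unusedSectionVars false

variable {L Q R : ℕ}

/-- The noiseless output: entry `(m, i)` is `√ρ x_i (A s_m)_i`. -/
def signal (A : Matrix (Fin L) (Fin Q) ℂ) (ρ : ℝ) (x : Fin L → ℂ) (s : Fin R → Fin Q → ℂ) :
    Fin R → Fin L → ℂ :=
  fun m i => ((Real.sqrt ρ : ℝ) : ℂ) * (x i * ∑ j, A i j * s m j)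

lemma output_eq (A : Matrix (Fin L) (Fin Q) ℂ) (ρ : ℝ) (x : Fin L → ℂ) (s : Fin R → Fin Q → ℂ)
    (n : Fin R → Fin L → ℂ) : output A ρ x s n = signal A ρ x s + n := by
  ext m i
  simp only [output, signal, Pi.add_apply, Pi.smul_apply, smul_eq_mul,
    Matrix.mulVec, dotProduct, Matrix.diagonal_apply, ite_mul, zero_mul, Finset.sum_ite_eq,
    Finset.mem_univ, if_true]
  ring

lemma continuous_signal (A : Matrix (Fin L) (Fin Q) ℂ) (ρ : ℝ) :
    Continuous fun p : (Fin L → ℂ) × (Fin R → Fin Q → ℂ) => signal A ρ p.1 p.2 := by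
  unfold signal; fun_prop

@[fun_prop]
lemma Measurable.signal {α : Type*} [MeasurableSpace α] (A : Matrix (Fin L) (Fin Q) ℂ) (ρ : ℝ)
    {f : α → Fin L → ℂ} {g : α → Fin R → Fin Q → ℂ} (hf : Measurable f) (hg : Measurable g) :
    Measurable fun a => SIMO.signal A ρ (f a) (g a) :=
  (continuous_signal A ρ).measurable.comp (hf.prodMk hg)

/-- The conditional density of the output given the input. -/
def channelDensity (A : Matrix (Fin L) (Fin Q) ℂ) (ρ : ℝ) (x : Fin L → ℂ)
    (y : Fin R → Fin L → ℂ) : ℝ≥0∞ :=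
  ∫⁻ s, gaussianDensity R L (y - signal A ρ x s) ∂(complexGaussianVectors R Q)

/-- The density of the output when the input has law `μ`. -/
def outputDensity (A : Matrix (Fin L) (Fin Q) ℂ) (ρ : ℝ) (μ : Measure (Fin L → ℂ))
    (y : Fin R → Fin L → ℂ) : ℝ≥0∞ :=
  ∫⁻ x, channelDensity A ρ x y ∂μ

variable (A : Matrix (Fin L) (Fin Q) ℂ) (ρ : ℝ)

lemma measurable_channelDensity :
    Measurable fun p : (Fin L → ℂ) × (Fin R → Fin L → ℂ) => channelDensity A ρ p.1 p.2 := by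
  unfold channelDensity
  refine Measurable.lintegral_prod_right' (f := fun q : ((Fin L → ℂ) × (Fin R → Fin L → ℂ)) ×
    (Fin R → Fin Q → ℂ) => gaussianDensity R L (q.1.2 - signal A ρ q.1.1 q.2)) ?_
  fun_prop

lemma measurable_channelDensity_left (y : Fin R → Fin L → ℂ) :
    Measurable fun x : Fin L → ℂ => channelDensity A ρ x y := by
  unfold channelDensity
  refine Measurable.lintegral_prod_right' (f := fun q : (Fin L → ℂ) × (Fin R → Fin Q → ℂ) =>
    gaussianDensity R L (y - signal A ρ q.1 q.2)) ?_
  fun_prop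

/-- The Gaussian noise density is positive everywhere. Together with the bound by one this allows
the densities to be inverted and cancelled pointwise, with no exceptional null sets. -/
lemma channelDensity_pos (x : Fin L → ℂ) (y : Fin R → Fin L → ℂ) :
    0 < channelDensity A ρ x y := by
  unfold channelDensity
  rw [lintegral_pos_iff_support (by fun_prop)]
  have : (Function.support fun s : Fin R → Fin Q → ℂ =>
      gaussianDensity R L (y - signal A ρ x s)) = Set.univ := by
    ext s
    simpa using (gaussianDensity_pos _).ne'
  rw [this]
  simp

lemma channelDensity_le_one (x : Fin L → ℂ) (y : Fin R → Fin L → ℂ) :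
    channelDensity A ρ x y ≤ 1 := by
  unfold channelDensity
  calc _ ≤ ∫⁻ _, 1 ∂(complexGaussianVectors R Q) :=
        lintegral_mono fun s => gaussianDensity_le_one _
    _ = 1 := by simp

variable (μ : Measure (Fin L → ℂ)) [IsProbabilityMeasure μ]

lemma measurable_outputDensity : Measurable (outputDensity (R := R) A ρ μ) := by
  unfold outputDensity
  exact (measurable_channelDensity A ρ).lintegral_prod_left'

lemma outputDensity_pos (y : Fin R → Fin L → ℂ) : 0 < outputDensity A ρ μ y := by
  unfold outputDensity
  rw [lintegral_pos_iff_support ((measurable_channelDensity_left A ρ y))]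
  have : (Function.support fun x : Fin L → ℂ => channelDensity A ρ x y) = Set.univ := by
    ext s
    simpa using (channelDensity_pos A ρ s y).ne'
  rw [this]
  simp

lemma outputDensity_ne_top (y : Fin R → Fin L → ℂ) : outputDensity A ρ μ y ≠ ∞ := by
  refine ne_top_of_le_ne_top ENNReal.one_ne_top (b := 1) ?_
  unfold outputDensity
  calc _ ≤ ∫⁻ _, 1 ∂μ := lintegral_mono fun x => channelDensity_le_one A ρ x y
    _ = 1 := by simp

lemma measurable_output : Measurable fun p : (Fin L → ℂ) × (Fin R → Fin Q → ℂ) ×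
    (Fin R → Fin L → ℂ) => (p.1, output A ρ p.1 p.2.1 p.2.2) := by
  simp only [output_eq]
  fun_prop

instance : IsProbabilityMeasure (jointLaw A R ρ μ) :=
  Measure.isProbabilityMeasure_map (measurable_output A ρ).aemeasurable

/-- Integration over the fading and the noise, expressed through the output. -/
lemma lintegral_signal_add {g : (Fin R → Fin Q → ℂ) × (Fin R → Fin L → ℂ) → ℝ≥0∞}
    (hg : Measurable g) (x : Fin L → ℂ) :
    ∫⁻ q, g (q.1, signal A ρ x q.1 + q.2)
      ∂((complexGaussianVectors R Q).prod (complexGaussianVectors R L))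
      = ∫⁻ y, ∫⁻ s, gaussianDensity R L (y - signal A ρ x s) * g (s, y)
        ∂(complexGaussianVectors R Q) := by
  have hswap : AEMeasurable (Function.uncurry fun (y : Fin R → Fin L → ℂ)
      (s : Fin R → Fin Q → ℂ) => gaussianDensity R L (y - signal A ρ x s) * g (s, y))
      ((volume : Measure (Fin R → Fin L → ℂ)).prod (complexGaussianVectors R Q)) := by
    unfold Function.uncurry
    fun_prop
  rw [lintegral_prod _ (by fun_prop), lintegral_lintegral_swap hswap]
  refine lintegral_congr fun s => ?_
  exact lintegral_add_complexGaussianVectors (signal A ρ x s) (g := fun y => g (s, y)) (by fun_prop)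

lemma lintegral_jointLaw {g : (Fin L → ℂ) × (Fin R → Fin L → ℂ) → ℝ≥0∞} (hg : Measurable g) :
    ∫⁻ z, g z ∂(jointLaw A R ρ μ)
      = ∫⁻ x, ∫⁻ y, channelDensity A ρ x y * g (x, y) ∂volume ∂μ := by
  rw [jointLaw, lintegral_map hg (measurable_output A ρ)]
  simp only [output_eq]
  rw [lintegral_prod _ (by fun_prop)]
  refine lintegral_congr fun x => ?_
  dsimp only
  rw [lintegral_signal_add A ρ (g := fun q => g (x, q.2)) (by fun_prop)]
  refine lintegral_congr fun y => ?_
  dsimp only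
  rw [lintegral_mul_const _ (by fun_prop), channelDensity]

lemma jointLaw_eq_withDensity :
    jointLaw A R ρ μ = (μ.prod volume).withDensity (fun p => channelDensity A ρ p.1 p.2) := by
  refine Measure.ext_of_lintegral _ fun g hg => ?_
  rw [lintegral_jointLaw A ρ μ hg, lintegral_withDensity_eq_lintegral_mul _
    (measurable_channelDensity A ρ) hg, lintegral_prod]
  · rfl
  · exact ((measurable_channelDensity A ρ).mul hg).aemeasurable

lemma jointLaw_fst : (jointLaw A R ρ μ).fst = μ := by
  rw [Measure.fst, jointLaw, Measure.map_map measurable_fst (measurable_output A ρ)]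
  exact Measure.fst_prod

lemma jointLaw_snd : (jointLaw A R ρ μ).snd = volume.withDensity (outputDensity A ρ μ) := by
  refine Measure.ext_of_lintegral _ fun g hg => ?_
  rw [Measure.snd, lintegral_map hg measurable_snd, lintegral_jointLaw A ρ μ (by fun_prop),
    lintegral_withDensity_eq_lintegral_mul _ (measurable_outputDensity A ρ μ) hg,
    lintegral_lintegral_swap]
  · refine lintegral_congr fun y => ?_
    dsimp only
    rw [lintegral_mul_const _ (measurable_channelDensity_left A ρ y)]
    rfl
  · exact ((measurable_channelDensity A ρ).mul (hg.comp measurable_snd)).aemeasurable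

/-- The density of the joint law with respect to the product of its marginals. -/
def likelihoodRatio (p : (Fin L → ℂ) × (Fin R → Fin L → ℂ)) : ℝ≥0∞ :=
  channelDensity A ρ p.1 p.2 * (outputDensity A ρ μ p.2)⁻¹

lemma measurable_likelihoodRatio : Measurable (likelihoodRatio (R := R) A ρ μ) :=
  (measurable_channelDensity A ρ).mul
    (((measurable_outputDensity A ρ μ).comp measurable_snd).inv)

lemma jointLaw_eq_withDensity_likelihoodRatio :
    jointLaw A R ρ μ = ((jointLaw A R ρ μ).fst.prod (jointLaw A R ρ μ).snd).withDensity
      (likelihoodRatio A ρ μ) := by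
  have hs : SFinite ((volume : Measure (Fin R → Fin L → ℂ)).withDensity
    (outputDensity A ρ μ)) := inferInstance
  have hm : Measurable fun z : (Fin L → ℂ) × (Fin R → Fin L → ℂ) => outputDensity A ρ μ z.2 :=
    (measurable_outputDensity A ρ μ).comp measurable_snd
  rw [jointLaw_fst, jointLaw_snd, prod_withDensity_right (measurable_outputDensity A ρ μ),
    ← withDensity_mul _ hm
      (measurable_likelihoodRatio A ρ μ), jointLaw_eq_withDensity]
  congr 1
  ext p
  simp only [Pi.mul_apply, likelihoodRatio]
  rw [mul_comm, mul_assoc, ENNReal.inv_mul_cancel (outputDensity_pos A ρ μ p.2).ne'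
    (outputDensity_ne_top A ρ μ p.2), mul_one]

/-! ### The variational bounds specialized to the channel. -/

section Bounds

variable {U : Type*} [MeasurableSpace U] (η : Measure U) [IsProbabilityMeasure η]

/-- The additional randomness is independent of everything else, so adjoining it does not change the
law of input and output. This is what lets test functions depend on fading, noise and smearing
variables. -/
lemma map_prod_output : (μ.prod (((complexGaussianVectors R Q).prod
      (complexGaussianVectors R L)).prod η)).map
      (fun ω => (ω.1, signal A ρ ω.1 ω.2.1.1 + ω.2.1.2)) = jointLaw A R ρ μ := by
  refine Measure.ext_of_lintegral _ fun g hg => ?_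
  rw [lintegral_map hg (by fun_prop), jointLaw, lintegral_map hg (measurable_output A ρ)]
  simp only [output_eq]
  rw [lintegral_prod _ (by fun_prop), lintegral_prod _ (by fun_prop)]
  refine lintegral_congr fun x => ?_
  rw [lintegral_prod _ (by fun_prop)]
  simp

/-- Iterated form of an expectation over input, fading, noise and additional randomness. -/
lemma lintegral_prod_output {k : (Fin L → ℂ) × ((Fin R → Fin Q → ℂ) × (Fin R → Fin L → ℂ)) × U
      → ℝ≥0∞} (hk : Measurable k) {f : (Fin L → ℂ) × (Fin R → Fin L → ℂ) → ℝ≥0∞}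
    (hf : Measurable f) :
    ∫⁻ ω, k ω * f (ω.1, signal A ρ ω.1 ω.2.1.1 + ω.2.1.2) ∂(μ.prod (((complexGaussianVectors R Q).prod
      (complexGaussianVectors R L)).prod η))
    = ∫⁻ x, ∫⁻ y, (∫⁻ s, gaussianDensity R L (y - signal A ρ x s) *
        (∫⁻ u, k (x, (s, y - signal A ρ x s), u) ∂η) ∂(complexGaussianVectors R Q)) * f (x, y)
          ∂volume ∂μ := by
  rw [lintegral_prod _ (by fun_prop)]
  refine lintegral_congr fun x => ?_
  rw [lintegral_prod _ (by fun_prop)]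
  have hk' : Measurable fun p : ((Fin R → Fin Q → ℂ) × (Fin R → Fin L → ℂ)) × U =>
    k (x, (p.1.1, p.1.2 - signal A ρ x p.1.1), p.2) := by fun_prop
  have hk'' := hk'.lintegral_prod_right' (ν := η)
  have := lintegral_signal_add A ρ (g := fun q => (∫⁻ u, k (x, (q.1, q.2 - signal A ρ x q.1), u) ∂η)
    * f (x, q.2)) (by fun_prop) x
  simp only [add_sub_cancel_left] at this
  have h2 : ∀ q : (Fin R → Fin Q → ℂ) × (Fin R → Fin L → ℂ),
      ∫⁻ u, k (x, q, u) * f (x, signal A ρ x q.1 + q.2) ∂η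
      = (∫⁻ u, k (x, (q.1, q.2), u) ∂η) * f (x, signal A ρ x q.1 + q.2) := fun q => by
    rw [lintegral_mul_const _ (by fun_prop)]
  simp only
  simp_rw [h2]
  rw [this]
  refine lintegral_congr fun y => ?_
  rw [← lintegral_mul_const]
  · simp_rw [mul_assoc]
  · have : Measurable fun s : Fin R → Fin Q → ℂ =>
      ∫⁻ u, k (x, (s, y - signal A ρ x s), u) ∂η :=
      hk''.comp (measurable_id.prodMk measurable_const)
    fun_prop

/-- Lower bound on the mutual information (in nats) of input and output. -/
theorem le_klDiv_jointLaw
    {h : (Fin L → ℂ) × ((Fin R → Fin Q → ℂ) × (Fin R → Fin L → ℂ)) × U → ℝ}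
    (hm : Measurable h) (h0 : ∀ ω, 0 ≤ h ω) {B C H : ℝ} (hC0 : 0 ≤ C) (hH0 : 0 ≤ H)
    (hH : ∫⁻ ω, ENNReal.ofReal (h ω) ∂(μ.prod (((complexGaussianVectors R Q).prod
      (complexGaussianVectors R L)).prod η)) ≤ ENNReal.ofReal H)
    {G : (Fin L → ℂ) × (Fin R → Fin L → ℂ) → ℝ≥0∞} (hGm : Measurable G)
    (hG : ∀ᵐ x ∂μ, ∀ s y, ∫⁻ u, ENNReal.ofReal (Real.exp (B - h (x, (s, y - signal A ρ x s), u)))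
      ∂η ≤ G (x, y))
    (hC : ∀ y, ∫⁻ x, G (x, y) ∂μ ≤ ENNReal.ofReal C) :
    ENNReal.ofReal (B - H + 1 - C) ≤ InformationTheory.klDiv (jointLaw A R ρ μ)
      ((jointLaw A R ρ μ).fst.prod (jointLaw A R ρ μ).snd) := by
  refine le_klDiv_of_lintegral_exp_div_le (π := fun ω => (ω.1, signal A ρ ω.1 ω.2.1.1 + ω.2.1.2))
    (by fun_prop) (map_prod_output A ρ μ η) (measurable_likelihoodRatio A ρ μ)
    (jointLaw_eq_withDensity_likelihoodRatio A ρ μ) hm h0 hC0 hH0 hH ?_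
  rw [lintegral_prod_output A ρ μ η (k := fun ω => ENNReal.ofReal (Real.exp (B - h ω)))
    (f := fun p => (likelihoodRatio A ρ μ p)⁻¹) (by fun_prop) (measurable_likelihoodRatio A ρ μ).inv]
  have hstep : ∫⁻ x, ∫⁻ y, (∫⁻ s, gaussianDensity R L (y - signal A ρ x s) *
        (∫⁻ u, ENNReal.ofReal (Real.exp (B - h (x, (s, y - signal A ρ x s), u))) ∂η)
          ∂(complexGaussianVectors R Q)) * (likelihoodRatio A ρ μ (x, y))⁻¹ ∂volume ∂μ
      ≤ ∫⁻ x, ∫⁻ y, outputDensity A ρ μ y * G (x, y) ∂volume ∂μ := by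
    refine lintegral_mono_ae ?_
    filter_upwards [hG] with x hx
    refine lintegral_mono fun y => ?_
    calc _ ≤ (∫⁻ s, gaussianDensity R L (y - signal A ρ x s) * G (x, y)
          ∂(complexGaussianVectors R Q)) * (likelihoodRatio A ρ μ (x, y))⁻¹ := by
          gcongr with s
          exact hx s y
      _ = channelDensity A ρ x y * G (x, y) * (likelihoodRatio A ρ μ (x, y))⁻¹ := by
          rw [lintegral_mul_const _ (by fun_prop), channelDensity]
      -- Dividing by the likelihood ratio trades the channel density for the output density. The
      -- latter does not depend on `x`, so only the average of `G` over the input remains to be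
      -- bounded.
      _ = outputDensity A ρ μ y * G (x, y) := by
          rw [likelihoodRatio, ENNReal.mul_inv (Or.inl (channelDensity_pos A ρ x y).ne')
            (Or.inr (ENNReal.inv_ne_zero.2 (outputDensity_ne_top A ρ μ y))), inv_inv]
          calc _ = (channelDensity A ρ x y * (channelDensity A ρ x y)⁻¹) *
                (outputDensity A ρ μ y * G (x, y)) := by ring
            _ = _ := by
              rw [ENNReal.mul_inv_cancel (channelDensity_pos A ρ x y).ne'
                (ne_top_of_le_ne_top ENNReal.one_ne_top (channelDensity_le_one A ρ x y)), one_mul]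
  refine hstep.trans ?_
  rw [lintegral_lintegral_swap
    ((((measurable_outputDensity A ρ μ).comp measurable_snd).mul hGm).aemeasurable)]
  calc ∫⁻ y, ∫⁻ x, outputDensity A ρ μ y * G (x, y) ∂μ
      ≤ ∫⁻ y, outputDensity (R := R) A ρ μ y * ENNReal.ofReal C := by
        refine lintegral_mono fun y => ?_
        rw [lintegral_const_mul _ (by fun_prop)]
        gcongr
        exact hC y
    _ = ENNReal.ofReal C := by
        rw [lintegral_mul_const _ (measurable_outputDensity A ρ μ)]
        have h1 : (jointLaw A R ρ μ).snd Set.univ = 1 := measure_univ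
        rw [jointLaw_snd, withDensity_apply _ MeasurableSet.univ, Measure.restrict_univ] at h1
        rw [h1, one_mul]

/-- Upper bound on the mutual information (in nats) of input and output. -/
theorem klDiv_jointLaw_le
    {h : (Fin L → ℂ) × ((Fin R → Fin Q → ℂ) × (Fin R → Fin L → ℂ)) × U → ℝ}
    (hm : Measurable h) (h0 : ∀ ω, 0 ≤ h ω) {B C H : ℝ} (hC0 : 0 ≤ C) (hH0 : 0 ≤ H)
    (hH : ∫⁻ ω, ENNReal.ofReal (h ω) ∂(μ.prod (((complexGaussianVectors R Q).prod
      (complexGaussianVectors R L)).prod η)) ≤ ENNReal.ofReal H)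
    {G : (Fin R → Fin L → ℂ) → ℝ≥0∞} (hGm : Measurable G)
    (hG : ∀ x y, ∫⁻ s, gaussianDensity R L (y - signal A ρ x s) *
      (∫⁻ u, ENNReal.ofReal (Real.exp (-(B + h (x, (s, y - signal A ρ x s), u)))) ∂η)
        ∂(complexGaussianVectors R Q) ≤ G y)
    (hC : ∫⁻ y, G y ≤ ENNReal.ofReal C) :
    InformationTheory.klDiv (jointLaw A R ρ μ)
      ((jointLaw A R ρ μ).fst.prod (jointLaw A R ρ μ).snd) ≤ ENNReal.ofReal (B + H + C - 1) := by
  refine klDiv_le_of_lintegral_exp_mul_le (π := fun ω => (ω.1, signal A ρ ω.1 ω.2.1.1 + ω.2.1.2))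
    (by fun_prop) (map_prod_output A ρ μ η) (measurable_likelihoodRatio A ρ μ)
    (jointLaw_eq_withDensity_likelihoodRatio A ρ μ) hm h0 hC0 hH0 hH ?_
  rw [lintegral_prod_output A ρ μ η (k := fun ω => ENNReal.ofReal (Real.exp (-(B + h ω))))
    (f := likelihoodRatio A ρ μ) (by fun_prop) (measurable_likelihoodRatio A ρ μ)]
  refine le_trans ?_ hC
  calc _ ≤ ∫⁻ x, ∫⁻ y, G y * likelihoodRatio A ρ μ (x, y) ∂volume ∂μ := by
        gcongr with x y
        exact hG x y
    _ = ∫⁻ y, ∫⁻ x, G y * likelihoodRatio A ρ μ (x, y) ∂μ :=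
        lintegral_lintegral_swap
          ((hGm.comp measurable_snd).mul (measurable_likelihoodRatio A ρ μ)).aemeasurable
    _ = ∫⁻ y, G y := by
        -- For fixed `y` the likelihood ratio has `μ`-average one, so the input law disappears and
        -- the bound is uniform in it.
        refine lintegral_congr fun y => ?_
        have hm' : Measurable fun x => likelihoodRatio A ρ μ (x, y) :=
          (measurable_likelihoodRatio A ρ μ).comp (measurable_id.prodMk measurable_const)
        rw [lintegral_const_mul _ hm']
        simp only [likelihoodRatio]
        rw [lintegral_mul_const _ (measurable_channelDensity_left A ρ y)]
        change _ * (outputDensity A ρ μ y * _) = _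
        rw [ENNReal.mul_inv_cancel (outputDensity_pos A ρ μ y).ne'
          (outputDensity_ne_top A ρ μ y), mul_one]

end Bounds

end Channel

end SIMO

end

noncomputable section

namespace SIMO

/-! ### Logarithmic integrals of polynomials -/

/-- Subadditivity of the positive part. Zero factors do no harm because `log 0 = 0` makes the left
side vanish. -/
lemma ofReal_neg_log_mul_le (a b : ℝ) :
    ENNReal.ofReal (-Real.log (a * b)) ≤ ENNReal.ofReal (-Real.log a) +
      ENNReal.ofReal (-Real.log b) := by
  rcases eq_or_ne a 0 with rfl | ha
  · simp
  rcases eq_or_ne b 0 with rfl | hb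
  · simp
  rw [Real.log_mul ha hb, neg_add]
  exact ENNReal.ofReal_add_le

/-- In polar coordinates the area factor tames the singularity, since `r (-log r) ≤ 1` on `(0, 1]`.
For `r > 1` the truncation gives zero. -/
lemma lintegral_neg_log_norm_ne_top : ∫⁻ z : ℂ, ENNReal.ofReal (-Real.log ‖z‖) ≠ ∞ := by
  rw [← Complex.lintegral_comp_polarCoord_symm]
  refine ne_top_of_le_ne_top (b := ∫⁻ p : ℝ × ℝ,
    (Set.Icc 0 1 ×ˢ Set.Icc (-Real.pi) Real.pi).indicator (fun _ => 1) p) ?_ ?_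
  · rw [lintegral_indicator (measurableSet_Icc.prod measurableSet_Icc)]
    simp only [lintegral_const, one_mul, MeasurableSet.univ, Measure.restrict_apply,
      Set.univ_inter]
    exact (isCompact_Icc.prod isCompact_Icc).measure_lt_top.ne
  · rw [← lintegral_indicator polarCoord.open_target.measurableSet]
    refine lintegral_mono fun p => ?_
    by_cases hp : p ∈ polarCoord.target
    swap
    · rw [Set.indicator_of_notMem hp]; exact zero_le
    rw [Set.indicator_of_mem hp]
    simp only [polarCoord_target, Set.mem_prod, Set.mem_Ioi, Set.mem_Ioo] at hp
    rw [Complex.norm_polarCoord_symm, abs_of_pos hp.1, smul_eq_mul,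
      ← ENNReal.ofReal_mul hp.1.le]
    rcases le_or_gt p.1 1 with h1 | h1
    · have hmem : p ∈ Set.Icc (0 : ℝ) 1 ×ˢ Set.Icc (-Real.pi) Real.pi :=
        ⟨⟨hp.1.le, h1⟩, ⟨hp.2.1.le, hp.2.2.le⟩⟩
      rw [Set.indicator_of_mem hmem, ← ENNReal.ofReal_one]
      refine ENNReal.ofReal_le_ofReal ?_
      have := Real.log_le_sub_one_of_pos (inv_pos.2 hp.1)
      rw [Real.log_inv] at this
      calc p.1 * -Real.log p.1 ≤ p.1 * (p.1)⁻¹ := by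
            exact mul_le_mul_of_nonneg_left (by linarith) hp.1.le
        _ = 1 := mul_inv_cancel₀ hp.1.ne'
    · have : p.1 * -Real.log p.1 ≤ 0 :=
        mul_nonpos_of_nonneg_of_nonpos hp.1.le (neg_nonpos.2 (Real.log_nonneg h1.le))
      rw [ENNReal.ofReal_of_nonpos this]
      exact zero_le

/-- The logarithmic singularities of a polynomial are integrable over the unit disc, with a bound
depending only on the degree and the leading coefficient. -/
theorem lintegral_neg_log_norm_eval_le (p : Polynomial ℂ) :
    ∫⁻ τ in Metric.closedBall (0 : ℂ) 1, ENNReal.ofReal (-Real.log ‖p.eval τ‖)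
      ≤ ENNReal.ofReal (-Real.log ‖p.leadingCoeff‖) * volume (Metric.closedBall (0 : ℂ) 1)
        + p.natDegree * ∫⁻ z : ℂ, ENNReal.ofReal (-Real.log ‖z‖) := by
  set K := ∫⁻ z : ℂ, ENNReal.ofReal (-Real.log ‖z‖)
  -- After factoring over `ℂ`, each root costs at most `K` wherever it lies, by translation
  -- invariance. The bound is therefore blind to the lower coefficients.
  have hroots : ∀ S : Multiset ℂ, ∫⁻ τ in Metric.closedBall (0 : ℂ) 1,
      ENNReal.ofReal (-Real.log ‖(S.map fun r => τ - r).prod‖) ≤ S.card * K := by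
    intro S
    induction S using Multiset.induction_on with
    | empty => simp
    | cons r S ih =>
      simp only [Multiset.map_cons, Multiset.prod_cons, norm_mul, Multiset.card_cons]
      calc _ ≤ ∫⁻ τ in Metric.closedBall (0 : ℂ) 1, (ENNReal.ofReal (-Real.log ‖τ - r‖) +
            ENNReal.ofReal (-Real.log ‖(S.map fun r => τ - r).prod‖)) :=
            lintegral_mono fun τ => ofReal_neg_log_mul_le _ _
        _ ≤ K + S.card * K := by
            rw [lintegral_add_left (by fun_prop)]
            refine add_le_add ?_ ih
            refine (setLIntegral_le_lintegral _ _).trans ?_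
            exact (lintegral_sub_right_eq_self
              (fun z : ℂ => ENNReal.ofReal (-Real.log ‖z‖)) r).le
        _ = _ := by push_cast; ring
  have hp : ∀ τ, p.eval τ = p.leadingCoeff * (p.roots.map fun r => τ - r).prod := fun τ =>
    (IsAlgClosed.splits p).eval_eq_prod_roots τ
  calc _ ≤ ∫⁻ τ in Metric.closedBall (0 : ℂ) 1, (ENNReal.ofReal (-Real.log ‖p.leadingCoeff‖) +
            ENNReal.ofReal (-Real.log ‖(p.roots.map fun r => τ - r).prod‖)) := by
        refine lintegral_mono fun τ => ?_
        rw [hp τ, norm_mul]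
        exact ofReal_neg_log_mul_le _ _
    _ ≤ _ := by
        rw [lintegral_add_left (by fun_prop), setLIntegral_const]
        gcongr
        refine (hroots _).trans ?_
        gcongr
        exact p.card_roots'

/-! ### Gaussian averages of functions with controlled line averages -/

instance isAddHaarMeasure_volume_matrix (R n : ℕ) :
    (volume : Measure (Fin R → Fin n → ℂ)).IsAddHaarMeasure :=
  Measure.pi.isAddHaarMeasure _

lemma integrable_exp_neg_mul_sqNorm (R n : ℕ) {c : ℝ} (hc : 0 < c) :
    Integrable (fun y : Fin R → Fin n → ℂ => Real.exp (-(c * sqNorm y))) := by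
  have h1 : Integrable (fun y : Fin R → Fin n → ℂ => Real.exp (-sqNorm y)) := by
    have h2 : Integrable (fun y : Fin R → Fin n → ℂ =>
        (Real.pi⁻¹) ^ (R * n) * Real.exp (-sqNorm y)) := by
      have hp := Real.pi_pos
      refine ⟨by fun_prop, ?_⟩
      rw [hasFiniteIntegral_iff_ofReal (ae_of_all _ fun _ => by positivity)]
      have h3 : complexGaussianVectors R n Set.univ = 1 := measure_univ
      rw [complexGaussianVectors_eq_withDensity, withDensity_apply _ MeasurableSet.univ,
        Measure.restrict_univ] at h3
      unfold gaussianDensity at h3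
      rw [h3]
      exact ENNReal.one_lt_top
    exact (integrable_const_mul_iff (IsUnit.mk0 _ (by
      have := Real.pi_pos; positivity)) _).1 h2
  have h2 := h1.comp_smul (Real.sqrt_pos.2 hc).ne'
  refine h2.congr (ae_of_all _ fun y => ?_)
  simp only [sqNorm, Pi.smul_apply, norm_smul, mul_pow, Real.norm_eq_abs, sq_abs,
    Real.sq_sqrt hc.le, ← Finset.mul_sum]

/-- Shifting a Gaussian by a bounded vector costs a constant factor once the rate in the exponent is
halved. -/
lemma half_sqNorm_sub_le {R n : ℕ} (y w : Fin R → Fin n → ℂ) :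
    2⁻¹ * sqNorm y - sqNorm w ≤ sqNorm (y + w) := by
  simp only [sqNorm, Finset.mul_sum, ← Finset.sum_sub_distrib]
  gcongr with m _ i _
  have h1 : ‖y m i‖ ≤ ‖(y + w) m i‖ + ‖w m i‖ := by
    have := norm_sub_le ((y + w) m i) (w m i)
    simpa using this
  have h0 := norm_nonneg (y m i)
  nlinarith [sq_nonneg (‖(y + w) m i‖ - ‖w m i‖), norm_nonneg ((y + w) m i), norm_nonneg (w m i)]

lemma sqNorm_add_le {R n : ℕ} (y w : Fin R → Fin n → ℂ) :
    sqNorm (y + w) ≤ 2 * sqNorm y + 2 * sqNorm w := by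
  simp only [sqNorm, Finset.mul_sum, ← Finset.sum_add_distrib]
  gcongr with m _ i _
  have h1 : ‖(y + w) m i‖ ≤ ‖y m i‖ + ‖w m i‖ := norm_add_le _ _
  nlinarith [sq_nonneg (‖y m i‖ - ‖w m i‖), norm_nonneg ((y + w) m i)]

lemma sqNorm_le_of_norm_le_one {R n : ℕ} {v : Fin R → Fin n → ℂ} (hv : ‖v‖ ≤ 1) :
    sqNorm v ≤ R * n := by
  have h : ∀ m i, ‖v m i‖ ^ 2 ≤ 1 := fun m i =>
    pow_le_one₀ (norm_nonneg _) (((norm_le_pi_norm (v m) i).trans (norm_le_pi_norm v m)).trans hv)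
  calc sqNorm v ≤ ∑ _m : Fin R, ∑ _i : Fin n, (1 : ℝ) := by
        unfold sqNorm; gcongr with m _ i _; exact h m i
    _ = R * n := by simp

/-- If a function has bounded averages over all discs in direction `s₀`, then it has bounded
expectation under all bounded translates of the Gaussian law. -/
theorem exists_lintegral_add_le_of_line_average {R n : ℕ}
    {ℓ : (Fin R → Fin n → ℂ) → ℝ≥0∞} (hℓ : Measurable ℓ) (s₀ : Fin R → Fin n → ℂ) {K : ℝ≥0∞}
    (hK : K ≠ ∞) (hav : ∀ s, ∫⁻ τ in Metric.closedBall (0 : ℂ) 1, ℓ (s + τ • s₀) ≤ K) :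
    ∃ C : ℝ≥0, ∀ v : Fin R → Fin n → ℂ, ‖v‖ ≤ 1 →
      ∫⁻ s, ℓ (v + s) ∂(complexGaussianVectors R n) ≤ C := by
  set V := volume (Metric.closedBall (0 : ℂ) 1) with hV
  have hV0 : V ≠ 0 := (Metric.measure_closedBall_pos volume _ one_pos).ne'
  have hVt : V ≠ ∞ := (isCompact_closedBall _ _).measure_lt_top.ne
  -- An upper bound for `sqNorm (τ • s₀ - v)` over `‖τ‖ ≤ 1` and `‖v‖ ≤ 1`.
  set M : ℝ := 2 * sqNorm s₀ + 2 * (R * n) with hM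
  set I := ∫⁻ y : Fin R → Fin n → ℂ, ENNReal.ofReal (Real.exp (-(2⁻¹ * sqNorm y))) with hI
  have hIt : I ≠ ∞ := ((hasFiniteIntegral_iff_ofReal
    (ae_of_all _ fun _ => (Real.exp_pos _).le)).1
      (integrable_exp_neg_mul_sqNorm R n (c := 2⁻¹) (by norm_num)).2).ne
  have hCt : V⁻¹ * (ENNReal.ofReal (Real.exp M) * I * K) ≠ ∞ := by
    refine ENNReal.mul_ne_top (ENNReal.inv_ne_top.2 hV0) ?_
    exact ENNReal.mul_ne_top (ENNReal.mul_ne_top ENNReal.ofReal_ne_top hIt) hK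
  refine ⟨(V⁻¹ * (ENNReal.ofReal (Real.exp M) * I * K)).toNNReal, fun v hv => ?_⟩
  rw [ENNReal.coe_toNNReal hCt, lintegral_add_complexGaussianVectors v hℓ]
  set E := ∫⁻ y, gaussianDensity R n (y - v) * ℓ y with hE
  have hbound : ∀ τ ∈ Metric.closedBall (0 : ℂ) 1, E ≤ ∫⁻ y : Fin R → Fin n → ℂ,
      ENNReal.ofReal (Real.exp M) * ENNReal.ofReal (Real.exp (-(2⁻¹ * sqNorm y))) *
        ℓ (y + τ • s₀) := by
    intro τ hτ
    -- `E` does not depend on `τ`, so it may be shifted by `τ • s₀` and averaged over the disc.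
    -- Tonelli then brings in the line averages of `ℓ`.
    rw [hE, ← lintegral_add_right_eq_self _ (τ • s₀)]
    refine lintegral_mono fun y => ?_
    gcongr
    refine (gaussianDensity_le_exp _).trans ?_
    rw [← ENNReal.ofReal_mul (Real.exp_pos _).le, ← Real.exp_add]
    refine ENNReal.ofReal_le_ofReal (Real.exp_le_exp.2 ?_)
    have h1 := half_sqNorm_sub_le y (τ • s₀ + -v)
    have h2 := sqNorm_add_le (τ • s₀) (-v)
    have h3 : sqNorm (τ • s₀) ≤ sqNorm s₀ := by
      unfold sqNorm
      gcongr with m _ i _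
      simp only [Pi.smul_apply, norm_smul]
      exact mul_le_of_le_one_left (norm_nonneg _) (by simpa using hτ)
    have h4 : sqNorm (-v) ≤ R * n := sqNorm_le_of_norm_le_one (by simpa using hv)
    have h5 : y + τ • s₀ - v = y + (τ • s₀ + -v) := by abel
    rw [h5]
    linarith
  have hmeas : Measurable fun p : ℂ × (Fin R → Fin n → ℂ) => ℓ (p.2 + p.1 • s₀) := by fun_prop
  have key : V * E ≤ ENNReal.ofReal (Real.exp M) * I * K := by
    calc V * E = ∫⁻ _ in Metric.closedBall (0 : ℂ) 1, E := by
          rw [setLIntegral_const, mul_comm]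
      _ ≤ ∫⁻ τ in Metric.closedBall (0 : ℂ) 1, ∫⁻ y : Fin R → Fin n → ℂ,
          ENNReal.ofReal (Real.exp M) * ENNReal.ofReal (Real.exp (-(2⁻¹ * sqNorm y))) *
          ℓ (y + τ • s₀) := setLIntegral_mono' measurableSet_closedBall hbound
      _ = ∫⁻ y : Fin R → Fin n → ℂ, ∫⁻ τ in Metric.closedBall (0 : ℂ) 1,
          ENNReal.ofReal (Real.exp M) * ENNReal.ofReal (Real.exp (-(2⁻¹ * sqNorm y))) *
          ℓ (y + τ • s₀) := by
          refine lintegral_lintegral_swap (Measurable.aemeasurable ?_)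
          unfold Function.uncurry
          fun_prop
      _ ≤ ∫⁻ y : Fin R → Fin n → ℂ, ENNReal.ofReal (Real.exp M) *
          ENNReal.ofReal (Real.exp (-(2⁻¹ * sqNorm y))) * K := by
          refine lintegral_mono fun y => ?_
          rw [lintegral_const_mul _ (by fun_prop)]
          gcongr
          exact hav y
      _ = _ := by
          rw [lintegral_mul_const _ (by fun_prop), lintegral_const_mul _ (by fun_prop)]
  calc E = V⁻¹ * (V * E) := by rw [← mul_assoc, ENNReal.inv_mul_cancel hV0 hVt, one_mul]
    _ ≤ _ := by gcongr

/-- Up to bounded nonzero factors, the function `D` restricts to polynomials of degree at most `N`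
with coefficient `κ` of degree `N` on the lines in direction `s₀`. -/
def IsPolynomialAlong {R n : ℕ} (D : (Fin R → Fin n → ℂ) → ℂ) (s₀ : Fin R → Fin n → ℂ) (N : ℕ)
    (κ : ℂ) : Prop :=
  ∀ s, ∃ (p : Polynomial ℂ) (w : ℂ → ℂ), p.natDegree ≤ N ∧ p.coeff N = κ ∧
    ∀ τ : ℂ, τ ≠ 0 → ‖τ‖ ≤ 1 → w τ ≠ 0 ∧ ‖w τ‖ ≤ 1 ∧ p.eval τ = w τ * D (s + τ • s₀)

lemma ae_restrict_closedBall_ne_zero :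
    ∀ᵐ τ : ℂ ∂(volume.restrict (Metric.closedBall (0 : ℂ) 1)), τ ≠ 0 ∧ ‖τ‖ ≤ 1 := by
  have hne : ∀ᵐ τ : ℂ ∂(volume.restrict (Metric.closedBall (0 : ℂ) 1)), τ ≠ 0 :=
    ae_restrict_of_ae (by simp [ae_iff])
  filter_upwards [hne, ae_restrict_mem measurableSet_closedBall] with τ h0 h1
  exact ⟨h0, by simpa using h1⟩

/-- Bounded Gaussian expectation of `log⁻ ‖D‖`. -/
theorem IsPolynomialAlong.exists_lintegral_neg_log_le {R n : ℕ} {D : (Fin R → Fin n → ℂ) → ℂ}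
    (hD : Measurable D) {s₀ : Fin R → Fin n → ℂ} {N : ℕ} {κ : ℂ}
    (hp : IsPolynomialAlong D s₀ N κ) (hκ : κ ≠ 0) :
    ∃ C : ℝ≥0, ∀ v : Fin R → Fin n → ℂ, ‖v‖ ≤ 1 →
      ∫⁻ s, ENNReal.ofReal (-Real.log ‖D (v + s)‖) ∂(complexGaussianVectors R n) ≤ C := by
  refine exists_lintegral_add_le_of_line_average
    (ℓ := fun s => ENNReal.ofReal (-Real.log ‖D s‖)) (by fun_prop) s₀
    (K := ENNReal.ofReal (-Real.log ‖κ‖) * volume (Metric.closedBall (0 : ℂ) 1)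
        + N * ∫⁻ z : ℂ, ENNReal.ofReal (-Real.log ‖z‖)) ?_ fun s => ?_
  · refine ENNReal.add_ne_top.2 ⟨ENNReal.mul_ne_top ENNReal.ofReal_ne_top
      (isCompact_closedBall _ _).measure_lt_top.ne, ENNReal.mul_ne_top (by simp)
        lintegral_neg_log_norm_ne_top⟩
  · obtain ⟨p, w, hdeg, hcoeff, hle⟩ := hp s
    have hdeg' : p.natDegree = N := le_antisymm hdeg
      (Polynomial.le_natDegree_of_ne_zero (by rw [hcoeff]; exact hκ))
    have hlc : p.leadingCoeff = κ := by rw [Polynomial.leadingCoeff, hdeg', hcoeff]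
    have h := lintegral_neg_log_norm_eval_le p
    rw [hdeg', hlc] at h
    refine le_trans (lintegral_mono_ae ?_) h
    filter_upwards [ae_restrict_closedBall_ne_zero] with τ hτ
    obtain ⟨h2, h3, h4⟩ := hle τ hτ.1 hτ.2
    -- At zeros of `D` the convention `log 0 = 0` makes the integrand vanish. Elsewhere `‖w τ‖ ≤ 1`
    -- gives `‖p.eval τ‖ ≤ ‖D‖`.
    by_cases hDτ : D (s + τ • s₀) = 0
    · simp [hDτ]
    · refine ENNReal.ofReal_le_ofReal (neg_le_neg ?_)
      rw [h4, norm_mul]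
      exact Real.log_le_log (mul_pos (norm_pos_iff.2 h2) (norm_pos_iff.2 hDτ))
        (mul_le_of_le_one_left (norm_nonneg _) h3)

/-- The averaging lemma is applied to `∞` times the indicator of the zero set. Each disc in
direction `s₀` meets that set only in roots of a nonzero polynomial and possibly `τ = 0`, hence the
bound is zero. -/
theorem IsPolynomialAlong.ae_ne_zero {R n : ℕ} {D : (Fin R → Fin n → ℂ) → ℂ}
    (hD : Measurable D) {s₀ : Fin R → Fin n → ℂ} {N : ℕ} {κ : ℂ}
    (hp : IsPolynomialAlong D s₀ N κ) (hκ : κ ≠ 0) : ∀ᵐ s, D s ≠ 0 := by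
  have hset : MeasurableSet {s | D s = 0} := hD (measurableSet_singleton 0)
  obtain ⟨C, hC⟩ := exists_lintegral_add_le_of_line_average
    (ℓ := {s | D s = 0}.indicator fun _ => ∞) (measurable_const.indicator hset) s₀
    (K := 0) ENNReal.zero_ne_top fun s => by
      obtain ⟨p, w, -, hcoeff, hle⟩ := hp s
      have hp0 : p ≠ 0 := by
        rintro rfl
        exact hκ (by simpa using hcoeff.symm)
      have hroots : ∀ᵐ τ : ℂ ∂(volume.restrict (Metric.closedBall (0 : ℂ) 1)), p.eval τ ≠ 0 := by
        refine ae_restrict_of_ae ?_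
        rw [ae_iff]
        refine measure_mono_null (t := (p.roots.toFinset : Set ℂ)) (fun τ hτ => ?_)
          (p.roots.toFinset.finite_toSet.measure_zero _)
        simpa [hp0] using hτ
      rw [nonpos_iff_eq_zero, ← lintegral_zero (μ := volume.restrict (Metric.closedBall (0 : ℂ) 1))]
      refine lintegral_congr_ae ?_
      filter_upwards [hroots, ae_restrict_closedBall_ne_zero] with τ h1 hτ
      refine Set.indicator_of_notMem (fun hmem => h1 ?_) _
      rw [(hle τ hτ.1 hτ.2).2.2, show D (s + τ • s₀) = 0 from hmem, mul_zero]
  have h0 := hC 0 (by simp)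
  simp only [zero_add] at h0
  have h1 : ∀ᵐ s ∂(complexGaussianVectors R n), D s ≠ 0 := by
    filter_upwards [ae_lt_top (measurable_const.indicator hset)
      (ne_top_of_le_ne_top ENNReal.coe_ne_top h0)] with s hs h
    rw [Set.indicator_of_mem (show s ∈ {s | D s = 0} from h)] at hs
    exact lt_irrefl _ hs
  rw [complexGaussianVectors_eq_withDensity] at h1
  exact (withDensity_absolutelyContinuous' (measurable_gaussianDensity R n).aemeasurable
    (ae_of_all _ fun y => (gaussianDensity_pos y).ne')).ae_le h1

end SIMO

end

noncomputable section

namespace SIMO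

/-! ### Generic solvability of the linearized input-output relation -/

section Genericity

variable {L Q : ℕ} (A : Matrix (Fin L) (Fin Q) ℂ)

lemma bijective_mulVec_restrict {S : Finset (Fin L)} (hS : S.card = Q)
    (hli : LinearIndependent ℂ (fun i : S => A.row i)) :
    Function.Bijective fun (t : Fin Q → ℂ) (i : S) => (A *ᵥ t) i := by
  set B : Matrix S (Fin Q) ℂ := A.submatrix (fun i : S => (i : Fin L)) id with hB
  have hrank : B.rank = Fintype.card S := LinearIndependent.rank_matrix (M := B) hli
  have hfin : Module.finrank ℂ (Fin Q → ℂ) = Module.finrank ℂ (S → ℂ) := by simp [hS]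
  have hsurj : Function.Surjective B.mulVecLin := by
    rw [← LinearMap.range_eq_top]
    refine Submodule.eq_top_of_finrank_eq ?_
    rw [← Matrix.rank, hrank]
    simp
  have hinj := (LinearMap.injective_iff_surjective_of_finrank_eq_finrank hfin).2 hsurj
  exact ⟨hinj, hsurj⟩

/-- A fading vector vanishing on `Q - 1` given rows forces the input perturbation to be constant
on the remaining rows. -/
lemma exists_fading_constant {K T : Finset (Fin L)} (hTK : T ⊆ K) {i₀ : Fin L} (hi₀ : i₀ ∈ T)
    (hcard : (K \ T).card + 1 = Q)
    (hK : ∀ S ⊆ K, S.card = Q → LinearIndependent ℂ (fun i : S => A.row i)) :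
    ∃ s : Fin Q → ℂ, ∀ (δ : Fin L → ℂ) (t : Fin Q → ℂ),
      (∀ i ∈ K, δ i * (A *ᵥ s) i + (A *ᵥ t) i = 0) → ∀ i ∈ T, δ i = δ i₀ := by
  classical
  have hbij : ∀ i ∈ T, Function.Bijective
      fun (t : Fin Q → ℂ) (j : (insert i (K \ T) : Finset (Fin L))) => (A *ᵥ t) j := by
    intro i hi
    have hcard' : (insert i (K \ T)).card = Q := by
      rw [Finset.card_insert_of_notMem (by simp [hi]), hcard]
    exact bijective_mulVec_restrict A hcard' (hK _ (Finset.insert_subset (hTK hi)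
      Finset.sdiff_subset) hcard')
  have hinj : ∀ i ∈ T, ∀ t : Fin Q → ℂ, (A *ᵥ t) i = 0 → (∀ j ∈ K \ T, (A *ᵥ t) j = 0) → t = 0 := by
    intro i hi t h1 h2
    refine (hbij i hi).1 ?_
    funext ⟨j, hj⟩
    rcases Finset.mem_insert.1 hj with rfl | hj
    · simpa using h1
    · simpa using h2 j hj
  -- The rows outside `T` number `Q - 1`, so they together with `i₀` can be prescribed freely. The
  -- gain is then nonzero on all of `T`, since vanishing on `Q` rows of `K` forces `s = 0`.
  obtain ⟨s, hs⟩ := (hbij i₀ hi₀).2 fun j => if (j : Fin L) = i₀ then 1 else 0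
  have hs0 : (A *ᵥ s) i₀ = 1 := by
    simpa using congrFun hs ⟨i₀, Finset.mem_insert_self _ _⟩
  have hsz : ∀ j ∈ K \ T, (A *ᵥ s) j = 0 := by
    intro j hj
    have hne : j ≠ i₀ := by rintro rfl; simp [hi₀] at hj
    simpa [hne] using congrFun hs ⟨j, Finset.mem_insert_of_mem hj⟩
  have hsT : ∀ i ∈ T, (A *ᵥ s) i ≠ 0 := by
    intro i hi h
    have := hinj i hi s h hsz
    simp [this] at hs0
  refine ⟨s, fun δ t h i hi => ?_⟩
  -- Outside `T` the equations read `(A t)_j = 0`, so `t` must be a multiple of `s`, and row `i₀`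
  -- fixes the factor.
  have ht : t + δ i₀ • s = 0 := by
    refine hinj i₀ hi₀ _ ?_ fun j hj => ?_
    · have := h i₀ (hTK hi₀)
      simp only [Matrix.mulVec_add, Matrix.mulVec_smul, Pi.add_apply, Pi.smul_apply, smul_eq_mul]
      linear_combination this
    · have := h j (Finset.mem_sdiff.1 hj).1
      rw [hsz j hj] at this
      simp only [Matrix.mulVec_add, Matrix.mulVec_smul, Pi.add_apply, Pi.smul_apply, smul_eq_mul,
        hsz j hj]
      linear_combination this
  have hi' := h i (hTK hi)
  rw [eq_neg_of_add_eq_zero_left ht] at hi'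
  simp only [Matrix.mulVec_neg, Matrix.mulVec_smul, Pi.neg_apply, Pi.smul_apply, smul_eq_mul] at hi'
  have : (δ i - δ i₀) * (A *ᵥ s) i = 0 := by linear_combination hi'
  exact sub_eq_zero.1 ((mul_eq_zero.1 this).resolve_right (hsT i hi))

/-- With `R` fading vectors, the input perturbation is constant on `R (|K| - Q) + 1` rows. -/
lemma exists_fadings_constant {K : Finset (Fin L)} {N R : ℕ} (hN : K.card = N) (hQ : 1 ≤ Q)
    (hQN : Q ≤ N) (hR : 1 ≤ R)
    (hK : ∀ S ⊆ K, S.card = Q → LinearIndependent ℂ (fun i : S => A.row i)) :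
    ∃ s : Fin R → Fin Q → ℂ, ∀ (δ : Fin L → ℂ) (t : Fin R → Fin Q → ℂ),
      (∀ m, ∀ i ∈ K, δ i * (A *ᵥ s m) i + (A *ᵥ t m) i = 0) →
      ∀ j : Fin N, (j : ℕ) ≤ R * (N - Q) →
        δ (K.orderEmbOfFin hN j) = δ (K.orderEmbOfFin hN ⟨0, by omega⟩) := by
  classical
  set e := K.orderEmbOfFin hN with he
  set d := N - Q with hd
  -- Antenna `m` controls the window of `d + 1` rows starting at `a m`. Consecutive windows share a
  -- row because `a (m + 1) ≤ a m + d`, and the cap `Q - 1` keeps the last row at `N - 1` at most.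
  set a : ℕ → ℕ := fun m => min (m * d) (Q - 1) with ha
  have haN : ∀ m, a m + d < N := fun m => by
    have : a m ≤ Q - 1 := min_le_right _ _
    omega
  have hex : ∀ m : ℕ, ∃ s : Fin Q → ℂ, ∀ (δ : Fin L → ℂ) (t : Fin Q → ℂ),
      (∀ i ∈ K, δ i * (A *ᵥ s) i + (A *ᵥ t) i = 0) →
      ∀ j : Fin N, a m ≤ j → (j : ℕ) ≤ a m + d →
        δ (e j) = δ (e ⟨a m, by have := haN m; omega⟩) := by
    intro m
    have ham := haN m
    set I : Finset (Fin N) := Finset.Icc ⟨a m, by omega⟩ ⟨a m + d, ham⟩ with hI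
    have hTK : I.map e.toEmbedding ⊆ K := by
      intro i hi
      obtain ⟨j, -, rfl⟩ := Finset.mem_map.1 hi
      exact Finset.orderEmbOfFin_mem K hN j
    have hcard : (K \ I.map e.toEmbedding).card + 1 = Q := by
      rw [Finset.card_sdiff_of_subset hTK, Finset.card_map, hN, hI, Fin.card_Icc]
      simp only
      omega
    obtain ⟨s, hs⟩ := exists_fading_constant A hTK
      (i₀ := e ⟨a m, by omega⟩) (Finset.mem_map_of_mem _ (by simp [hI, Fin.le_def])) hcard hK
    exact ⟨s, fun δ t h j h1 h2 => hs δ t h _ (Finset.mem_map_of_mem _ (by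
      rw [hI, Finset.mem_Icc, Fin.le_def, Fin.le_def]; exact ⟨h1, h2⟩))⟩
  choose s hs using hex
  refine ⟨fun m => s m, fun δ t h => ?_⟩
  have key : ∀ m, m < R → ∀ j : Fin N, (j : ℕ) ≤ a m + d → δ (e j) = δ (e ⟨0, by omega⟩) := by
    intro m
    induction m with
    | zero =>
      intro hm j hj
      have h0 : a 0 = 0 := by simp [ha]
      have := hs 0 δ (t ⟨0, hm⟩) (h ⟨0, hm⟩) j (by omega) hj
      simpa only [h0] using this
    | succ m ih =>
      intro hm j hj
      rcases lt_or_ge (j : ℕ) (a (m + 1)) with hlt | hge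
      · refine ih (by omega) j ?_
        have : a (m + 1) ≤ a m + d := by
          simp only [ha, add_mul, one_mul]; omega
        omega
      · rw [hs (m + 1) δ (t ⟨m + 1, hm⟩) (h ⟨m + 1, hm⟩) j hge hj]
        refine ih (by omega) _ ?_
        simp only [ha, add_mul, one_mul]; omega
  intro j hj
  refine key (R - 1) (by omega) j ?_
  have h1 : (R - 1) * d + d = R * d := by
    obtain ⟨r, rfl⟩ : ∃ r, R = r + 1 := ⟨R - 1, by omega⟩
    simp [add_mul]
  have := j.2
  simp only [ha]
  omega

lemma eq_zero_of_mulVec_eq_zero {K : Finset (Fin L)} (hQN : Q ≤ K.card)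
    (hK : ∀ S ⊆ K, S.card = Q → LinearIndependent ℂ (fun i : S => A.row i)) {t : Fin Q → ℂ}
    (ht : ∀ i ∈ K, (A *ᵥ t) i = 0) : t = 0 := by
  obtain ⟨S, hSK, hS⟩ := Finset.exists_subset_card_eq hQN
  refine (bijective_mulVec_restrict A hS (hK S hSK hS)).1 ?_
  funext i
  simpa using ht i (hSK i.2)

/-- All `L` rows satisfy the independence property and there are few observations. -/
theorem exists_injective_of_univ {R : ℕ} (hQ : 1 ≤ Q) (hQL : Q ≤ L) (hR : 1 ≤ R)
    (hRL : R * (L - Q) < L)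
    (hK : ∀ S : Finset (Fin L), S.card = Q → LinearIndependent ℂ (fun i : S => A.row i)) :
    ∃ (P : Finset (Fin L)) (s : Fin R → Fin Q → ℂ), P.card = R * (L - Q) ∧
      ∀ (δ : Fin L → ℂ) (t : Fin R → Fin Q → ℂ), (∀ i ∉ P, δ i = 0) →
        (∀ m i, δ i * (A *ᵥ s m) i + (A *ᵥ t m) i = 0) → δ = 0 ∧ t = 0 := by
  classical
  have hN : (Finset.univ : Finset (Fin L)).card = L := by simp
  obtain ⟨s, hs⟩ := exists_fadings_constant A hN hQ hQL hR (fun S _ => hK S)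
  set e := (Finset.univ : Finset (Fin L)).orderEmbOfFin hN with he
  -- Position `0` is left out: as a pilot it fixes the common value of `δ` on positions `0` to `R (L
  -- - Q)`. Later positions are pilots as well.
  set P := (Finset.Ioc (⟨0, by omega⟩ : Fin L) ⟨R * (L - Q), hRL⟩).map e.toEmbedding with hP
  refine ⟨P, s, by simp [hP], fun δ t h0 h => ?_⟩
  have hsurj : Function.Surjective e := Finite.injective_iff_surjective.1 e.injective
  have hδ0 : δ (e ⟨0, by omega⟩) = 0 := h0 _ (by simp [hP])
  have hδ : δ = 0 := by
    funext i
    obtain ⟨j, rfl⟩ := hsurj i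
    rcases le_or_gt (j : ℕ) (R * (L - Q)) with hj | hj
    · rw [hs δ t (fun m i _ => h m i) j hj, hδ0]; rfl
    · refine h0 _ ?_
      simp only [hP, Finset.mem_map, Finset.mem_Ioc, Fin.lt_def, Fin.le_def,
        not_exists, not_and]
      intro j' hj' hjj
      have : j' = j := e.injective hjj
      subst this
      omega
  refine ⟨hδ, funext fun m => ?_⟩
  refine eq_zero_of_mulVec_eq_zero A (K := Finset.univ) (by simpa using hQL) (fun S _ => hK S)
    fun i _ => ?_
  simpa [hδ] using h m i

/-- Each nonzero row excludes a proper subspace, and finitely many proper subspaces over an infinite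
field do not cover the space. -/
lemma exists_forall_mulVec_ne_zero (hrow : ∀ i, A.row i ≠ 0) :
    ∃ v : Fin Q → ℂ, ∀ i, (A *ᵥ v) i ≠ 0 := by
  by_contra hcon
  push Not at hcon
  set p : Fin L → Submodule ℂ (Fin Q → ℂ) := fun i =>
    LinearMap.ker ((LinearMap.proj i).comp A.mulVecLin) with hp
  have hcover : ⋃ i, (p i : Set (Fin Q → ℂ)) = Set.univ := by
    ext v
    obtain ⟨i, hi⟩ := hcon v
    simp only [Set.mem_iUnion, Set.mem_univ, iff_true]
    exact ⟨i, by simpa [hp] using hi⟩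
  obtain ⟨i, hi⟩ := Subspace.exists_eq_top_of_iUnion_eq_univ hcover
  apply hrow i
  funext j
  have : Pi.single j (1 : ℂ) ∈ p i := by rw [hi]; trivial
  simpa [hp] using this

/-- A small perturbation of an injective linear map along a line stays injective. -/
lemma eventually_injective_add_smul {E F : Type*} [NormedAddCommGroup E] [NormedSpace ℂ E]
    [FiniteDimensional ℂ E] [AddCommGroup F] [Module ℂ F] {Φ Ψ : E →ₗ[ℂ] F}
    (hΦ : Function.Injective Φ) :
    ∀ᶠ τ : ℂ in 𝓝[≠] 0, Function.Injective (Φ + τ • Ψ) := by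
  obtain ⟨G, hG⟩ := Φ.exists_leftInverse_of_injective (LinearMap.ker_eq_bot.2 hΦ)
  -- For a left inverse `G` of `Φ` one has `G (Φ + τ Ψ) = 1 + τ M`, which is injective as soon as
  -- `‖τ‖ ‖M‖ < 1`.
  set M : E →L[ℂ] E := LinearMap.toContinuousLinearMap (G.comp Ψ) with hM
  have hcont : ∀ᶠ τ : ℂ in 𝓝[≠] 0, ‖τ‖ * ‖M‖ < 1 := by
    have h1 : Tendsto (fun τ : ℂ => ‖τ‖ * ‖M‖) (𝓝[≠] 0) (𝓝 (‖(0 : ℂ)‖ * ‖M‖)) :=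
      (Continuous.tendsto (by fun_prop) 0).mono_left nhdsWithin_le_nhds
    exact h1.eventually (gt_mem_nhds (by simp))
  filter_upwards [hcont] with τ hτ
  rw [← LinearMap.ker_eq_bot, LinearMap.ker_eq_bot']
  intro z hz
  have h1 : z + τ • M z = 0 := by
    have h2 := congrArg G hz
    have h3 : G (Φ z) = z := LinearMap.congr_fun hG z
    simpa [h3, hM] using h2
  have h2 : ‖z‖ ≤ ‖τ‖ * ‖M‖ * ‖z‖ := by
    calc ‖z‖ = ‖τ • M z‖ := by rw [← norm_neg (τ • M z), ← eq_neg_of_add_eq_zero_left h1]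
      _ ≤ ‖τ‖ * (‖M‖ * ‖z‖) := by
        rw [norm_smul]; gcongr; exact M.le_opNorm z
      _ = _ := by ring
  by_contra hne
  have := norm_pos_iff.2 hne
  nlinarith

/-- There are enough observations on `K` to determine everything up to scaling. -/
theorem exists_injective_of_subset {K : Finset (Fin L)} {N R : ℕ} (hN : K.card = N) (hQ : 1 ≤ Q)
    (hQN : Q ≤ N) (hR : 1 ≤ R) (hRN : N - 1 ≤ R * (N - Q)) (hrow : ∀ i, A.row i ≠ 0)
    (hK : ∀ S ⊆ K, S.card = Q → LinearIndependent ℂ (fun i : S => A.row i)) :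
    ∃ (P : Finset (Fin L)) (s : Fin R → Fin Q → ℂ), P.card = L - 1 ∧
      ∀ (δ : Fin L → ℂ) (t : Fin R → Fin Q → ℂ), (∀ i ∉ P, δ i = 0) →
        (∀ m i, δ i * (A *ᵥ s m) i + (A *ᵥ t m) i = 0) → δ = 0 ∧ t = 0 := by
  classical
  obtain ⟨s, hs⟩ := exists_fadings_constant A hN hQ hQN hR hK
  set e := K.orderEmbOfFin hN with he
  set i₀ := e ⟨0, by omega⟩ with hi₀
  have hi₀K : i₀ ∈ K := Finset.orderEmbOfFin_mem K hN _
  have hconst : ∀ (δ : Fin L → ℂ) (t : Fin R → Fin Q → ℂ), δ i₀ = 0 →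
      (∀ m, ∀ i ∈ K, δ i * (A *ᵥ s m) i + (A *ᵥ t m) i = 0) → (∀ i ∈ K, δ i = 0) ∧ t = 0 := by
    intro δ t h0 h
    have hδ : ∀ i ∈ K, δ i = 0 := by
      intro i hi
      have : i ∈ Set.range e := by rw [he, Finset.range_orderEmbOfFin]; exact hi
      obtain ⟨j, rfl⟩ := this
      rw [hs δ t h j (by have := j.2; omega), h0]
    refine ⟨hδ, funext fun m => eq_zero_of_mulVec_eq_zero A (hN ▸ hQN) hK fun i hi => ?_⟩
    simpa [hδ i hi] using h m i hi
  obtain ⟨v, hv⟩ := exists_forall_mulVec_ne_zero A hrow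
  -- the equations on `K`, completed by the remaining coordinates
  let Φ : ((Fin L → ℂ) × (Fin R → Fin Q → ℂ)) →ₗ[ℂ] ((Fin L → ℂ) × (Fin R → Fin L → ℂ)) :=
    { toFun := fun z => (fun i => if i ∈ K ∧ i ≠ i₀ then 0 else z.1 i,
        fun m i => if i ∈ K then z.1 i * (A *ᵥ s m) i + (A *ᵥ z.2 m) i else 0)
      map_add' := fun z w => by
        ext
        · dsimp; split_ifs <;> simp
        · dsimp; split_ifs
          · simp only [Matrix.mulVec_add, Pi.add_apply]; ring
          · simp
      map_smul' := fun c z => by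
        ext
        · dsimp; split_ifs <;> simp
        · dsimp; split_ifs
          · simp only [Matrix.mulVec_smul, Pi.smul_apply, smul_eq_mul]; ring
          · simp }
  -- The change of the equations when every fading vector moves along `v`, so that `Φ + τ • Ψ`
  -- belongs to the fadings `s m + τ • v`.
  let Ψ : ((Fin L → ℂ) × (Fin R → Fin Q → ℂ)) →ₗ[ℂ] ((Fin L → ℂ) × (Fin R → Fin L → ℂ)) :=
    { toFun := fun z => (0, fun m i => if i ∈ K then z.1 i * (A *ᵥ v) i else 0)
      map_add' := fun z w => by
        ext
        · simp
        · dsimp; split_ifs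
          · ring
          · simp
      map_smul' := fun c z => by
        ext
        · simp
        · dsimp; split_ifs
          · ring
          · simp }
  have hΦ : Function.Injective Φ := by
    rw [← LinearMap.ker_eq_bot, LinearMap.ker_eq_bot']
    rintro ⟨δ, t⟩ hz
    have h1 : ∀ i, (if i ∈ K ∧ i ≠ i₀ then 0 else δ i) = 0 := fun i =>
      congrFun (congrArg Prod.fst hz) i
    have h2 : ∀ m i, (if i ∈ K then δ i * (A *ᵥ s m) i + (A *ᵥ t m) i else 0) = 0 := fun m i =>
      congrFun (congrFun (congrArg Prod.snd hz) m) i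
    obtain ⟨h3, h4⟩ := hconst δ t (by simpa using h1 i₀) fun m i hi => by simpa [hi] using h2 m i
    refine Prod.ext (funext fun i => ?_) h4
    by_cases hi : i ∈ K
    · exact h3 i hi
    · simpa [hi] using h1 i
  have hne : ∀ i, ∀ᶠ τ : ℂ in 𝓝[≠] 0, (A *ᵥ s ⟨0, hR⟩) i + τ * (A *ᵥ v) i ≠ 0 := by
    intro i
    by_cases h0 : (A *ᵥ s ⟨0, hR⟩) i = 0
    · filter_upwards [self_mem_nhdsWithin] with τ hτ
      rw [h0, zero_add]
      exact mul_ne_zero hτ (hv i)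
    · have h1 : Tendsto (fun τ : ℂ => (A *ᵥ s ⟨0, hR⟩) i + τ * (A *ᵥ v) i) (𝓝[≠] 0)
          (𝓝 ((A *ᵥ s ⟨0, hR⟩) i + 0 * (A *ᵥ v) i)) :=
        (Continuous.tendsto (by fun_prop) 0).mono_left nhdsWithin_le_nhds
      exact h1.eventually_ne (by simpa using h0)
  obtain ⟨τ, hτ1, hτ2⟩ :=
    ((eventually_injective_add_smul (Ψ := Ψ) hΦ).and (eventually_all.2 hne)).exists
  -- A single pilot `i₀` removes the scaling ambiguity. The small shift along `v` keeps the system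
  -- on `K` injective and makes every gain of the first antenna nonzero. Once `t = 0` is known, this
  -- antenna alone determines `δ`, also off `K`.
  refine ⟨Finset.univ.erase i₀, fun m => s m + τ • v, by simp, fun δ t h0 h => ?_⟩
  have hA : ∀ m i, (A *ᵥ (s m + τ • v)) i = (A *ᵥ s m) i + τ * (A *ᵥ v) i := fun m i => by
    simp [Matrix.mulVec_add, Matrix.mulVec_smul]
  simp only [hA] at h
  -- restrict the perturbation to `K`
  have hz : ((fun i => if i ∈ K then δ i else 0 : Fin L → ℂ), t) = (0, 0) := by
    apply hτ1
    rw [Prod.mk_zero_zero, map_zero]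
    refine Prod.ext (funext fun i => ?_) (funext fun m => funext fun i => ?_)
    · by_cases hi : i ∈ K
      · by_cases hi' : i = i₀
        · subst hi'
          simp [Φ, Ψ, h0 i₀ (by simp)]
        · simp [Φ, Ψ, hi, hi']
      · simp [Φ, Ψ, hi]
    · by_cases hi : i ∈ K
      · simp only [Φ, Ψ, LinearMap.add_apply, LinearMap.smul_apply, LinearMap.coe_mk,
          AddHom.coe_mk, Prod.snd_add, Prod.smul_snd, Pi.add_apply, Pi.smul_apply, hi, if_true,
          smul_eq_mul, Prod.snd_zero, Pi.zero_apply]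
        linear_combination h m i
      · simp [Φ, Ψ, hi]
  have ht : t = 0 := congrArg Prod.snd hz
  refine ⟨funext fun i => ?_, ht⟩
  have := h ⟨0, hR⟩ i
  rw [ht] at this
  simp only [Pi.zero_apply, Matrix.mulVec_zero, add_zero] at this
  exact (mul_eq_zero.1 this).resolve_right (hτ2 i)

end Genericity

end SIMO

end

noncomputable section

namespace SIMO

/-! ### Complex-linear changes of variables -/

section ComplexLinear

variable {E : Type*} [NormedAddCommGroup E] [NormedSpace ℝ E] [NormedSpace ℂ E]
  [IsScalarTower ℝ ℂ E] [FiniteDimensional ℝ E]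

/-- The real determinant is the field norm of the complex one. Hence volumes scale by `‖det‖ ^ 2`,
and scaling by `√ρ` costs one full power of `ρ` per complex dimension. -/
lemma det_restrictScalars_eq_sq_norm (f : E →ₗ[ℂ] E) :
    LinearMap.det (f.restrictScalars ℝ) = ‖LinearMap.det f‖ ^ 2 := by
  have : FiniteDimensional ℂ E := FiniteDimensional.right ℝ ℂ E
  rw [LinearMap.det_restrictScalars, Algebra.norm_complex_apply, Complex.sq_norm]

variable [MeasurableSpace E] [BorelSpace E]

lemma lintegral_comp_complex_smul (μ : Measure E) [μ.IsAddHaarMeasure] {c : ℂ} (hc : c ≠ 0)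
    {g : E → ℝ≥0∞} (hg : Measurable g) :
    ∫⁻ w, g (c • w) ∂μ
      = ENNReal.ofReal ((‖c‖ ^ 2) ^ Module.finrank ℂ E)⁻¹ * ∫⁻ w, g w ∂μ := by
  have : FiniteDimensional ℂ E := FiniteDimensional.right ℝ ℂ E
  set f : E →ₗ[ℂ] E := c • LinearMap.id with hf
  have hdet : LinearMap.det (f.restrictScalars ℝ) = (‖c‖ ^ 2) ^ Module.finrank ℂ E := by
    rw [det_restrictScalars_eq_sq_norm, hf, LinearMap.det_smul, LinearMap.det_id, mul_one, norm_pow,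
      ← pow_mul, ← pow_mul, mul_comm]
  have hne : LinearMap.det (f.restrictScalars ℝ) ≠ 0 := by
    rw [hdet]; exact pow_ne_zero _ (pow_ne_zero _ (norm_ne_zero_iff.2 hc))
  have hmap := Measure.map_linearMap_addHaar_eq_smul_addHaar μ hne
  have hmeas : Measurable (f.restrictScalars ℝ) :=
    (LinearMap.continuous_of_finiteDimensional _).measurable
  calc ∫⁻ w, g (c • w) ∂μ = ∫⁻ w, g w ∂(μ.map (f.restrictScalars ℝ)) := by
        rw [lintegral_map hg hmeas]; rfl
    _ = _ := by
        rw [hmap, lintegral_smul_measure, hdet, abs_of_nonneg (by positivity), smul_eq_mul]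

end ComplexLinear

lemma lintegral_exp_neg_sq_norm :
    ∫⁻ z : ℂ, ENNReal.ofReal (Real.exp (-‖z‖ ^ 2)) = ENNReal.ofReal Real.pi := by
  have h3 : complexGaussian Set.univ = 1 := measure_univ
  rw [complexGaussian_eq_withDensity, withDensity_apply _ MeasurableSet.univ,
    Measure.restrict_univ] at h3
  simp_rw [ENNReal.ofReal_mul (inv_nonneg.2 Real.pi_pos.le)] at h3
  rw [lintegral_const_mul _ (by fun_prop), ENNReal.ofReal_inv_of_pos Real.pi_pos] at h3
  have h4 : ENNReal.ofReal Real.pi ≠ 0 := (ENNReal.ofReal_pos.2 Real.pi_pos).ne'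
  rw [← one_mul (∫⁻ _, _), ← ENNReal.mul_inv_cancel h4 ENNReal.ofReal_ne_top, mul_assoc, h3,
    mul_one]

lemma lintegral_exp_neg_sq_norm_sub_mul (y : ℂ) {β : ℂ} (hβ : β ≠ 0) :
    ∫⁻ z : ℂ, ENNReal.ofReal (Real.exp (-‖y - β * z‖ ^ 2))
      = ENNReal.ofReal (Real.pi / ‖β‖ ^ 2) := by
  have h := lintegral_comp_complex_smul (volume : Measure ℂ) hβ
    (g := fun w => ENNReal.ofReal (Real.exp (-‖y - w‖ ^ 2))) (by fun_prop)
  simp only [smul_eq_mul, Module.finrank_self, pow_one] at h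
  rw [h, lintegral_sub_left_eq_self (fun w : ℂ => ENNReal.ofReal (Real.exp (-‖w‖ ^ 2))) y,
    lintegral_exp_neg_sq_norm, ← ENNReal.ofReal_mul (by positivity)]
  congr 1
  field_simp

/-! ### Selecting a square subsystem -/

/-- Injectivity means full column rank, so the rows span and a basis can be chosen among them. -/
lemma exists_submatrix_det_ne_zero {m n : Type*} [Fintype m] [Fintype n] [DecidableEq n]
    (M : Matrix m n ℂ) (hM : Function.Injective M.mulVec) :
    ∃ σ : n → m, (M.submatrix σ id).det ≠ 0 := by
  classical
  have hspan : Submodule.span ℂ (Set.range M.row) = ⊤ := by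
    refine Submodule.eq_top_of_finrank_eq ?_
    rw [← Matrix.rank_eq_finrank_span_row, Matrix.rank,
      LinearMap.finrank_range_of_inj (f := M.mulVecLin) hM]
  obtain ⟨κ, a, -, hsp, hli⟩ := exists_linearIndependent' ℂ M.row
  rw [hspan] at hsp
  let b := Module.Basis.mk hli hsp.ge
  let e : κ ≃ n := b.indexEquiv (Pi.basisFun ℂ n)
  refine ⟨a ∘ e.symm, ?_⟩
  have hli' : LinearIndependent ℂ (M.submatrix (a ∘ e.symm) id).row :=
    hli.comp e.symm e.symm.injective
  have := Matrix.linearIndependent_rows_iff_isUnit.1 hli'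
  exact ((Matrix.isUnit_iff_isUnit_det _).1 this).ne_zero

/-! ### The Jacobian of the noiseless channel -/

section Jacobian

variable {L Q R : ℕ} (A : Matrix (Fin L) (Fin Q) ℂ) (P : Finset (Fin L))

/-- The input whose free entries are `x` and whose remaining entries are equal to one. -/
def pilotInput (x : P → ℂ) : Fin L → ℂ := fun i => if h : i ∈ P then x ⟨i, h⟩ else 1

/-- The unknowns: the free inputs and the fading coefficients. -/
abbrev Unknown (P : Finset (Fin L)) (R Q : ℕ) : Type := P ⊕ (Fin R × Fin Q)

/-- The Jacobian matrix of the map `(x, s) ↦ (x_i (A s_m)_i)_{m,i}`. -/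
def jacobian (X : Fin L → ℂ) (s : Fin R → Fin Q → ℂ) :
    Matrix (Fin R × Fin L) (Unknown P R Q) ℂ :=
  fun a b => match b with
    | Sum.inl p => if a.2 = p then ∑ j, A a.2 j * s a.1 j else 0
    | Sum.inr q => if q.1 = a.1 then X a.2 * A a.2 q.2 else 0

lemma jacobian_mulVec (X : Fin L → ℂ) (s : Fin R → Fin Q → ℂ) (z : Unknown P R Q → ℂ)
    (a : Fin R × Fin L) :
    (jacobian A P X s *ᵥ z) a = (if h : a.2 ∈ P then z (Sum.inl ⟨a.2, h⟩) else 0) *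
      (∑ j, A a.2 j * s a.1 j) + X a.2 * ∑ j, A a.2 j * z (Sum.inr (a.1, j)) := by
  rw [Matrix.mulVec, dotProduct, Fintype.sum_sum_type, Fintype.sum_prod_type]
  congr 1
  · simp only [jacobian]
    by_cases h : a.2 ∈ P
    · rw [Finset.sum_eq_single ⟨a.2, h⟩]
      · simp [h, mul_comm]
      · intro b _ hb
        rw [if_neg, zero_mul]
        intro hab
        exact hb (Subtype.ext hab.symm)
      · simp
    · rw [Finset.sum_eq_zero]
      · simp [h]
      · intro b _
        rw [if_neg, zero_mul]
        intro hab
        exact h (hab ▸ b.2)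
  · simp only [jacobian]
    rw [Finset.sum_eq_single a.1]
    · simp [Finset.mul_sum, mul_assoc]
    · intro m _ hm
      simp [hm]
    · simp

/-- The Jacobian matrix of the square subsystem selected by `σ`. -/
def squareJacobian (σ : Unknown P R Q → Fin R × Fin L) (X : Fin L → ℂ)
    (s : Fin R → Fin Q → ℂ) : Matrix (Unknown P R Q) (Unknown P R Q) ℂ :=
  (jacobian A P X s).submatrix σ id

variable (σ : Unknown P R Q → Fin R × Fin L)

/-- At the all-ones input the kernel of the Jacobian is the solution space of the linearized
equations, with perturbations supported on `P`. -/
lemma exists_det_squareJacobian_ne_zero {s : Fin R → Fin Q → ℂ}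
    (hinj : ∀ (δ : Fin L → ℂ) (t : Fin R → Fin Q → ℂ), (∀ i ∉ P, δ i = 0) →
        (∀ m i, δ i * (A *ᵥ s m) i + (A *ᵥ t m) i = 0) → δ = 0 ∧ t = 0) :
    ∃ σ : Unknown P R Q → Fin R × Fin L, (squareJacobian A P σ 1 s).det ≠ 0 := by
  refine exists_submatrix_det_ne_zero _ ?_
  have : Function.Injective (jacobian A P 1 s).mulVecLin := by
    rw [← LinearMap.ker_eq_bot, LinearMap.ker_eq_bot']
    intro z hz
    obtain ⟨h1, h2⟩ := hinj (fun i => if h : i ∈ P then z (Sum.inl ⟨i, h⟩) else 0)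
      (fun m j => z (Sum.inr (m, j))) (fun i hi => by simp [hi]) (fun m i => by
        have := congrFun hz (m, i)
        rw [Matrix.mulVecLin_apply, jacobian_mulVec] at this
        simpa [Matrix.mulVec, dotProduct] using this)
    funext b
    rcases b with p | q
    · simpa using congrFun h1 p
    · exact congrFun (congrFun h2 q.1) q.2
  exact this

/-- Scaling rows and columns relates the Jacobian to the one at the all-ones input. -/
lemma norm_det_squareJacobian_le (s : Fin R → Fin Q → ℂ) {x : P → ℂ}
    (hx : ∀ p, 2⁻¹ ≤ ‖x p‖ ∧ ‖x p‖ ≤ 1) :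
    ‖(squareJacobian A P σ 1 s).det‖ ≤ 2 ^ Fintype.card (Unknown P R Q) *
      ‖(squareJacobian A P σ (pilotInput P x) s).det‖ := by
  set X := pilotInput P x with hX
  have hX1 : ∀ i, 2⁻¹ ≤ ‖X i‖ := fun i => by
    by_cases h : i ∈ P
    · simpa [hX, pilotInput, h] using (hx ⟨i, h⟩).1
    · simp only [hX, pilotInput, h, dite_false, norm_one]; norm_num
  -- An input column `p` has entries only in rows with index `p`, so scaling it by `X p` is the same
  -- as scaling those rows. Fading columns carry the row factor already.
  set col : Unknown P R Q → ℂ := Sum.elim (fun p => X p) (fun _ => 1) with hcol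
  have h1 : Matrix.of (fun a b => col b * squareJacobian A P σ X s a b)
      = Matrix.of (fun a b => X (σ a).2 * squareJacobian A P σ 1 s a b) := by
    ext a b
    rcases b with p | q
    · simp only [Matrix.of_apply, hcol, squareJacobian, Matrix.submatrix_apply, jacobian, id,
        Sum.elim_inl]
      split_ifs with h
      · rw [h]
      · simp
    · simp only [Matrix.of_apply, hcol, squareJacobian, Matrix.submatrix_apply, jacobian, id,
        Sum.elim_inr, Pi.one_apply, one_mul]
      split_ifs with h <;> simp
  have h2 := congrArg Matrix.det h1
  rw [Matrix.det_mul_row, Matrix.det_mul_column (fun a => X (σ a).2)] at h2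
  have h3 := congrArg norm h2
  rw [norm_mul, norm_mul] at h3
  have hcolle : ‖∏ b, col b‖ ≤ 1 := by
    rw [norm_prod]
    refine Finset.prod_le_one (fun _ _ => norm_nonneg _) fun b _ => ?_
    rcases b with p | q
    · simpa [hcol, hX, pilotInput] using (hx p).2
    · simp [hcol]
  have hrowge : (2⁻¹ : ℝ) ^ Fintype.card (Unknown P R Q) ≤ ‖∏ a, X (σ a).2‖ := by
    rw [norm_prod, ← Finset.card_univ, ← Finset.prod_const]
    exact Finset.prod_le_prod (fun _ _ => by norm_num) fun a _ => hX1 _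
  set D1 := ‖(squareJacobian A P σ 1 s).det‖
  set DX := ‖(squareJacobian A P σ X s).det‖
  have h4 : (2⁻¹ : ℝ) ^ Fintype.card (Unknown P R Q) * D1 ≤ DX := by
    calc _ ≤ ‖∏ a, X (σ a).2‖ * D1 := by gcongr
      _ = ‖∏ b, col b‖ * DX := h3.symm
      _ ≤ 1 * DX := by gcongr
      _ = DX := one_mul _
  rw [inv_pow] at h4
  rwa [inv_mul_le_iff₀ (by positivity)] at h4

lemma measurable_det_squareJacobian_one :
    Measurable fun s : Fin R → Fin Q → ℂ => (squareJacobian A P σ 1 s).det := by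
  refine Continuous.measurable (Continuous.matrix_det ?_)
  refine continuous_matrix fun a b => ?_
  rcases b with p | q
  · simp only [squareJacobian, Matrix.submatrix_apply, jacobian, id]
    split_ifs <;> fun_prop
  · simp only [squareJacobian, Matrix.submatrix_apply, jacobian, id]
    fun_prop

/-- At the all-ones input the input columns are linear in `s` and the fading columns are constant.
Multiplying the latter by `τ` turns the matrix at `s + τ • s₀` into `τ J(s₀) + B` with `B`
independent of `τ`. The top coefficient of its determinant is `det J(s₀)`, and the factor `w`
records the powers of `τ` introduced. -/
lemma isPolynomialAlong_det_squareJacobian (s₀ : Fin R → Fin Q → ℂ) :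
    IsPolynomialAlong (fun s => (squareJacobian A P σ 1 s).det) s₀
      (Fintype.card (Unknown P R Q)) (squareJacobian A P σ 1 s₀).det := by
  intro s
  set B : Matrix (Unknown P R Q) (Unknown P R Q) ℂ :=
    Matrix.of fun a b => Sum.elim (fun p => squareJacobian A P σ 1 s a (Sum.inl p)) (fun _ => 0) b
    with hB
  refine ⟨_, fun τ => ∏ b, Sum.elim (fun _ : P => 1) (fun _ : Fin R × Fin Q => τ) b,
    Polynomial.natDegree_det_X_add_C_le (squareJacobian A P σ 1 s₀) B,
    Polynomial.coeff_det_X_add_C_card (squareJacobian A P σ 1 s₀) B, fun τ hτ hτ1 => ?_⟩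
  set col : Unknown P R Q → ℂ := Sum.elim (fun _ => 1) (fun _ => τ) with hcol
  have heval : Polynomial.eval τ ((Polynomial.X : Polynomial ℂ) •
      (squareJacobian A P σ 1 s₀).map Polynomial.C + B.map Polynomial.C).det
      = (∏ b, col b) * (squareJacobian A P σ 1 (s + τ • s₀)).det := by
    rw [← Matrix.det_mul_row, ← Polynomial.coe_evalRingHom, RingHom.map_det]
    congr 1
    ext a b
    rcases b with p | q
    · simp only [RingHom.mapMatrix_apply, Matrix.map_apply, Matrix.add_apply, Matrix.smul_apply,
        smul_eq_mul, map_add, Polynomial.coe_evalRingHom, Polynomial.eval_mul, Polynomial.eval_X,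
        Polynomial.eval_C, hB, hcol, Matrix.of_apply, Sum.elim_inl, one_mul, squareJacobian,
        Matrix.submatrix_apply, jacobian, id, Pi.add_apply, Pi.smul_apply]
      split_ifs with h
      · rw [Finset.mul_sum, ← Finset.sum_add_distrib]
        exact Finset.sum_congr rfl fun j _ => by ring
      · simp
    · simp [hB, hcol, squareJacobian, jacobian]
      split_ifs <;> ring
  have hcol0 : ∏ b, col b ≠ 0 := Finset.prod_ne_zero_iff.2 fun b _ => by
    rcases b with p | q
    · simp [hcol]
    · simpa [hcol] using hτ
  refine ⟨hcol0, ?_, heval⟩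
  rw [norm_prod]
  refine Finset.prod_le_one (fun _ _ => norm_nonneg _) fun b _ => ?_
  rcases b with p | q
  · simp
  · simpa [hcol] using hτ1

/-! ### The change of variables -/

/-- The free inputs among the unknowns. -/
def freeInputs (z : Unknown P R Q → ℂ) : P → ℂ := fun p => z (Sum.inl p)

/-- The fading coefficients among the unknowns. -/
def fadings (z : Unknown P R Q → ℂ) : Fin R → Fin Q → ℂ := fun m j => z (Sum.inr (m, j))

/-- The square subsystem of noiseless observations selected by `σ`. -/
def observe (z : Unknown P R Q → ℂ) : Unknown P R Q → ℂ :=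
  fun a => pilotInput P (freeInputs P z) (σ a).2 *
    ∑ j, A (σ a).2 j * fadings P z (σ a).1 j

lemma hasFDerivAt_observe (z : Unknown P R Q → ℂ) :
    HasFDerivAt (observe A P σ) (LinearMap.toContinuousLinearMap (Matrix.toLin'
      (squareJacobian A P σ (pilotInput P (freeInputs P z)) (fadings P z)))) z := by
  rw [hasFDerivAt_pi']
  intro a
  have h2 : HasFDerivAt (fun z : Unknown P R Q → ℂ => ∑ j, A (σ a).2 j * fadings P z (σ a).1 j)
      (∑ j, A (σ a).2 j • ContinuousLinearMap.proj (R := ℂ)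
        (φ := fun _ : Unknown P R Q => ℂ) (Sum.inr ((σ a).1, j))) z := by
    refine HasFDerivAt.fun_sum fun j _ => ?_
    exact (hasFDerivAt_apply (𝕜 := ℂ) _ z).const_mul _
  by_cases h : (σ a).2 ∈ P
  · have h1 : HasFDerivAt (fun z : Unknown P R Q → ℂ => pilotInput P (freeInputs P z) (σ a).2)
        (ContinuousLinearMap.proj (R := ℂ) (φ := fun _ : Unknown P R Q => ℂ)
          (Sum.inl ⟨(σ a).2, h⟩)) z := by
      simp only [pilotInput, h, dite_true, freeInputs]
      exact hasFDerivAt_apply (𝕜 := ℂ) _ z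
    refine (h1.mul h2).congr_fderiv ?_
    ext v
    have := jacobian_mulVec A P (pilotInput P (freeInputs P z)) (fadings P z) v (σ a)
    simp only [ContinuousLinearMap.comp_apply, LinearMap.coe_toContinuousLinearMap',
      Matrix.toLin'_apply, ContinuousLinearMap.proj_apply, squareJacobian]
    change _ = (jacobian A P (pilotInput P (freeInputs P z)) (fadings P z) *ᵥ v) (σ a)
    rw [this]
    simp [h]
    ring
  · have h1 : (fun z : Unknown P R Q → ℂ => observe A P σ z a)
        = fun z => ∑ j, A (σ a).2 j * fadings P z (σ a).1 j := by
      funext z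
      simp [observe, pilotInput, h]
    rw [h1]
    refine h2.congr_fderiv ?_
    ext v
    have := jacobian_mulVec A P (pilotInput P (freeInputs P z)) (fadings P z) v (σ a)
    simp only [ContinuousLinearMap.comp_apply, LinearMap.coe_toContinuousLinearMap',
      Matrix.toLin'_apply, ContinuousLinearMap.proj_apply, squareJacobian]
    change _ = (jacobian A P (pilotInput P (freeInputs P z)) (fadings P z) *ᵥ v) (σ a)
    rw [this]
    simp [h, pilotInput]

/-- The regular points of the square subsystem. -/
def regularPoints : Set (Unknown P R Q → ℂ) :=
  {z | (∀ p, freeInputs P z p ≠ 0) ∧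
    (squareJacobian A P σ (pilotInput P (freeInputs P z)) (fadings P z)).det ≠ 0}

lemma continuous_det_squareJacobian : Continuous fun z : Unknown P R Q → ℂ =>
    (squareJacobian A P σ (pilotInput P (freeInputs P z)) (fadings P z)).det := by
  refine Continuous.matrix_det (continuous_matrix fun a b => ?_)
  rcases b with p | q
  · simp only [squareJacobian, Matrix.submatrix_apply, jacobian, id, fadings]
    split_ifs <;> fun_prop
  · simp only [squareJacobian, Matrix.submatrix_apply, jacobian, id, pilotInput, freeInputs]
    split_ifs <;> fun_prop

lemma measurableSet_regularPoints : MeasurableSet (regularPoints A P σ) := by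
  refine (IsOpen.and ?_ ?_).measurableSet
  · simp only [Set.ofPred_forall, freeInputs]
    exact isOpen_iInter_of_finite fun p => isOpen_ne_fun (by fun_prop) (by fun_prop)
  · exact isOpen_ne_fun (continuous_det_squareJacobian A P σ) continuous_const

/-- In the unknowns `1 / x` and `s` the equations are linear, whence regular solutions are
unique. -/
lemma injOn_observe : Set.InjOn (observe A P σ) (regularPoints A P σ) := by
  intro z hz z' hz' heq
  set X := pilotInput P (freeInputs P z) with hX
  set J := squareJacobian A P σ X (fadings P z) with hJ
  -- The difference of the two points in the coordinates `(1 / x, s)`, with the input part carried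
  -- back to `x` by the derivative `-x ^ 2` of inversion. By linearity this is an exact kernel
  -- vector of the Jacobian, not merely one to first order.
  set d : Unknown P R Q → ℂ := Sum.elim
    (fun p => -(z (Sum.inl p)) ^ 2 * ((z' (Sum.inl p))⁻¹ - (z (Sum.inl p))⁻¹))
    (fun q => z' (Sum.inr q) - z (Sum.inr q)) with hd
  have hker : J *ᵥ d = 0 := by
    funext a
    change (jacobian A P X (fadings P z) *ᵥ d) (σ a) = 0
    rw [jacobian_mulVec]
    have ha := congrFun heq a
    simp only [observe] at ha
    have hsum : ∑ j, A (σ a).2 j * d (Sum.inr ((σ a).1, j))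
        = ∑ j, A (σ a).2 j * fadings P z' (σ a).1 j - ∑ j, A (σ a).2 j * fadings P z (σ a).1 j := by
      rw [← Finset.sum_sub_distrib]
      exact Finset.sum_congr rfl fun j _ => by simp only [hd, Sum.elim_inr, fadings]; ring
    rw [hsum]
    by_cases h : (σ a).2 ∈ P
    · have hz0 : z (Sum.inl ⟨(σ a).2, h⟩) ≠ 0 := hz.1 ⟨(σ a).2, h⟩
      have hz0' : z' (Sum.inl ⟨(σ a).2, h⟩) ≠ 0 := hz'.1 ⟨(σ a).2, h⟩
      simp only [hX, pilotInput, h, dite_true, freeInputs, hd, Sum.elim_inl] at ha ⊢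
      field_simp
      linear_combination (-z (Sum.inl ⟨(σ a).2, h⟩)) * ha
    · simp only [hX, pilotInput, h, dite_false, freeInputs] at ha ⊢
      linear_combination -ha
  have hd0 : d = 0 := by
    have hu : IsUnit J := (Matrix.isUnit_iff_isUnit_det J).2 (isUnit_iff_ne_zero.2 hz.2)
    have := Matrix.mulVec_injective_iff_isUnit.2 hu
    exact this (by rw [hker, Matrix.mulVec_zero])
  funext b
  rcases b with p | q
  · have h1 := congrFun hd0 (Sum.inl p)
    have hz0 : z (Sum.inl p) ≠ 0 := hz.1 p
    simp only [hd, Sum.elim_inl, Pi.zero_apply, neg_mul, neg_eq_zero, mul_eq_zero,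
      pow_eq_zero_iff, hz0, false_or, ne_eq, OfNat.ofNat_ne_zero, not_false_eq_true] at h1
    exact (inv_injective (sub_eq_zero.1 h1)).symm
  · have h1 := congrFun hd0 (Sum.inr q)
    simp only [hd, Sum.elim_inr, Pi.zero_apply] at h1
    exact (sub_eq_zero.1 h1).symm

/-- Change of variables along the square subsystem. -/
theorem setLIntegral_regularPoints_le (g : (Unknown P R Q → ℂ) → ℝ≥0∞) :
    ∫⁻ z in regularPoints A P σ, ENNReal.ofReal (‖(squareJacobian A P σ
      (pilotInput P (freeInputs P z)) (fadings P z)).det‖ ^ 2) * g (observe A P σ z)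
      ≤ ∫⁻ w, g w := by
  have h := lintegral_image_eq_lintegral_abs_det_fderiv_mul
    (volume : Measure (Unknown P R Q → ℂ)) (measurableSet_regularPoints A P σ)
    (fun z _ => ((hasFDerivAt_observe A P σ z).restrictScalars ℝ).hasFDerivWithinAt)
    (injOn_observe A P σ) g
  refine le_trans (le_of_eq ?_) (h.symm.trans_le (setLIntegral_le_lintegral _ _))
  refine lintegral_congr fun z => ?_
  congr 2
  have hdet := det_restrictScalars_eq_sq_norm (Matrix.toLin'
    (squareJacobian A P σ (pilotInput P (freeInputs P z)) (fadings P z)))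
  rw [LinearMap.det_toLin'] at hdet
  rw [← abs_of_nonneg (sq_nonneg ‖(squareJacobian A P σ
      (pilotInput P (freeInputs P z)) (fadings P z)).det‖), ← hdet]
  rfl

end Jacobian

end SIMO

end

noncomputable section

namespace SIMO

/-! ### The lower bound -/

/-- The closed annulus `1/2 ≤ |z| ≤ 1`. -/
def annulus : Set ℂ := {z | 2⁻¹ ≤ ‖z‖ ∧ ‖z‖ ≤ 1}

lemma measurableSet_annulus : MeasurableSet annulus :=
  ((isClosed_le continuous_const continuous_norm).and
    (isClosed_le continuous_norm continuous_const)).measurableSet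

lemma volume_annulus_ne_top : volume annulus ≠ ∞ := by
  refine ne_top_of_le_ne_top (isCompact_closedBall (0 : ℂ) 1).measure_lt_top.ne
    (measure_mono fun z hz => ?_)
  simpa using hz.2

lemma volume_annulus_ne_zero : volume annulus ≠ 0 := by
  have h : Metric.ball (3 / 4 : ℂ) (1 / 4) ⊆ annulus := by
    intro z hz
    have hz' : ‖z - 3 / 4‖ < 1 / 4 := by simpa [dist_eq_norm] using hz
    have h34 : ‖(3 / 4 : ℂ)‖ = 3 / 4 := by norm_num
    have h1 := norm_sub_norm_le z (3 / 4)
    have h2 := norm_sub_norm_le (3 / 4) z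
    rw [norm_sub_rev] at h2
    constructor <;> rw [h34] at h1 h2 <;> linarith
  exact ((Metric.measure_ball_pos volume _ (by norm_num)).trans_le (measure_mono h)).ne'

lemma lintegral_cond {α : Type*} [MeasurableSpace α] (μ : Measure α) (S : Set α)
    (g : α → ℝ≥0∞) : ∫⁻ z, g z ∂(ProbabilityTheory.cond μ S) = (μ S)⁻¹ * ∫⁻ z in S, g z ∂μ := by
  rw [ProbabilityTheory.cond, lintegral_smul_measure, smul_eq_mul]

lemma ae_cond_mem {α : Type*} [MeasurableSpace α] (μ : Measure α) {S : Set α}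
    (hS : MeasurableSet S) : ∀ᵐ z ∂(ProbabilityTheory.cond μ S), z ∈ S := by
  rw [ProbabilityTheory.cond]
  exact Measure.ae_smul_measure (ae_restrict_mem hS) _

section Lower

variable {L Q R : ℕ} (A : Matrix (Fin L) (Fin Q) ℂ) (P : Finset (Fin L))

/-- The region of the free inputs. -/
def freeRegion : Set (P → ℂ) := Set.univ.pi fun _ => annulus

lemma measurableSet_freeRegion : MeasurableSet (freeRegion P) :=
  MeasurableSet.univ_pi fun _ => measurableSet_annulus

lemma volume_freeRegion : volume (freeRegion P) = ∏ _p : P, volume annulus :=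
  Measure.pi_pi _ _

lemma volume_freeRegion_ne_zero : volume (freeRegion P) ≠ 0 := by
  rw [volume_freeRegion]
  exact Finset.prod_ne_zero_iff.2 fun _ _ => volume_annulus_ne_zero

lemma volume_freeRegion_ne_top : volume (freeRegion P) ≠ ∞ := by
  rw [volume_freeRegion]
  exact ENNReal.prod_ne_top fun _ _ => volume_annulus_ne_top

@[fun_prop]
lemma measurable_pilotInput : Measurable (pilotInput P) := by
  refine measurable_pi_lambda _ fun i => ?_
  unfold pilotInput
  by_cases h : i ∈ P
  · simp only [h, dite_true]; fun_prop
  · simp only [h, dite_false]; fun_prop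

/-- The input law: free entries uniform on the annulus, all other entries equal to one. -/
def inputLaw : Measure (Fin L → ℂ) :=
  (ProbabilityTheory.cond volume (freeRegion P)).map (pilotInput P)

instance : IsProbabilityMeasure (inputLaw P) := by
  have : IsProbabilityMeasure (ProbabilityTheory.cond volume (freeRegion P)) :=
    cond_isProbabilityMeasure_of_finite (volume_freeRegion_ne_zero P) (volume_freeRegion_ne_top P)
  exact Measure.isProbabilityMeasure_map (measurable_pilotInput P).aemeasurable

lemma ae_inputLaw_norm_le_one : ∀ᵐ x ∂(inputLaw P), ∀ i, ‖x i‖ ≤ 1 := by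
  rw [inputLaw, ae_map_iff (measurable_pilotInput P).aemeasurable]
  · filter_upwards [ae_cond_mem volume (measurableSet_freeRegion P)] with x hx i
    by_cases h : i ∈ P
    · simpa [pilotInput, h] using (hx ⟨i, h⟩ trivial).2
    · simp [pilotInput, h]
  · simp only [Set.ofPred_forall]
    exact MeasurableSet.iInter fun i => measurableSet_le (by fun_prop) (by fun_prop)

lemma inputLaw_mem_admissibleInputs : inputLaw P ∈ admissibleInputs L := by
  refine ⟨inferInstance, ?_⟩
  calc ∫⁻ x, ∑ i, ‖x i‖ₑ ^ 2 ∂(inputLaw P) ≤ ∫⁻ _, (L : ℝ≥0∞) ∂(inputLaw P) := by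
        refine lintegral_mono_ae ?_
        filter_upwards [ae_inputLaw_norm_le_one P] with x hx
        calc ∑ i, ‖x i‖ₑ ^ 2 ≤ ∑ _i : Fin L, (1 : ℝ≥0∞) := by
              gcongr with i
              refine pow_le_one₀ zero_le ?_
              rw [← ofReal_norm, ← ENNReal.ofReal_one]
              exact ENNReal.ofReal_le_ofReal (hx i)
          _ = L := by simp
    _ = L := by simp

/-- Integration over free inputs and fadings as integration over all unknowns. -/
lemma exists_lintegral_unknown :
    ∃ κ : ℝ≥0, ∀ g : (Unknown P R Q → ℂ) → ℝ≥0∞, Measurable g →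
      ∫⁻ x : P → ℂ, ∫⁻ s : Fin R → Fin Q → ℂ, g (Sum.elim x fun q => s q.1 q.2)
        = κ * ∫⁻ z, g z := by
  let e₀ : ((P → ℂ) × (Fin R → Fin Q → ℂ)) ≃ₗ[ℝ] (Unknown P R Q → ℂ) :=
    { toFun := fun p => Sum.elim p.1 fun q => p.2 q.1 q.2
      invFun := fun z => (freeInputs P z, fadings P z)
      map_add' := fun p q => by ext (b | b) <;> simp
      map_smul' := fun c p => by ext (b | b) <;> simp
      left_inv := fun p => rfl
      right_inv := fun z => by ext (b | b) <;> rfl }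
  let e := e₀.toContinuousLinearEquiv
  have : (Measure.map e (volume : Measure ((P → ℂ) × (Fin R → Fin Q → ℂ)))).IsAddHaarMeasure := by
    have : (volume : Measure ((P → ℂ) × (Fin R → Fin Q → ℂ))).IsAddHaarMeasure :=
      Measure.prod.instIsAddHaarMeasure _ _
    exact e.isAddHaarMeasure_map _
  -- Only finiteness of the constant matters, so uniqueness of Haar measure replaces its
  -- computation.
  obtain ⟨κ, h⟩ : ∃ κ : ℝ≥0, Measure.map e
      (volume : Measure ((P → ℂ) × (Fin R → Fin Q → ℂ))) = κ • volume :=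
    ⟨_, Measure.isAddLeftInvariant_eq_smul _ _⟩
  refine ⟨κ, fun g hg => ?_⟩
  have he : Measurable e := e.continuous.measurable
  have h1 : ∫⁻ p : (P → ℂ) × (Fin R → Fin Q → ℂ), g (e p)
      = ∫⁻ x : P → ℂ, ∫⁻ s : Fin R → Fin Q → ℂ, g (Sum.elim x fun q => s q.1 q.2) := by
    rw [Measure.volume_eq_prod, lintegral_prod (fun p => g (e p)) (hg.comp he).aemeasurable]
    rfl
  rw [← h1, ← lintegral_map hg he, h, lintegral_smul_measure]
  rfl

variable (σ : Unknown P R Q → Fin R × Fin L)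

/-- The squared distance of the observations selected by `σ` to the noiseless ones. -/
def misfit (ρ : ℝ) (x : Fin L → ℂ) (s : Fin R → Fin Q → ℂ) (y : Fin R → Fin L → ℂ) : ℝ :=
  ∑ a, ‖y (σ a).1 (σ a).2 - signal A ρ x s (σ a).1 (σ a).2‖ ^ 2

lemma measurable_misfit (ρ : ℝ) {α : Type*} [MeasurableSpace α] {x : α → Fin L → ℂ}
    {s : α → Fin R → Fin Q → ℂ} {y : α → Fin R → Fin L → ℂ} (hx : Measurable x)
    (hs : Measurable s) (hy : Measurable y) :
    Measurable fun t => misfit A P σ ρ (x t) (s t) (y t) := by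
  unfold misfit
  have := Measurable.signal A ρ hx hs
  fun_prop

/-- The Gaussian weight of the selected observations as a function of the noiseless ones. -/
def selectedWeight (ρ : ℝ) (y : Fin R → Fin L → ℂ) (w : Unknown P R Q → ℂ) : ℝ≥0∞ :=
  ENNReal.ofReal (Real.exp (-∑ a, ‖y (σ a).1 (σ a).2 - ((Real.sqrt ρ : ℝ) : ℂ) * w a‖ ^ 2))

lemma ofReal_exp_neg_misfit (ρ : ℝ) (y : Fin R → Fin L → ℂ) (z : Unknown P R Q → ℂ) :
    ENNReal.ofReal (Real.exp (-misfit A P σ ρ (pilotInput P (freeInputs P z)) (fadings P z) y))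
      = selectedWeight P σ ρ y (observe A P σ z) := by
  simp only [misfit, selectedWeight, observe, signal]

/-- The observations separate, and each complex one contributes a Gaussian integral `π / ρ`. This is
the source of the power of `ρ` in the lower bound. -/
lemma lintegral_selectedWeight {ρ : ℝ} (hρ : 0 < ρ) (y : Fin R → Fin L → ℂ) :
    ∫⁻ w, selectedWeight P σ ρ y w
      = ENNReal.ofReal (Real.pi ^ Fintype.card (Unknown P R Q)) *
        ENNReal.ofReal ((ρ⁻¹) ^ Fintype.card (Unknown P R Q)) := by
  have hsq : ((Real.sqrt ρ : ℝ) : ℂ) ≠ 0 := by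
    exact_mod_cast (Real.sqrt_pos.2 hρ).ne'
  have h1 : ∀ w, selectedWeight P σ ρ y w = ∏ a, ENNReal.ofReal
      (Real.exp (-‖y (σ a).1 (σ a).2 - ((Real.sqrt ρ : ℝ) : ℂ) * w a‖ ^ 2)) := fun w => by
    rw [← ENNReal.ofReal_prod_of_nonneg fun _ _ => (Real.exp_pos _).le, ← Real.exp_sum,
      Finset.sum_neg_distrib, selectedWeight]
  simp_rw [h1]
  rw [volume_pi, lintegral_pi_prod (fun _ => (volume : Measure ℂ)) (f := fun a t =>
    ENNReal.ofReal (Real.exp (-‖y (σ a).1 (σ a).2 - ((Real.sqrt ρ : ℝ) : ℂ) * t‖ ^ 2)))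
    fun a => by fun_prop]
  simp_rw [lintegral_exp_neg_sq_norm_sub_mul _ hsq]
  rw [Finset.prod_const, Finset.card_univ, ← ENNReal.ofReal_pow (by positivity),
    ← ENNReal.ofReal_mul (by positivity), ← mul_pow]
  congr 2
  rw [Complex.norm_real, Real.norm_eq_abs, sq_abs, Real.sq_sqrt hρ.le, div_eq_mul_inv]

/-- The squared determinant times the Gaussian weight of the selected observations. -/
def detWeight (ρ : ℝ) (x : Fin L → ℂ) (s : Fin R → Fin Q → ℂ) (y : Fin R → Fin L → ℂ) : ℝ≥0∞ :=
  ENNReal.ofReal (‖(squareJacobian A P σ 1 s).det‖ ^ 2) *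
    ENNReal.ofReal (Real.exp (-misfit A P σ ρ x s y))

lemma measurable_detWeight (ρ : ℝ) {α : Type*} [MeasurableSpace α] {x : α → Fin L → ℂ}
    {s : α → Fin R → Fin Q → ℂ} {y : α → Fin R → Fin L → ℂ} (hx : Measurable x)
    (hs : Measurable s) (hy : Measurable y) :
    Measurable fun t => detWeight A P σ ρ (x t) (s t) (y t) := by
  have h1 := measurable_misfit A P σ ρ hx hs hy
  have h2 : Measurable fun t => (squareJacobian A P σ 1 (s t)).det :=
    (measurable_det_squareJacobian_one A P σ).comp hs
  exact (ENNReal.measurable_ofReal.comp ((measurable_norm.comp h2).pow_const 2)).mul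
    (ENNReal.measurable_ofReal.comp (Real.measurable_exp.comp h1.neg))

/-- On the input region the determinant at the all-ones input is dominated by the true one, with `4
^ n` from squaring the factor `2 ^ n`. Where the true one vanishes so does the other, hence singular
points do not matter. -/
lemma detWeight_le (ρ : ℝ) (y : Fin R → Fin L → ℂ) (z : Unknown P R Q → ℂ) :
    (freeInputs P ⁻¹' freeRegion P).indicator
      (fun z => detWeight A P σ ρ (pilotInput P (freeInputs P z)) (fadings P z) y) z
    ≤ (regularPoints A P σ).indicator (fun z =>
        ENNReal.ofReal (4 ^ Fintype.card (Unknown P R Q)) *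
          (ENNReal.ofReal (‖(squareJacobian A P σ
          (pilotInput P (freeInputs P z)) (fadings P z)).det‖ ^ 2) *
            selectedWeight P σ ρ y (observe A P σ z))) z := by
  by_cases hz : z ∈ freeInputs P ⁻¹' freeRegion P
  swap
  · rw [Set.indicator_of_notMem hz]; exact zero_le
  rw [Set.indicator_of_mem hz, detWeight, ofReal_exp_neg_misfit]
  have hle := norm_det_squareJacobian_le A P σ (fadings P z) (x := freeInputs P z)
    fun p => hz p trivial
  by_cases hz2 : (squareJacobian A P σ (pilotInput P (freeInputs P z)) (fadings P z)).det = 0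
  · rw [hz2, norm_zero, mul_zero] at hle
    have h0 : (squareJacobian A P σ 1 (fadings P z)).det = 0 := norm_le_zero_iff.1 hle
    rw [h0, norm_zero, zero_pow two_ne_zero, ENNReal.ofReal_zero, zero_mul]
    exact zero_le
  · have hreg : z ∈ regularPoints A P σ := by
      refine ⟨fun p => ?_, hz2⟩
      have h1 : 2⁻¹ ≤ ‖freeInputs P z p‖ := (hz p trivial).1
      refine norm_pos_iff.1 (lt_of_lt_of_le (by norm_num) h1)
    rw [Set.indicator_of_mem hreg, ← mul_assoc]
    refine mul_le_mul_left ?_ _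
    rw [← ENNReal.ofReal_mul (by positivity)]
    refine ENNReal.ofReal_le_ofReal ?_
    refine (pow_le_pow_left₀ (norm_nonneg _) hle 2).trans (le_of_eq ?_)
    rw [mul_pow, ← pow_mul, mul_comm _ 2, pow_mul]
    norm_num

lemma lintegral_inputLaw_eq {h : (Fin L → ℂ) → (Fin R → Fin Q → ℂ) → ℝ≥0∞}
    (hm : Measurable fun p : (Fin L → ℂ) × (Fin R → Fin Q → ℂ) => h p.1 p.2) :
    ∫⁻ x, ∫⁻ s, h x s ∂volume ∂(inputLaw P)
      = (volume (freeRegion P))⁻¹ * ∫⁻ x, ∫⁻ s : Fin R → Fin Q → ℂ,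
        (freeInputs P ⁻¹' freeRegion P).indicator
          (fun z => h (pilotInput P (freeInputs P z)) (fadings P z))
          (Sum.elim x fun q => s q.1 q.2) := by
  have hm' : Measurable fun x : Fin L → ℂ => ∫⁻ s : Fin R → Fin Q → ℂ, h x s :=
    hm.lintegral_prod_right'
  rw [inputLaw, lintegral_map hm' (measurable_pilotInput P), lintegral_cond,
    ← lintegral_indicator (measurableSet_freeRegion P)]
  congr 1
  refine lintegral_congr fun x => ?_
  by_cases hx : x ∈ freeRegion P
  · rw [Set.indicator_of_mem hx]
    refine lintegral_congr fun s => ?_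
    rw [Set.indicator_of_mem (show (Sum.elim x fun q => s q.1 q.2) ∈
      freeInputs P ⁻¹' freeRegion P from hx)]
    rfl
  · rw [Set.indicator_of_notMem hx]
    symm
    rw [← lintegral_zero (μ := (volume : Measure (Fin R → Fin Q → ℂ)))]
    refine lintegral_congr fun s => ?_
    exact Set.indicator_of_notMem (show (Sum.elim x fun q => s q.1 q.2) ∉
      freeInputs P ⁻¹' freeRegion P from hx) _

/-- The squared determinant is the real Jacobian of the passage to the selected noiseless
observations. What remains is a Gaussian integral in those coordinates, whose value does not depend
on the centre `y`. -/
theorem exists_lintegral_detWeight_le :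
    ∃ C : ℝ≥0, ∀ ρ : ℝ, 0 < ρ → ∀ y : Fin R → Fin L → ℂ,
      ∫⁻ x, ∫⁻ s : Fin R → Fin Q → ℂ, detWeight A P σ ρ x s y ∂volume ∂(inputLaw P)
      ≤ C * ENNReal.ofReal ((ρ⁻¹) ^ Fintype.card (Unknown P R Q)) := by
  obtain ⟨κ, hκ⟩ := exists_lintegral_unknown (R := R) (Q := Q) P
  set n := Fintype.card (Unknown P R Q) with hn
  set V := volume (freeRegion P) with hV
  set C : ℝ≥0∞ := V⁻¹ * (κ * (ENNReal.ofReal (4 ^ n) * ENNReal.ofReal (Real.pi ^ n))) with hC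
  have hCt : C ≠ ∞ := ENNReal.mul_ne_top (ENNReal.inv_ne_top.2 (volume_freeRegion_ne_zero P))
    (ENNReal.mul_ne_top ENNReal.coe_ne_top
      (ENNReal.mul_ne_top ENNReal.ofReal_ne_top ENNReal.ofReal_ne_top))
  refine ⟨C.toNNReal, fun ρ hρ y => ?_⟩
  rw [ENNReal.coe_toNNReal hCt]
  have hfr : Measurable (freeInputs (R := R) (Q := Q) P) := by unfold freeInputs; fun_prop
  have hfa : Measurable (fadings (R := R) (Q := Q) P) := by unfold fadings; fun_prop
  have hdm : Measurable fun z : Unknown P R Q → ℂ =>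
      detWeight A P σ ρ (pilotInput P (freeInputs P z)) (fadings P z) y :=
    measurable_detWeight A P σ ρ ((measurable_pilotInput P).comp hfr) hfa measurable_const
  rw [lintegral_inputLaw_eq P (measurable_detWeight A P σ ρ measurable_fst measurable_snd
    measurable_const), hκ _ (hdm.indicator (hfr (measurableSet_freeRegion P)))]
  refine (mul_le_mul_right (mul_le_mul_right (lintegral_mono (detWeight_le A P σ ρ y)) _)
    _).trans ?_
  rw [lintegral_indicator (measurableSet_regularPoints A P σ),
    lintegral_const_mul' _ _ ENNReal.ofReal_ne_top]
  refine (mul_le_mul_right (mul_le_mul_right (mul_le_mul_right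
    (setLIntegral_regularPoints_le A P σ _) _) _) _).trans (le_of_eq ?_)
  rw [lintegral_selectedWeight P σ hρ, hC]
  ring

end Lower

end SIMO

end

noncomputable section

namespace SIMO

/-! ### Tilting of the fading and its bounded expected cost. -/

section Lower

variable {L Q R : ℕ} (A : Matrix (Fin L) (Fin Q) ℂ) (P : Finset (Fin L))

instance isProbabilityMeasure_cond_closedBall {E : Type*} [NormedAddCommGroup E]
    [NormedSpace ℝ E] [FiniteDimensional ℝ E] [MeasurableSpace E] [BorelSpace E] (μ : Measure E)
    [μ.IsAddHaarMeasure] : IsProbabilityMeasure (ProbabilityTheory.cond μ (Metric.closedBall 0 1)) :=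
  cond_isProbabilityMeasure_of_finite (Metric.measure_closedBall_pos μ _ one_pos).ne'
    (isCompact_closedBall (0 : E) 1).measure_lt_top.ne

lemma norm_sum_mul_le {u : Fin Q → ℂ} (hu : ‖u‖ ≤ 1) (i : Fin L) :
    ‖∑ j, A i j * u j‖ ≤ ∑ i, ∑ j, ‖A i j‖ := by
  calc ‖∑ j, A i j * u j‖ ≤ ∑ j, ‖A i j‖ := by
        refine (norm_sum_le _ _).trans (Finset.sum_le_sum fun j _ => ?_)
        rw [norm_mul]
        exact mul_le_of_le_one_right (norm_nonneg _) ((norm_le_pi_norm u j).trans hu)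
    _ ≤ _ := Finset.single_le_sum (f := fun i => ∑ j, ‖A i j‖)
        (fun _ _ => Finset.sum_nonneg fun _ _ => norm_nonneg _) (Finset.mem_univ i)

lemma signal_add_smul {ρ : ℝ} {c : ℂ} (hc : ((Real.sqrt ρ : ℝ) : ℂ) * c = 1) (x : Fin L → ℂ)
    (s u : Fin R → Fin Q → ℂ) (m : Fin R) (i : Fin L) :
    signal A ρ x (s + c • u) m i = signal A ρ x s m i + x i * ∑ j, A i j * u m j := by
  have : ∑ j, A i j * (s + c • u) m j = ∑ j, A i j * s m j + c * ∑ j, A i j * u m j := by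
    rw [Finset.mul_sum, ← Finset.sum_add_distrib]
    refine Finset.sum_congr rfl fun j _ => ?_
    simp only [Pi.add_apply, Pi.smul_apply, smul_eq_mul]
    ring
  simp only [signal, this]
  linear_combination (x i * ∑ j, A i j * u m j) * hc

variable (σ : Unknown P R Q → Fin R × Fin L)

/-- Because `√ρ c = 1`, moving the fading by `c • u` shifts each observation by a bounded amount.
The smearing is thus invisible below the noise level, uniformly in `ρ`. -/
lemma misfit_add_smul_le {ρ : ℝ} {c : ℂ} (hc : ((Real.sqrt ρ : ℝ) : ℂ) * c = 1) {x : Fin L → ℂ}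
    (hx : ∀ i, ‖x i‖ ≤ 1) (s : Fin R → Fin Q → ℂ) {u : Fin R → Fin Q → ℂ} (hu : ‖u‖ ≤ 1)
    (n : Fin R → Fin L → ℂ) :
    misfit A P σ ρ x (s + c • u) (signal A ρ x s + n)
      ≤ Fintype.card (Unknown P R Q) * (2 * sqNorm n + 2 * (∑ i, ∑ j, ‖A i j‖) ^ 2) := by
  rw [← nsmul_eq_mul, misfit]
  refine Finset.sum_le_card_nsmul _ _ _ fun a _ => ?_
  rw [signal_add_smul A hc, Pi.add_apply, Pi.add_apply, add_sub_add_left_eq_sub]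
  have h1 : ‖x (σ a).2 * ∑ j, A (σ a).2 j * u (σ a).1 j‖ ≤ ∑ i, ∑ j, ‖A i j‖ := by
    rw [norm_mul]
    refine (mul_le_of_le_one_left (norm_nonneg _) (hx _)).trans ?_
    exact norm_sum_mul_le A ((norm_le_pi_norm u _).trans hu) _
  have h2 := sq_norm_apply_le_sqNorm n (σ a).1 (σ a).2
  have h3 := norm_sub_le (n (σ a).1 (σ a).2) (x (σ a).2 * ∑ j, A (σ a).2 j * u (σ a).1 j)
  set p := ‖n (σ a).1 (σ a).2‖
  set q := ‖x (σ a).2 * ∑ j, A (σ a).2 j * u (σ a).1 j‖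
  have hq : q ^ 2 ≤ (∑ i, ∑ j, ‖A i j‖) ^ 2 := pow_le_pow_left₀ (norm_nonneg _) h1 2
  calc _ ≤ (p + q) ^ 2 := pow_le_pow_left₀ (norm_nonneg _) h3 2
    _ ≤ 2 * p ^ 2 + 2 * q ^ 2 := by nlinarith [sq_nonneg (p - q)]
    _ ≤ _ := by linarith

/-- The exponent of the auxiliary tilting. -/
def lowerExponent (ρ : ℝ) (c : ℂ) (ω : (Fin L → ℂ) ×
    ((Fin R → Fin Q → ℂ) × (Fin R → Fin L → ℂ)) × (Fin R → Fin Q → ℂ)) : ℝ :=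
  misfit A P σ ρ ω.1 (ω.2.1.1 + c • ω.2.2) (signal A ρ ω.1 ω.2.1.1 + ω.2.1.2) +
    2 * max (-Real.log ‖(squareJacobian A P σ 1 (ω.2.1.1 + c • ω.2.2)).det‖) 0

lemma measurable_lowerExponent (ρ : ℝ) (c : ℂ) : Measurable (lowerExponent A P σ ρ c) := by
  unfold lowerExponent
  have h1 : Measurable fun ω : (Fin L → ℂ) ×
    ((Fin R → Fin Q → ℂ) × (Fin R → Fin L → ℂ)) × (Fin R → Fin Q → ℂ) =>
    ω.2.1.1 + c • ω.2.2 := by fun_prop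
  refine (measurable_misfit A P σ ρ measurable_fst h1 (by fun_prop)).add
    (((Real.measurable_log.comp (measurable_norm.comp
      ((measurable_det_squareJacobian_one A P σ).comp h1))).neg.max measurable_const).const_mul _)

lemma lowerExponent_nonneg (ρ : ℝ) (c : ℂ) (ω) : 0 ≤ lowerExponent A P σ ρ c ω := by
  unfold lowerExponent misfit
  positivity

/-- The misfit is controlled by the noise energy. The determinant is evaluated at a Gaussian vector
translated by `c • u`, for which the bound on `log⁻` is uniform over translates of norm at most one.
-/
lemma exists_lintegral_lowerExponent_le {s₀ : Fin R → Fin Q → ℂ}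
    (hs₀ : (squareJacobian A P σ 1 s₀).det ≠ 0) :
    ∃ H : ℝ≥0, ∀ (ρ : ℝ) (c : ℂ), ((Real.sqrt ρ : ℝ) : ℂ) * c = 1 → ‖c‖ ≤ 1 →
      ∫⁻ ω, ENNReal.ofReal (lowerExponent A P σ ρ c ω) ∂((inputLaw P).prod
        (((complexGaussianVectors R Q).prod (complexGaussianVectors R L)).prod
          (ProbabilityTheory.cond volume (Metric.closedBall 0 1)))) ≤ H := by
  have hDm := measurable_det_squareJacobian_one A P σ
  obtain ⟨C, hC⟩ := (isPolynomialAlong_det_squareJacobian A P σ s₀).exists_lintegral_neg_log_le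
    hDm hs₀
  set a : ℝ := ∑ i, ∑ j, ‖A i j‖
  set k : ℝ := (Fintype.card (Unknown P R Q) : ℝ)
  set I : ℝ≥0∞ := ∫⁻ n : Fin R → Fin L → ℂ, ENNReal.ofReal (k * (2 * sqNorm n + 2 * a ^ 2))
    ∂(complexGaussianVectors R L) with hI
  have hIt : I ≠ ∞ := by
    refine (Integrable.lintegral_lt_top ?_).ne
    exact (((integrable_sqNorm R L).const_mul 2).add (integrable_const _)).const_mul k
  refine ⟨(I + 2 * C).toNNReal, fun ρ c hc hc1 => ?_⟩
  rw [ENNReal.coe_toNNReal (by finiteness)]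
  set η : Measure (Fin R → Fin Q → ℂ) := ProbabilityTheory.cond volume (Metric.closedBall 0 1)
    with hη
  have hηp : IsProbabilityMeasure η := isProbabilityMeasure_cond_closedBall _
  have hu : ∀ᵐ u ∂η, ‖u‖ ≤ 1 := by
    filter_upwards [ae_cond_mem volume (S := Metric.closedBall (0 : Fin R → Fin Q → ℂ) 1)
      Metric.isClosed_closedBall.measurableSet] with u hu
    simpa using hu
  set γ := complexGaussianVectors R Q
  set γ' := complexGaussianVectors R L
  have hmp1 : MeasurePreserving (fun ω : (Fin L → ℂ) × ((Fin R → Fin Q → ℂ) ×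
      (Fin R → Fin L → ℂ)) × (Fin R → Fin Q → ℂ) => ω.2.1.2)
      ((inputLaw P).prod ((γ.prod γ').prod η)) γ' :=
    measurePreserving_snd.comp (measurePreserving_fst.comp measurePreserving_snd)
  have hmp2 : MeasurePreserving (fun ω : (Fin L → ℂ) × ((Fin R → Fin Q → ℂ) ×
      (Fin R → Fin L → ℂ)) × (Fin R → Fin Q → ℂ) => (ω.2.1.1, ω.2.2))
      ((inputLaw P).prod ((γ.prod γ').prod η)) (γ.prod η) :=
    (measurePreserving_fst.prod (MeasurePreserving.id η)).comp measurePreserving_snd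
  have hmp3 : MeasurePreserving (fun ω : (Fin L → ℂ) × ((Fin R → Fin Q → ℂ) ×
      (Fin R → Fin L → ℂ)) × (Fin R → Fin Q → ℂ) => ω.2.2)
      ((inputLaw P).prod ((γ.prod γ').prod η)) η :=
    measurePreserving_snd.comp measurePreserving_snd
  have hm1 : Measurable fun n : Fin R → Fin L → ℂ =>
    ENNReal.ofReal (k * (2 * sqNorm n + 2 * a ^ 2)) := by fun_prop
  have hm2 : Measurable fun p : (Fin R → Fin Q → ℂ) × (Fin R → Fin Q → ℂ) =>
      ENNReal.ofReal (-Real.log ‖(squareJacobian A P σ 1 (p.1 + c • p.2)).det‖) :=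
    ENNReal.measurable_ofReal.comp (Real.measurable_log.comp (measurable_norm.comp
      (hDm.comp (by fun_prop)))).neg
  calc _ ≤ ∫⁻ ω : (Fin L → ℂ) × ((Fin R → Fin Q → ℂ) ×
      (Fin R → Fin L → ℂ)) × (Fin R → Fin Q → ℂ),
        (ENNReal.ofReal (k * (2 * sqNorm ω.2.1.2 + 2 * a ^ 2)) + 2 *
        ENNReal.ofReal (-Real.log ‖(squareJacobian A P σ 1 (ω.2.1.1 + c • ω.2.2)).det‖))
        ∂((inputLaw P).prod ((γ.prod γ').prod η)) := by
        refine lintegral_mono_ae ?_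
        filter_upwards [measurePreserving_fst.quasiMeasurePreserving.ae
          (ae_inputLaw_norm_le_one P), hmp3.quasiMeasurePreserving.ae hu] with ω h1 h2
        refine ENNReal.ofReal_add_le.trans (add_le_add (ENNReal.ofReal_le_ofReal
          (misfit_add_smul_le A P σ hc h1 _ h2 _)) ?_)
        rw [ENNReal.ofReal_mul zero_le_two, ENNReal.ofReal_ofNat, ENNReal.ofReal_max,
          ENNReal.ofReal_zero, max_eq_left zero_le]
    _ = I + 2 * ∫⁻ p, ENNReal.ofReal (-Real.log
          ‖(squareJacobian A P σ 1 (p.1 + c • p.2)).det‖) ∂(γ.prod η) := by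
        refine (lintegral_add_left (hm1.comp hmp1.measurable) _).trans ?_
        refine congrArg₂ (· + ·) (hmp1.lintegral_comp hm1) ?_
        refine (lintegral_const_mul _ (hm2.comp hmp2.measurable)).trans ?_
        exact congrArg _ (hmp2.lintegral_comp hm2)
    _ ≤ I + 2 * C := by
        gcongr
        rw [lintegral_prod_symm' _ hm2]
        calc _ ≤ ∫⁻ _, (C : ℝ≥0∞) ∂η := by
              refine lintegral_mono_ae ?_
              filter_upwards [hu] with u hu
              refine le_trans (le_of_eq ?_) (hC (c • u) ?_)
              · exact lintegral_congr fun s => by rw [add_comm]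
              · rw [norm_smul]
                exact mul_le_one₀ hc1 (norm_nonneg _) hu
          _ = C := by simp

/-- The term `2 log⁻ ‖det‖` in the exponent yields the factor `‖det‖ ^ 2` needed by the change of
variables. A zero determinant must be excluded, since `log 0 = 0` would provide no decay there. -/
lemma ofReal_exp_sub_lowerExponent_le {B : ℝ} (ρ : ℝ) (x : Fin L → ℂ) {s : Fin R → Fin Q → ℂ}
    (hs : (squareJacobian A P σ 1 s).det ≠ 0) (y : Fin R → Fin L → ℂ) :
    ENNReal.ofReal (Real.exp (B - (misfit A P σ ρ x s y +
      2 * max (-Real.log ‖(squareJacobian A P σ 1 s).det‖) 0)))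
      ≤ ENNReal.ofReal (Real.exp B) * detWeight A P σ ρ x s y := by
  rw [detWeight, ← ENNReal.ofReal_mul (by positivity), ← ENNReal.ofReal_mul (by positivity)]
  refine ENNReal.ofReal_le_ofReal ?_
  have h : Real.exp (-(2 * max (-Real.log ‖(squareJacobian A P σ 1 s).det‖) 0))
      ≤ ‖(squareJacobian A P σ 1 s).det‖ ^ 2 := by
    have hpos := norm_pos_iff.2 hs
    rw [← Real.exp_log (pow_pos hpos 2), Real.exp_le_exp, Real.log_pow]
    have := le_max_left (-Real.log ‖(squareJacobian A P σ 1 s).det‖) 0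
    push_cast
    linarith
  have h2 : B - (misfit A P σ ρ x s y +
      2 * max (-Real.log ‖(squareJacobian A P σ 1 s).det‖) 0)
      = B + (-(2 * max (-Real.log ‖(squareJacobian A P σ 1 s).det‖) 0) +
        -misfit A P σ ρ x s y) := by ring
  rw [h2, Real.exp_add, Real.exp_add]
  gcongr

/-- A lower bound of the information obtained from an injective linearized system. -/
theorem exists_le_klDiv_inputLaw {s₀ : Fin R → Fin Q → ℂ}
    (hinj : ∀ (δ : Fin L → ℂ) (t : Fin R → Fin Q → ℂ), (∀ i ∉ P, δ i = 0) →
      (∀ m i, δ i * (A *ᵥ s₀ m) i + (A *ᵥ t m) i = 0) → δ = 0 ∧ t = 0) :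
    ∃ C : ℝ, ∀ ρ : ℝ, 1 ≤ ρ →
      ENNReal.ofReal (P.card * Real.log ρ - C) ≤
        InformationTheory.klDiv (jointLaw A R ρ (inputLaw P))
          ((jointLaw A R ρ (inputLaw P)).fst.prod (jointLaw A R ρ (inputLaw P)).snd) := by
  obtain ⟨σ, hσ⟩ := exists_det_squareJacobian_ne_zero A P hinj
  obtain ⟨H, hH⟩ := exists_lintegral_lowerExponent_le A P σ hσ
  obtain ⟨C, hC⟩ := exists_lintegral_detWeight_le A P σ
  have hne := (isPolynomialAlong_det_squareJacobian A P σ s₀).ae_ne_zero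
    (measurable_det_squareJacobian_one A P σ) hσ
  set V := (volume (Metric.closedBall (0 : Fin R → Fin Q → ℂ) 1))
  have hV0 : V ≠ 0 := (Metric.measure_closedBall_pos volume _ one_pos).ne'
  have hVt : V⁻¹ ≠ ∞ := ENNReal.inv_ne_top.2 hV0
  set C' : ℝ := (V⁻¹ * C).toReal with hC'
  refine ⟨H + C' - 1, fun ρ hρ => ?_⟩
  have hρ0 : 0 < ρ := by linarith
  set c : ℂ := (((Real.sqrt ρ)⁻¹ : ℝ) : ℂ) with hcdef
  have hsq : 0 < Real.sqrt ρ := Real.sqrt_pos.2 hρ0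
  have hc : ((Real.sqrt ρ : ℝ) : ℂ) * c = 1 := by
    rw [hcdef, ← Complex.ofReal_mul, mul_inv_cancel₀ hsq.ne', Complex.ofReal_one]
  have hcn : ‖c‖ = (Real.sqrt ρ)⁻¹ := by
    rw [hcdef, Complex.norm_real, Real.norm_of_nonneg (by positivity)]
  have hc1 : ‖c‖ ≤ 1 := by
    rw [hcn]
    exact inv_le_one_of_one_le₀ (Real.one_le_sqrt.2 hρ)
  have hc0 : c ≠ 0 := fun h => by simp [h] at hc
  set B : ℝ := P.card * Real.log ρ with hB
  have hBexp : Real.exp B = ρ ^ P.card := by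
    rw [hB, mul_comm, Real.exp_mul, Real.exp_log hρ0, Real.rpow_natCast]
  set G : (Fin L → ℂ) × (Fin R → Fin L → ℂ) → ℝ≥0∞ := fun p =>
    V⁻¹ * (ENNReal.ofReal (ρ ^ (R * Q)) * (ENNReal.ofReal (ρ ^ P.card) *
      ∫⁻ s, detWeight A P σ ρ p.1 s p.2)) with hG
  have hWm : Measurable fun p : (Fin L → ℂ) × (Fin R → Fin L → ℂ) =>
      ∫⁻ s, detWeight A P σ ρ p.1 s p.2 := by
    have : Measurable fun q : ((Fin L → ℂ) × (Fin R → Fin L → ℂ)) × (Fin R → Fin Q → ℂ) =>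
        detWeight A P σ ρ q.1.1 q.2 q.1.2 :=
      measurable_detWeight A P σ ρ (by fun_prop) (by fun_prop) (by fun_prop)
    exact this.lintegral_prod_right'
  have hGm : Measurable G := by
    exact (((hWm.const_mul _).const_mul _).const_mul _)
  have key := le_klDiv_jointLaw A ρ (inputLaw P)
    (ProbabilityTheory.cond volume (Metric.closedBall (0 : Fin R → Fin Q → ℂ) 1))
    (h := lowerExponent A P σ ρ c) (measurable_lowerExponent A P σ ρ c)
    (lowerExponent_nonneg A P σ ρ c) (B := B) (C := C') (H := H) (by positivity) H.2
    (by rw [ENNReal.ofReal_coe_nnreal]; exact hH ρ c hc hc1) hGm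
    (Eventually.of_forall fun x s y => ?_) fun y => ?_
  · refine le_trans (ENNReal.ofReal_le_ofReal (le_of_eq ?_)) key
    rw [hB]; ring
  · rw [lintegral_cond]
    refine mul_le_mul_right (le_trans (setLIntegral_le_lintegral _ _) ?_) _
    set F : (Fin R → Fin Q → ℂ) → ℝ≥0∞ := fun s' => ENNReal.ofReal (Real.exp (B -
      (misfit A P σ ρ x s' y + 2 * max (-Real.log ‖(squareJacobian A P σ 1 s').det‖) 0))) with hF
    have hFm : Measurable F := by
      refine ENNReal.measurable_ofReal.comp (Real.measurable_exp.comp (measurable_const.sub ?_))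
      exact (measurable_misfit A P σ ρ measurable_const measurable_id measurable_const).add
        (((Real.measurable_log.comp (measurable_norm.comp
          (measurable_det_squareJacobian_one A P σ))).neg.max measurable_const).const_mul _)
    calc _ = ∫⁻ u, F (s + c • u) := by
          refine lintegral_congr fun u => ?_
          simp only [lowerExponent, hF, add_sub_cancel]
      -- The map `u ↦ s + c • u` contracts `R Q` complex dimensions by `ρ ^ (-1/2)`. Translation
      -- invariance removes `s`, as required of `G`.
      _ = ENNReal.ofReal (ρ ^ (R * Q)) * ∫⁻ s', F s' := by
          rw [lintegral_comp_complex_smul volume hc0 (g := fun v => F (s + v))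
            (hFm.comp (by fun_prop)), lintegral_add_left_eq_self]
          congr 2
          rw [hcn, inv_pow, Real.sq_sqrt hρ0.le, inv_pow, inv_inv]
          congr 1
          simp [Module.finrank_pi_fintype]
      _ ≤ _ := by
          refine mul_le_mul_right ?_ _
          rw [← lintegral_const_mul' _ _ ENNReal.ofReal_ne_top]
          refine lintegral_mono_ae ?_
          filter_upwards [hne] with s' hs'
          rw [← hBexp]
          exact ofReal_exp_sub_lowerExponent_le A P σ ρ x hs' y
  -- The powers balance: `ρ ^ (R Q)` from the smearing and `ρ ^ |P|` from `exp B` cancel `ρ ^ (-n)`.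
  -- This determines the choice of `B`.
  · have hcard : Fintype.card (Unknown P R Q) = R * Q + P.card := by
      simp [Unknown, add_comm]
    simp only [hG]
    have hWy : Measurable fun x : Fin L → ℂ => ∫⁻ s, detWeight A P σ ρ x s y :=
      hWm.comp (f := fun x : Fin L → ℂ => (x, y)) (by fun_prop)
    rw [lintegral_const_mul' _ _ hVt, lintegral_const_mul' _ _ ENNReal.ofReal_ne_top,
      lintegral_const_mul' _ _ ENNReal.ofReal_ne_top, hC',
      ENNReal.ofReal_toReal (ENNReal.mul_ne_top hVt ENNReal.coe_ne_top)]
    refine mul_le_mul_right ?_ _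
    refine (mul_le_mul_right (mul_le_mul_right (hC ρ hρ0 y) _) _).trans (le_of_eq ?_)
    rw [hcard, ← mul_assoc, mul_comm, mul_assoc, ← ENNReal.ofReal_mul (by positivity),
      ← ENNReal.ofReal_mul (by positivity), ← pow_add, ← mul_pow, inv_mul_cancel₀ hρ0.ne',
      one_pow, ENNReal.ofReal_one, mul_one]

end Lower

end SIMO

end

noncomputable section

namespace SIMO

/-! ### The upper bound -/

/-- In the upper bound the Gaussian law of the fading is replaced by Lebesgue measure, for which
rescaling the fading is a plain change of variables. -/
lemma complexGaussianVectors_le_volume (R n : ℕ) : complexGaussianVectors R n ≤ volume := by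
  rw [complexGaussianVectors_eq_withDensity]
  conv_rhs => rw [← withDensity_one (μ := (volume : Measure (Fin R → Fin n → ℂ)))]
  exact withDensity_mono (Eventually.of_forall fun y => gaussianDensity_le_one y)

instance isProbabilityMeasure_cond_annulus :
    IsProbabilityMeasure (ProbabilityTheory.cond (volume : Measure ℂ) annulus) :=
  cond_isProbabilityMeasure_of_finite volume_annulus_ne_zero volume_annulus_ne_top

/-- Smearing the phase and modulus of a scalar signal. -/
lemma lintegral_cond_annulus_exp_le (y β : ℂ) :
    ∫⁻ c, ENNReal.ofReal (Real.exp (-‖y - β * c‖ ^ 2)) * ENNReal.ofReal ((1 + ‖β‖) ^ 2)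
      ∂(ProbabilityTheory.cond volume annulus)
      ≤ 4 + (volume annulus)⁻¹ * ENNReal.ofReal (4 * Real.pi) := by
  rw [lintegral_mul_const' _ _ ENNReal.ofReal_ne_top]
  -- For small `β` the prefactor is at most `4`. Otherwise the annulus is enlarged to the plane, and
  -- the Gaussian integral `π / ‖β‖ ^ 2` absorbs it.
  by_cases hβ : ‖β‖ ≤ 1
  · refine le_trans ?_ (le_self_add)
    calc _ ≤ 1 * ENNReal.ofReal 4 := by
          gcongr
          · calc _ ≤ ∫⁻ _, (1 : ℝ≥0∞) ∂(ProbabilityTheory.cond (volume : Measure ℂ) annulus) := by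
                  refine lintegral_mono fun c => ?_
                  rw [← ENNReal.ofReal_one]
                  refine ENNReal.ofReal_le_ofReal (Real.exp_le_one_iff.2 ?_)
                  exact neg_nonpos.2 (sq_nonneg _)
              _ = 1 := by simp
          · nlinarith [norm_nonneg β]
      _ = 4 := by simp
  · push Not at hβ
    have hβ0 : β ≠ 0 := norm_pos_iff.1 (by linarith)
    refine le_trans ?_ (le_add_self)
    rw [lintegral_cond, mul_assoc]
    refine mul_le_mul_right ?_ _
    calc _ ≤ (∫⁻ c : ℂ, ENNReal.ofReal (Real.exp (-‖y - β * c‖ ^ 2))) *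
          ENNReal.ofReal ((1 + ‖β‖) ^ 2) := by
          gcongr
          exact Measure.restrict_le_self
      _ ≤ _ := by
          rw [lintegral_exp_neg_sq_norm_sub_mul y hβ0, ← ENNReal.ofReal_mul (by positivity)]
          refine ENNReal.ofReal_le_ofReal ?_
          have h1 : (1 + ‖β‖) ^ 2 ≤ 4 * ‖β‖ ^ 2 := by nlinarith
          have h2 : 0 < ‖β‖ ^ 2 := by positivity
          rw [div_mul_eq_mul_div, div_le_iff₀ h2]
          nlinarith [Real.pi_pos]

variable {L Q R : ℕ}

/-- The reference weight of one entry of the scaled input. -/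
def inputWeight (ε ρ : ℝ) (i₀ i : Fin L) (z : ℂ) : ℝ :=
  if i = i₀ then (1 + ‖z‖) ^ (-(2 + 2 * ε)) else ρ⁻¹ * Real.exp (-‖z‖ ^ 2 / ρ)

lemma measurable_inputWeight (ε ρ : ℝ) (i₀ i : Fin L) : Measurable (inputWeight ε ρ i₀ i) := by
  unfold inputWeight
  by_cases h : i = i₀
  · simp only [h, if_true]; fun_prop
  · simp only [h, if_false]; fun_prop

lemma inputWeight_nonneg (ε : ℝ) {ρ : ℝ} (hρ : 0 < ρ) (i₀ i : Fin L) (z : ℂ) :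
    0 ≤ inputWeight ε ρ i₀ i z := by
  unfold inputWeight
  split_ifs <;> positivity

/-- The Gaussian factors have mass `π` for every `ρ`. The tail exponent `2 + 2ε` exceeds the real
dimension of `ℂ` exactly because `ε > 0`. -/
lemma exists_lintegral_prod_inputWeight {ε : ℝ} (hε : 0 < ε) (i₀ : Fin L) :
    ∃ C : ℝ≥0, ∀ ρ : ℝ, 0 < ρ →
      ∫⁻ w : Fin L → ℂ, ∏ i, ENNReal.ofReal (inputWeight ε ρ i₀ i (w i)) ≤ C := by
  have hJ : ∫⁻ z : ℂ, ENNReal.ofReal ((1 + ‖z‖) ^ (-(2 + 2 * ε))) < ∞ := by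
    refine (integrable_one_add_norm ?_).lintegral_lt_top
    rw [Complex.finrank_real_complex]
    push_cast
    linarith
  set J := ∫⁻ z : ℂ, ENNReal.ofReal ((1 + ‖z‖) ^ (-(2 + 2 * ε)))
  set C : ℝ≥0∞ := ∏ i : Fin L, if i = i₀ then J else ENNReal.ofReal Real.pi
  have hC : C ≠ ∞ := ENNReal.prod_ne_top fun i _ => by
    split_ifs
    · exact hJ.ne
    · exact ENNReal.ofReal_ne_top
  refine ⟨C.toNNReal, fun ρ hρ => ?_⟩
  rw [ENNReal.coe_toNNReal hC, volume_pi, lintegral_pi_prod (fun _ => (volume : Measure ℂ))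
    (f := fun i z => ENNReal.ofReal (inputWeight ε ρ i₀ i z))
    fun i => ENNReal.measurable_ofReal.comp (measurable_inputWeight ε ρ i₀ i)]
  refine Finset.prod_le_prod' fun i _ => ?_
  by_cases h : i = i₀
  · simp only [inputWeight, h, if_true]
    exact le_rfl
  · simp only [inputWeight, h, if_false]
    have hsq : (((Real.sqrt ρ)⁻¹ : ℝ) : ℂ) ≠ 0 := by
      exact_mod_cast (inv_pos.2 (Real.sqrt_pos.2 hρ)).ne'
    have hn : ‖(((Real.sqrt ρ)⁻¹ : ℝ) : ℂ)‖ ^ 2 = ρ⁻¹ := by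
      rw [Complex.norm_real, Real.norm_eq_abs, sq_abs, inv_pow, Real.sq_sqrt hρ.le]
    have h1 : ∀ z : ℂ, ENNReal.ofReal (ρ⁻¹ * Real.exp (-‖z‖ ^ 2 / ρ)) = ENNReal.ofReal ρ⁻¹ *
        ENNReal.ofReal (Real.exp (-‖(0 : ℂ) - (((Real.sqrt ρ)⁻¹ : ℝ) : ℂ) * z‖ ^ 2)) := fun z => by
      rw [← ENNReal.ofReal_mul (by positivity), zero_sub, norm_neg, norm_mul, mul_pow, hn]
      congr 3
      field_simp
    simp_rw [h1]
    rw [lintegral_const_mul' _ _ ENNReal.ofReal_ne_top, lintegral_exp_neg_sq_norm_sub_mul 0 hsq,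
      ← ENNReal.ofReal_mul (by positivity), hn]
    refine ENNReal.ofReal_le_ofReal (le_of_eq ?_)
    field_simp

/-- A scaled entry has modulus of order `√ρ ‖x‖`, so the normalization of the weight costs `log ρ`
and its exponent only the input energy. -/
lemma exp_neg_le_inputWeight_of_ne {ε ρ : ℝ} (hρ : 1 ≤ ρ) {i₀ i : Fin L} (hi : i ≠ i₀) {c x u : ℂ}
    (hc : ‖c‖ ≤ 1) (hu : ‖u‖ ≤ 1) :
    Real.exp (-(Real.log ρ + 2 * ‖x‖ ^ 2 + 2))
      ≤ inputWeight ε ρ i₀ i (((Real.sqrt ρ : ℝ) : ℂ) * c * x + u) := by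
  have hρ0 : 0 < ρ := by linarith
  rw [inputWeight, if_neg hi]
  have h1 : -(Real.log ρ + 2 * ‖x‖ ^ 2 + 2) = -Real.log ρ + -(2 * ‖x‖ ^ 2 + 2) := by ring
  rw [h1, Real.exp_add, Real.exp_neg, Real.exp_log hρ0]
  refine mul_le_mul_of_nonneg_left (Real.exp_le_exp.2 ?_) (by positivity)
  rw [neg_div, neg_le_neg_iff, div_le_iff₀ hρ0]
  have h2 : ‖((Real.sqrt ρ : ℝ) : ℂ) * c * x + u‖ ≤ Real.sqrt ρ * ‖x‖ + 1 := by
    refine (norm_add_le _ _).trans (add_le_add ?_ hu)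
    rw [norm_mul, norm_mul, Complex.norm_real, Real.norm_of_nonneg (Real.sqrt_nonneg _)]
    refine mul_le_mul_of_nonneg_right ?_ (norm_nonneg _)
    exact mul_le_of_le_one_right (Real.sqrt_nonneg _) hc
  have h3 := Real.sq_sqrt hρ0.le
  calc _ ≤ (Real.sqrt ρ * ‖x‖ + 1) ^ 2 := pow_le_pow_left₀ (norm_nonneg _) h2 2
    _ ≤ 2 * (Real.sqrt ρ ^ 2 * ‖x‖ ^ 2) + 2 := by nlinarith [sq_nonneg (Real.sqrt ρ * ‖x‖ - 1)]
    _ ≤ _ := by rw [h3]; nlinarith [sq_nonneg ‖x‖]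

/-- The prefactor cancels `(1 + ‖w‖) ^ (-2)` from the heavy tail, up to a constant and `log⁻ ‖a‖`.
The surviving `(1 + ‖w‖) ^ (-2ε)` costs `ε log ρ` and input energy. -/
lemma exp_neg_le_mul_inputWeight_self {ε ρ : ℝ} (hε : 0 < ε) (hρ : 1 ≤ ρ) (i₀ : Fin L)
    {a c x u : ℂ} (hc : ‖c‖ ≤ 1) (hu : ‖u‖ ≤ 1) (ha : a ≠ 0) :
    Real.exp (-(2 * Real.log 2 + 2 * max (-Real.log ‖a‖) 0 + ε * Real.log ρ
        + 2 * ε * (2 + ‖x‖ ^ 2)))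
      ≤ (1 + ‖((Real.sqrt ρ : ℝ) : ℂ) * x * a‖) ^ 2 *
        inputWeight ε ρ i₀ i₀ (((Real.sqrt ρ : ℝ) : ℂ) * c * x + u) := by
  have hρ0 : 0 < ρ := by linarith
  rw [inputWeight, if_pos rfl]
  set r := Real.sqrt ρ * ‖x‖ with hr
  have hr0 : 0 ≤ r := by positivity
  have ha0 : 0 < ‖a‖ := norm_pos_iff.2 ha
  have hn1 : ‖((Real.sqrt ρ : ℝ) : ℂ) * x * a‖ = r * ‖a‖ := by
    rw [norm_mul, norm_mul, Complex.norm_real, Real.norm_of_nonneg (Real.sqrt_nonneg _)]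
  have hw : ‖((Real.sqrt ρ : ℝ) : ℂ) * c * x + u‖ ≤ r + 1 := by
    refine (norm_add_le _ _).trans (add_le_add ?_ hu)
    rw [norm_mul, norm_mul, Complex.norm_real, Real.norm_of_nonneg (Real.sqrt_nonneg _)]
    refine mul_le_mul_of_nonneg_right ?_ (norm_nonneg _)
    exact mul_le_of_le_one_right (Real.sqrt_nonneg _) hc
  set w := ‖((Real.sqrt ρ : ℝ) : ℂ) * c * x + u‖ with hwdef
  have hw0 : 0 ≤ w := norm_nonneg _
  rw [hn1]
  have hpos1 : 0 < 1 + r * ‖a‖ := by positivity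
  have hpos2 : 0 < 1 + w := by positivity
  rw [← Real.exp_log (pow_pos hpos1 2), Real.rpow_def_of_pos hpos2, ← Real.exp_add,
    Real.exp_le_exp, Real.log_pow]
  set ℓ := max (-Real.log ‖a‖) 0 with hℓ
  have hℓ0 : 0 ≤ ℓ := le_max_right _ _
  have hℓ1 : -Real.log ‖a‖ ≤ ℓ := le_max_left _ _
  have key : Real.log (1 + w) ≤ Real.log 2 + Real.log (1 + r * ‖a‖) + ℓ := by
    have h1 : 1 ≤ Real.exp ℓ := Real.one_le_exp hℓ0
    have h2 : 1 ≤ ‖a‖ * Real.exp ℓ := by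
      rw [← Real.exp_log ha0, ← Real.exp_add]
      exact Real.one_le_exp (by linarith)
    have h3 : 1 + w ≤ 2 * (1 + r * ‖a‖) * Real.exp ℓ := by
      nlinarith [mul_le_mul_of_nonneg_left h2 hr0]
    calc Real.log (1 + w) ≤ Real.log (2 * (1 + r * ‖a‖) * Real.exp ℓ) :=
          Real.log_le_log hpos2 h3
      _ = _ := by
          rw [Real.log_mul (by positivity) (by positivity), Real.log_mul (by positivity)
            (by positivity), Real.log_exp]
  have key2 : 2 * Real.log (1 + w) ≤ Real.log ρ + 2 * (2 + ‖x‖ ^ 2) := by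
    have h1 : 1 ≤ Real.sqrt ρ := Real.one_le_sqrt.2 hρ
    have h2 : 1 + w ≤ Real.sqrt ρ * (2 + ‖x‖) := by rw [hr] at hw; nlinarith
    have h3 : Real.log (2 + ‖x‖) ≤ 1 + ‖x‖ := by
      have := Real.log_le_sub_one_of_pos (show 0 < 2 + ‖x‖ by positivity)
      linarith
    have h4 : Real.log (1 + w) ≤ Real.log ρ / 2 + Real.log (2 + ‖x‖) := by
      rw [← Real.log_sqrt hρ0.le, ← Real.log_mul (by positivity) (by positivity)]
      exact Real.log_le_log hpos2 h2
    nlinarith [sq_nonneg (‖x‖ - 1)]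
  push_cast
  nlinarith [mul_le_mul_of_nonneg_left key2 hε.le]

end SIMO

end

noncomputable section

namespace SIMO

/-! ### The reference weight and its pointwise comparison with the main term. -/

section Upper

variable {L Q R : ℕ} (A : Matrix (Fin L) (Fin Q) ℂ)

/-- The fading coefficient at time `i` and antenna `m`. -/
def gain (m : Fin R) (i : Fin L) (s : Fin R → Fin Q → ℂ) : ℂ := ∑ j, A i j * s m j

@[fun_prop]
lemma measurable_gain (m : Fin R) (i : Fin L) : Measurable (gain A m i) := by
  unfold gain; fun_prop

lemma gain_smul (m : Fin R) (i : Fin L) (c : ℂ) (s : Fin R → Fin Q → ℂ) :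
    gain A m i (c • s) = c * gain A m i s := by
  simp only [gain, Finset.mul_sum, Pi.smul_apply, smul_eq_mul]
  exact Finset.sum_congr rfl fun j _ => by ring

lemma exists_isPolynomialAlong_gain (m : Fin R) {i : Fin L} (hi : A.row i ≠ 0) :
    ∃ s₀ κ, IsPolynomialAlong (gain A m i) s₀ 1 κ ∧ κ ≠ 0 := by
  obtain ⟨j, hj⟩ : ∃ j, A i j ≠ 0 := by
    by_contra! h
    exact hi (funext h)
  refine ⟨Pi.single m (Pi.single j 1), A i j, fun s => ?_, hj⟩
  have hs₀ : gain A m i (Pi.single m (Pi.single j 1)) = A i j := by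
    simp [gain, Pi.single_apply]
  have hadd : ∀ s t, gain A m i (s + t) = gain A m i s + gain A m i t := fun s t => by
    simp only [gain, Pi.add_apply, mul_add, Finset.sum_add_distrib]
  refine ⟨Polynomial.C (A i j) * Polynomial.X + Polynomial.C (gain A m i s), fun _ => 1,
    Polynomial.natDegree_linear_le, by simp, fun τ _ _ => ⟨one_ne_zero, by simp, ?_⟩⟩
  rw [hadd, gain_smul, hs₀]
  simp
  ring

lemma sqNorm_smul (c : ℂ) (s : Fin R → Fin Q → ℂ) : sqNorm (c • s) = ‖c‖ ^ 2 * sqNorm s := by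
  simp only [sqNorm, Pi.smul_apply, norm_smul, mul_pow, Finset.mul_sum]

lemma sqNorm_sub_le (y w : Fin R → Fin Q → ℂ) : sqNorm (y - w) ≤ 2 * sqNorm y + 2 * sqNorm w := by
  have h := sqNorm_add_le y (-w)
  have : sqNorm (-w) = sqNorm w := by simp [sqNorm]
  rwa [this, ← sub_eq_add_neg] at h

lemma sqNorm_signal_one_le {u : Fin L → ℂ} (hu : ‖u‖ ≤ 1) (t : Fin R → Fin Q → ℂ) :
    sqNorm (signal A 1 u t) ≤ R * L * (∑ i, ∑ j, ‖A i j‖) ^ 2 * sqNorm t := by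
  set a := ∑ i, ∑ j, ‖A i j‖
  have h : ∀ m i, ‖signal A 1 u t m i‖ ^ 2 ≤ a ^ 2 * sqNorm t := fun m i => by
    have h1 : ‖signal A 1 u t m i‖ ≤ a * Real.sqrt (sqNorm t) := by
      simp only [signal, Real.sqrt_one, Complex.ofReal_one, one_mul, norm_mul]
      refine (mul_le_of_le_one_left (norm_nonneg _) ((norm_le_pi_norm u i).trans hu)).trans ?_
      calc ‖∑ j, A i j * t m j‖ ≤ ∑ j, ‖A i j‖ * Real.sqrt (sqNorm t) := by
            refine (norm_sum_le _ _).trans (Finset.sum_le_sum fun j _ => ?_)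
            rw [norm_mul]
            exact mul_le_mul_of_nonneg_left (Real.le_sqrt_of_sq_le
              (sq_norm_apply_le_sqNorm t m j)) (norm_nonneg _)
        _ ≤ _ := by
            rw [← Finset.sum_mul]
            refine mul_le_mul_of_nonneg_right ?_ (Real.sqrt_nonneg _)
            exact Finset.single_le_sum (f := fun i => ∑ j, ‖A i j‖)
              (fun _ _ => Finset.sum_nonneg fun _ _ => norm_nonneg _) (Finset.mem_univ i)
    calc _ ≤ (a * Real.sqrt (sqNorm t)) ^ 2 := pow_le_pow_left₀ (norm_nonneg _) h1 2
      _ = _ := by rw [mul_pow, Real.sq_sqrt (sqNorm_nonneg t)]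
  calc sqNorm (signal A 1 u t) ≤ ∑ _m : Fin R, ∑ _i : Fin L, a ^ 2 * sqNorm t := by
        unfold sqNorm at *
        exact Finset.sum_le_sum fun m _ => Finset.sum_le_sum fun i _ => h m i
    _ = _ := by simp; ring

/-- Moving a scalar between input and fading. -/
lemma sub_signal_one_eq (ρ : ℝ) {c : ℂ} (hc : c ≠ 0) (x u : Fin L → ℂ) (s : Fin R → Fin Q → ℂ)
    (y : Fin R → Fin L → ℂ) :
    y - signal A 1 (fun i => ((Real.sqrt ρ : ℝ) : ℂ) * c * x i + u i) (c⁻¹ • s)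
      = (y - signal A ρ x s) - signal A 1 u (c⁻¹ • s) := by
  ext m i
  have h : ∑ j, A i j * (c⁻¹ • s) m j = c⁻¹ * ∑ j, A i j * s m j := gain_smul A m i c⁻¹ s
  simp only [Pi.sub_apply, signal, Real.sqrt_one, Complex.ofReal_one, one_mul, h]
  field_simp
  ring

/-- The joint reference weight of fading, scaled input and output. -/
def referenceWeight (ε ρ : ℝ) (i₀ : Fin L) (t : Fin R → Fin Q → ℂ) (w : Fin L → ℂ)
    (y : Fin R → Fin L → ℂ) : ℝ≥0∞ :=
  ENNReal.ofReal (Real.exp (-sqNorm t)) * ((∏ i, ENNReal.ofReal (inputWeight ε ρ i₀ i (w i))) *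
    ENNReal.ofReal (Real.exp (-sqNorm (y - signal A 1 w t))))

lemma measurable_referenceWeight (ε ρ : ℝ) (i₀ : Fin L) {α : Type*} [MeasurableSpace α]
    {t : α → Fin R → Fin Q → ℂ} {w : α → Fin L → ℂ} {y : α → Fin R → Fin L → ℂ}
    (ht : Measurable t) (hw : Measurable w) (hy : Measurable y) :
    Measurable fun a => referenceWeight A ε ρ i₀ (t a) (w a) (y a) := by
  unfold referenceWeight
  refine Measurable.mul (by fun_prop) (Measurable.mul ?_ ?_)
  · exact Finset.measurable_fun_prod _ fun i _ => ENNReal.measurable_ofReal.comp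
      ((measurable_inputWeight ε ρ i₀ i).comp ((measurable_pi_apply i).comp hw))
  · have := Measurable.signal A 1 hw ht
    fun_prop

/-- Integrating over `y`, then `w`, then `t`, every factor has bounded mass, the first by
translation invariance. -/
lemma exists_lintegral_referenceWeight_le {ε : ℝ} (hε : 0 < ε) (i₀ : Fin L) :
    ∃ C : ℝ≥0, ∀ ρ : ℝ, 0 < ρ → ∫⁻ y : Fin R → Fin L → ℂ, ∫⁻ t : Fin R → Fin Q → ℂ,
      ∫⁻ w, referenceWeight A ε ρ i₀ t w y ≤ C := by
  obtain ⟨C, hC⟩ := exists_lintegral_prod_inputWeight hε i₀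
  set I : ∀ n : ℕ, ℝ≥0∞ := fun n =>
    ∫⁻ t : Fin R → Fin n → ℂ, ENNReal.ofReal (Real.exp (-sqNorm t)) with hI
  have hIt : ∀ n, I n ≠ ∞ := fun n => by
    have := integrable_exp_neg_mul_sqNorm R n one_pos
    simp only [one_mul] at this
    exact this.lintegral_lt_top.ne
  refine ⟨(I Q * (C * I L)).toNNReal, fun ρ hρ => ?_⟩
  rw [ENNReal.coe_toNNReal (ENNReal.mul_ne_top (hIt Q) (ENNReal.mul_ne_top ENNReal.coe_ne_top
    (hIt L)))]
  have hm : Measurable fun q : (Fin R → Fin L → ℂ) × (Fin R → Fin Q → ℂ) =>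
      ∫⁻ w, referenceWeight A ε ρ i₀ q.2 w q.1 := by
    have : Measurable fun q : ((Fin R → Fin L → ℂ) × (Fin R → Fin Q → ℂ)) × (Fin L → ℂ) =>
      referenceWeight A ε ρ i₀ q.1.2 q.2 q.1.1 :=
      measurable_referenceWeight A ε ρ i₀ (by fun_prop) (by fun_prop) (by fun_prop)
    exact this.lintegral_prod_right'
  have hmt : ∀ t : Fin R → Fin Q → ℂ, Measurable fun q : (Fin R → Fin L → ℂ) × (Fin L → ℂ) =>
      referenceWeight A ε ρ i₀ t q.2 q.1 := fun t =>
    measurable_referenceWeight A ε ρ i₀ (by fun_prop) (by fun_prop) (by fun_prop)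
  rw [lintegral_lintegral_swap hm.aemeasurable]
  have h1 : ∀ t : Fin R → Fin Q → ℂ, ∫⁻ y : Fin R → Fin L → ℂ, ∫⁻ w,
      referenceWeight A ε ρ i₀ t w y ≤ ENNReal.ofReal (Real.exp (-sqNorm t)) * (C * I L) := by
    intro t
    rw [lintegral_lintegral_swap (hmt t).aemeasurable]
    have h2 : ∀ w, ∫⁻ y : Fin R → Fin L → ℂ, referenceWeight A ε ρ i₀ t w y
        = (ENNReal.ofReal (Real.exp (-sqNorm t)) * I L) *
          ∏ i, ENNReal.ofReal (inputWeight ε ρ i₀ i (w i)) := fun w => by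
      simp only [referenceWeight]
      rw [lintegral_const_mul' _ _ ENNReal.ofReal_ne_top, lintegral_const_mul' _ _
        (ENNReal.prod_ne_top fun _ _ => ENNReal.ofReal_ne_top),
        lintegral_sub_right_eq_self (fun y => ENNReal.ofReal (Real.exp (-sqNorm y)))]
      ring
    simp_rw [h2]
    rw [lintegral_const_mul' _ _ (ENNReal.mul_ne_top ENNReal.ofReal_ne_top (hIt L)), mul_assoc]
    refine mul_le_mul_right ?_ _
    rw [mul_comm]
    exact mul_le_mul_left (hC ρ hρ) _
  refine (lintegral_mono h1).trans (le_of_eq ?_)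
  rw [lintegral_mul_const' _ _ (ENNReal.mul_ne_top ENNReal.coe_ne_top (hIt L))]

/-- The excess of the exponent of the reference weight over its main term. -/
def upperExponent (ε : ℝ) (m₀ : Fin R) (i₀ : Fin L) (x : Fin L → ℂ) (s : Fin R → Fin Q → ℂ)
    (n : Fin R → Fin L → ℂ) : ℝ :=
  2 * Real.log 2 + 4 * ε + 2 * L + (2 + 2 * ε) * ∑ i, ‖x i‖ ^ 2
    + (4 + 8 * (R * L * (∑ i, ∑ j, ‖A i j‖) ^ 2)) * sqNorm s + 2 * sqNorm n
    + 2 * max (-Real.log ‖gain A m₀ i₀ s‖) 0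

lemma prod_erase_inputWeight_ge {ε ρ : ℝ} (hρ : 1 ≤ ρ) (i₀ : Fin L) {c : ℂ} (hc : ‖c‖ ≤ 1)
    (x : Fin L → ℂ) {u : Fin L → ℂ} (hu : ‖u‖ ≤ 1) :
    Real.exp (-((L - 1 : ℝ) * Real.log ρ + 2 * ∑ i, ‖x i‖ ^ 2 + 2 * L)) ≤
      ∏ i ∈ Finset.univ.erase i₀,
        inputWeight ε ρ i₀ i (((Real.sqrt ρ : ℝ) : ℂ) * c * x i + u i) := by
  calc _ ≤ ∏ i ∈ Finset.univ.erase i₀, Real.exp (-(Real.log ρ + 2 * ‖x i‖ ^ 2 + 2)) := by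
        rw [← Real.exp_sum, Real.exp_le_exp, Finset.sum_neg_distrib, neg_le_neg_iff]
        have hcard : ((Finset.univ.erase i₀).card : ℝ) = L - 1 := by
          have : 0 < L := i₀.pos
          rw [Finset.card_erase_of_mem (Finset.mem_univ _), Finset.card_univ, Fintype.card_fin,
            Nat.cast_sub (by omega), Nat.cast_one]
        rw [Finset.sum_add_distrib, Finset.sum_add_distrib, Finset.sum_const, Finset.sum_const,
          nsmul_eq_mul, nsmul_eq_mul, hcard, ← Finset.mul_sum]
        have : ∑ i ∈ Finset.univ.erase i₀, ‖x i‖ ^ 2 ≤ ∑ i, ‖x i‖ ^ 2 :=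
          Finset.sum_le_sum_of_subset_of_nonneg (Finset.erase_subset _ _)
            fun _ _ _ => sq_nonneg _
        linarith
    _ ≤ _ := Finset.prod_le_prod (fun _ _ => (Real.exp_pos _).le) fun i hi =>
        exp_neg_le_inputWeight_of_ne hρ (Finset.ne_of_mem_erase hi) hc
          ((norm_le_pi_norm u i).trans hu)

/-- Moving `c` from fading to input leaves the noiseless output unchanged, and the shift `u` alters
it only by a multiple of the fading. With `1/2 ≤ ‖c‖ ≤ 1` the fading grows at most twofold and its
gain does not shrink, so all losses fit into the exponent on the left. -/
lemma exp_neg_upperExponent_le {ε ρ : ℝ} (hε : 0 < ε) (hρ : 1 ≤ ρ) (m₀ : Fin R) (i₀ : Fin L)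
    {c : ℂ} (hc : c ∈ annulus) (x : Fin L → ℂ) {u : Fin L → ℂ} (hu : ‖u‖ ≤ 1)
    {s : Fin R → Fin Q → ℂ} (hs : gain A m₀ i₀ s ≠ 0) (y : Fin R → Fin L → ℂ) :
    ENNReal.ofReal (Real.exp (-((L - 1 + ε : ℝ) * Real.log ρ +
      upperExponent A ε m₀ i₀ x s (y - signal A ρ x s))))
    ≤ ENNReal.ofReal ((1 + ‖((Real.sqrt ρ : ℝ) : ℂ) * x i₀ * gain A m₀ i₀ (c⁻¹ • s)‖) ^ 2) *
      referenceWeight A ε ρ i₀ (c⁻¹ • s)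
        (fun i => ((Real.sqrt ρ : ℝ) : ℂ) * c * x i + u i) y := by
  have hρ0 : 0 < ρ := by linarith
  have hcpos : 0 < ‖c‖ := lt_of_lt_of_le (by norm_num) hc.1
  have hc0 : c ≠ 0 := norm_pos_iff.1 hcpos
  set t := c⁻¹ • s with ht
  set n := y - signal A ρ x s with hn
  set w : Fin L → ℂ := fun i => ((Real.sqrt ρ : ℝ) : ℂ) * c * x i + u i with hw
  have hgt : gain A m₀ i₀ t = c⁻¹ * gain A m₀ i₀ s := gain_smul A m₀ i₀ _ s
  have hgt0 : gain A m₀ i₀ t ≠ 0 := by rw [hgt]; exact mul_ne_zero (inv_ne_zero hc0) hs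
  have hlog : max (-Real.log ‖gain A m₀ i₀ t‖) 0 ≤ max (-Real.log ‖gain A m₀ i₀ s‖) 0 := by
    refine max_le_max_right _ (neg_le_neg (Real.log_le_log (norm_pos_iff.2 hs) ?_))
    rw [hgt, norm_mul, norm_inv]
    exact le_mul_of_one_le_left (norm_nonneg _) ((one_le_inv₀ hcpos).2 hc.2)
  have hst : sqNorm t ≤ 4 * sqNorm s := by
    rw [ht, sqNorm_smul, norm_inv]
    refine mul_le_mul_of_nonneg_right ?_ (sqNorm_nonneg s)
    have : ‖c‖⁻¹ ≤ 2 := by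
      rw [inv_le_comm₀ hcpos two_pos]; exact hc.1
    have h0 : 0 ≤ ‖c‖⁻¹ := by positivity
    nlinarith
  set K : ℝ := R * L * (∑ i, ∑ j, ‖A i j‖) ^ 2 with hK
  have hK0 : 0 ≤ K := by positivity
  have hsy : sqNorm (y - signal A 1 w t) ≤ 2 * sqNorm n + 8 * K * sqNorm s := by
    rw [hw, ht, sub_signal_one_eq A ρ hc0]
    refine (sqNorm_sub_le _ _).trans ?_
    have := sqNorm_signal_one_le A hu t
    rw [← hK] at this
    have h2 := mul_le_mul_of_nonneg_left hst hK0
    linarith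
  have h1 := exp_neg_le_mul_inputWeight_self hε hρ i₀ (x := x i₀) hc.2
    ((norm_le_pi_norm u i₀).trans hu) hgt0
  have h2 := prod_erase_inputWeight_ge (ε := ε) hρ i₀ hc.2 x hu
  have hx0 : ‖x i₀‖ ^ 2 ≤ ∑ i, ‖x i‖ ^ 2 :=
    Finset.single_le_sum (f := fun i => ‖x i‖ ^ 2) (fun _ _ => sq_nonneg _) (Finset.mem_univ i₀)
  rw [referenceWeight, ← ENNReal.ofReal_prod_of_nonneg
    fun i _ => inputWeight_nonneg ε hρ0 i₀ i _,
    ← ENNReal.ofReal_mul (Finset.prod_nonneg fun i _ => inputWeight_nonneg ε hρ0 i₀ i _),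
    ← ENNReal.ofReal_mul (Real.exp_pos _).le, ← ENNReal.ofReal_mul (by positivity)]
  refine ENNReal.ofReal_le_ofReal ?_
  rw [← Finset.mul_prod_erase _ _ (Finset.mem_univ i₀)]
  set g := ‖((Real.sqrt ρ : ℝ) : ℂ) * x i₀ * gain A m₀ i₀ t‖
  set p := inputWeight ε ρ i₀ i₀ (w i₀) with hp
  set q := ∏ i ∈ Finset.univ.erase i₀, inputWeight ε ρ i₀ i (w i) with hq
  have hre : (1 + g) ^ 2 * (Real.exp (-sqNorm t) * (p * q * Real.exp (-sqNorm (y - signal A 1 w t))))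
      = ((1 + g) ^ 2 * p) * q * (Real.exp (-sqNorm t) *
        Real.exp (-sqNorm (y - signal A 1 w t))) := by ring
  rw [hre]
  refine le_trans ?_ (mul_le_mul_of_nonneg_right (mul_le_mul h1 h2 (Real.exp_pos _).le
    (mul_nonneg (sq_nonneg _) (inputWeight_nonneg ε hρ0 i₀ i₀ _))) (by positivity))
  rw [← Real.exp_add, ← Real.exp_add, ← Real.exp_add, Real.exp_le_exp]
  rw [upperExponent, ← hK]
  nlinarith [mul_le_mul_of_nonneg_left hx0 hε.le]

end Upper

end SIMO

end

noncomputable section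

namespace SIMO

/-! ### Smearing a scalar between input and fading, and the upper bound. -/

section Upper

variable {L Q R : ℕ} (A : Matrix (Fin L) (Fin Q) ℂ)

/-- The law of the auxiliary randomization: a scalar in the annulus and a vector in the ball. -/
def smearingLaw (L : ℕ) : Measure (ℂ × (Fin L → ℂ)) :=
  (ProbabilityTheory.cond volume annulus).prod
    (ProbabilityTheory.cond volume (Metric.closedBall 0 1))

instance : IsProbabilityMeasure (smearingLaw L) := by
  unfold smearingLaw; infer_instance

/-- The left integrand is constant, so the pointwise comparison may be averaged over `c` and `u`.
Averaging over `u` turns the weight at one scaled input into its integral over all `w`, which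
removes all dependence on `x` but the prefactor. -/
lemma lintegral_smearingLaw_le {ε ρ : ℝ} (hε : 0 < ε) (hρ : 1 ≤ ρ) (m₀ : Fin R) (i₀ : Fin L)
    (x : Fin L → ℂ) {s : Fin R → Fin Q → ℂ} (hs : gain A m₀ i₀ s ≠ 0) (y : Fin R → Fin L → ℂ) :
    ∫⁻ _, ENNReal.ofReal (Real.exp (-((L - 1 + ε : ℝ) * Real.log ρ +
      upperExponent A ε m₀ i₀ x s (y - signal A ρ x s)))) ∂(smearingLaw L)
    ≤ (volume (Metric.closedBall (0 : Fin L → ℂ) 1))⁻¹ *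
      ∫⁻ c, ENNReal.ofReal ((1 + ‖((Real.sqrt ρ : ℝ) : ℂ) * x i₀ * gain A m₀ i₀ (c⁻¹ • s)‖) ^ 2) *
        (∫⁻ w, referenceWeight A ε ρ i₀ (c⁻¹ • s) w y) ∂(ProbabilityTheory.cond volume annulus) := by
  have hV : (volume (Metric.closedBall (0 : Fin L → ℂ) 1))⁻¹ ≠ ∞ :=
    ENNReal.inv_ne_top.2 (Metric.measure_closedBall_pos volume _ one_pos).ne'
  rw [smearingLaw, lintegral_prod _ aemeasurable_const, ← lintegral_const_mul' _ _ hV]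
  refine lintegral_mono_ae ?_
  filter_upwards [ae_cond_mem volume measurableSet_annulus] with c hc
  set b := ENNReal.ofReal
    ((1 + ‖((Real.sqrt ρ : ℝ) : ℂ) * x i₀ * gain A m₀ i₀ (c⁻¹ • s)‖) ^ 2) with hb
  calc _ ≤ ∫⁻ u : Fin L → ℂ, b * referenceWeight A ε ρ i₀ (c⁻¹ • s)
        (fun i => ((Real.sqrt ρ : ℝ) : ℂ) * c * x i + u i) y
        ∂(ProbabilityTheory.cond volume (Metric.closedBall 0 1)) := by
        refine lintegral_mono_ae ?_
        filter_upwards [ae_cond_mem volume (S := Metric.closedBall (0 : Fin L → ℂ) 1)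
          Metric.isClosed_closedBall.measurableSet] with u hu
        exact exp_neg_upperExponent_le A hε hρ m₀ i₀ hc x (by simpa using hu) hs y
    _ ≤ _ := by
        rw [lintegral_cond, lintegral_const_mul' _ _ ENNReal.ofReal_ne_top]
        refine mul_le_mul_right (mul_le_mul_right
          ((setLIntegral_le_lintegral _ _).trans (le_of_eq ?_)) _) _
        exact lintegral_add_left_eq_self (fun w => referenceWeight A ε ρ i₀ (c⁻¹ • s) w y)
          fun i => ((Real.sqrt ρ : ℝ) : ℂ) * c * x i

section Scaling

/-- The weight of the fading `t` after extraction of the scalar `c`. -/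
def scaledWeight (T : (Fin R → Fin Q → ℂ) → ℝ≥0∞) (m₀ : Fin R) (i₀ : Fin L) (η z c : ℂ)
    (t : Fin R → Fin Q → ℂ) : ℝ≥0∞ :=
  ENNReal.ofReal (Real.exp (-‖z - η * gain A m₀ i₀ t * c‖ ^ 2)) *
    ENNReal.ofReal ((1 + ‖η * gain A m₀ i₀ t‖) ^ 2) * T t

variable {T : (Fin R → Fin Q → ℂ) → ℝ≥0∞} (m₀ : Fin R) (i₀ : Fin L) (η z : ℂ)

lemma measurable_scaledWeight (hT : Measurable T) {α : Type*} [MeasurableSpace α] {c : α → ℂ}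
    {t : α → Fin R → Fin Q → ℂ} (hc : Measurable c) (ht : Measurable t) :
    Measurable fun a => scaledWeight A T m₀ i₀ η z (c a) (t a) := by
  unfold scaledWeight
  fun_prop

lemma scaledWeight_inv_smul {c : ℂ} (hc : c ≠ 0) (s : Fin R → Fin Q → ℂ) :
    scaledWeight A T m₀ i₀ η z c (c⁻¹ • s) =
      ENNReal.ofReal (Real.exp (-‖z - η * gain A m₀ i₀ s‖ ^ 2)) *
        (ENNReal.ofReal ((1 + ‖η * gain A m₀ i₀ (c⁻¹ • s)‖) ^ 2) * T (c⁻¹ • s)) := by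
  have : η * gain A m₀ i₀ (c⁻¹ • s) * c = η * gain A m₀ i₀ s := by
    rw [gain_smul]; field_simp
  rw [scaledWeight, this, mul_assoc]

lemma lintegral_scaledWeight_inv_smul_le (hT : Measurable T) {c : ℂ} (hc : c ∈ annulus) :
    ∫⁻ s : Fin R → Fin Q → ℂ, scaledWeight A T m₀ i₀ η z c (c⁻¹ • s)
      ≤ ∫⁻ t, scaledWeight A T m₀ i₀ η z c t := by
  have hcpos : 0 < ‖c‖ := lt_of_lt_of_le (by norm_num) hc.1
  rw [lintegral_comp_complex_smul volume (inv_ne_zero (norm_pos_iff.1 hcpos))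
    (g := scaledWeight A T m₀ i₀ η z c)
    (measurable_scaledWeight A m₀ i₀ η z hT measurable_const measurable_id)]
  refine mul_le_of_le_one_left zero_le ?_
  rw [← ENNReal.ofReal_one]
  refine ENNReal.ofReal_le_ofReal (inv_le_one_of_one_le₀ (one_le_pow₀ (one_le_pow₀ ?_)))
  rw [norm_inv]
  exact (one_le_inv₀ hcpos).2 hc.2

lemma lintegral_scaledWeight_le (t : Fin R → Fin Q → ℂ) :
    ∫⁻ c, scaledWeight A T m₀ i₀ η z c t ∂(ProbabilityTheory.cond volume annulus)
      ≤ (4 + (volume annulus)⁻¹ * ENNReal.ofReal (4 * Real.pi)) * T t := by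
  unfold scaledWeight
  rw [lintegral_mul_const _ (by fun_prop)]
  exact mul_le_mul_left (lintegral_cond_annulus_exp_le z (η * gain A m₀ i₀ t)) _

/-- After the substitution `s = c • t`, whose Jacobian is at most one, `c` enters only through `z -
η (gain t) c`. Integrating over `c` at fixed `t` gains the factor that absorbs `(1 + ‖η gain t‖) ^
2`. This expresses that the common scale of input and fading carries no leading-order information.
-/
lemma lintegral_scaled_le (hT : Measurable T) :
    ∫⁻ s : Fin R → Fin Q → ℂ, ENNReal.ofReal (Real.exp (-‖z - η * gain A m₀ i₀ s‖ ^ 2)) *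
      ∫⁻ c, ENNReal.ofReal ((1 + ‖η * gain A m₀ i₀ (c⁻¹ • s)‖) ^ 2) * T (c⁻¹ • s)
        ∂(ProbabilityTheory.cond volume annulus)
    ≤ (4 + (volume annulus)⁻¹ * ENNReal.ofReal (4 * Real.pi)) * ∫⁻ t, T t := by
  set ν := ProbabilityTheory.cond (volume : Measure ℂ) annulus with hν
  have hmem : ∀ᵐ c ∂ν, c ∈ annulus := ae_cond_mem volume measurableSet_annulus
  have hfm : Measurable fun q : ℂ × (Fin R → Fin Q → ℂ) =>
      scaledWeight A T m₀ i₀ η z q.1 q.2 :=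
    measurable_scaledWeight A m₀ i₀ η z hT measurable_fst measurable_snd
  have hgm : Measurable fun q : (Fin R → Fin Q → ℂ) × ℂ =>
      scaledWeight A T m₀ i₀ η z q.2 (q.2⁻¹ • q.1) :=
    measurable_scaledWeight A m₀ i₀ η z hT measurable_snd (by fun_prop)
  have h1 : ∀ s : Fin R → Fin Q → ℂ,
      ENNReal.ofReal (Real.exp (-‖z - η * gain A m₀ i₀ s‖ ^ 2)) *
      ∫⁻ c, ENNReal.ofReal ((1 + ‖η * gain A m₀ i₀ (c⁻¹ • s)‖) ^ 2) * T (c⁻¹ • s) ∂ν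
      = ∫⁻ c, scaledWeight A T m₀ i₀ η z c (c⁻¹ • s) ∂ν := fun s => by
    rw [← lintegral_const_mul' _ _ ENNReal.ofReal_ne_top]
    refine lintegral_congr_ae ?_
    filter_upwards [hmem] with c hc
    exact (scaledWeight_inv_smul A m₀ i₀ η z
      (norm_pos_iff.1 (lt_of_lt_of_le (by norm_num) hc.1)) s).symm
  rw [lintegral_congr h1, lintegral_lintegral_swap hgm.aemeasurable,
    ← lintegral_const_mul _ hT]
  refine le_trans (lintegral_mono_ae (g := fun c => ∫⁻ t, scaledWeight A T m₀ i₀ η z c t) ?_) ?_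
  · filter_upwards [hmem] with c hc
    exact lintegral_scaledWeight_inv_smul_le A m₀ i₀ η z hT hc
  · rw [lintegral_lintegral_swap hfm.aemeasurable]
    exact lintegral_mono fun t => lintegral_scaledWeight_le A m₀ i₀ η z t

end Scaling

/-- Input, fading, noise and auxiliary randomization. -/
abbrev Randomness (L Q R : ℕ) : Type :=
  (Fin L → ℂ) × ((Fin R → Fin Q → ℂ) × (Fin R → Fin L → ℂ)) × (ℂ × (Fin L → ℂ))

/-- The information is at most `(L - 1 + ε) log ρ + O(1)` for every admissible input. -/
theorem exists_klDiv_jointLaw_le (m₀ : Fin R) {i₀ : Fin L} (hi₀ : A.row i₀ ≠ 0) {ε : ℝ}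
    (hε : 0 < ε) :
    ∃ C : ℝ, 0 ≤ C ∧ ∀ ρ : ℝ, 1 ≤ ρ → ∀ μ ∈ admissibleInputs L,
      InformationTheory.klDiv (jointLaw A R ρ μ)
          ((jointLaw A R ρ μ).fst.prod (jointLaw A R ρ μ).snd)
        ≤ ENNReal.ofReal ((L - 1 + ε : ℝ) * Real.log ρ + C) := by
  obtain ⟨s₀, κ, hpol, hκ⟩ := exists_isPolynomialAlong_gain A m₀ hi₀
  obtain ⟨C₁, hC₁⟩ := hpol.exists_lintegral_neg_log_le (measurable_gain A m₀ i₀) hκ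
  have hne : ∀ᵐ s ∂(complexGaussianVectors R Q), gain A m₀ i₀ s ≠ 0 :=
    ae_mono (complexGaussianVectors_le_volume R Q) (hpol.ae_ne_zero (measurable_gain A m₀ i₀) hκ)
  obtain ⟨C₂, hC₂⟩ := exists_lintegral_referenceWeight_le (R := R) A hε i₀
  set V := (volume (Metric.closedBall (0 : Fin L → ℂ) 1)) with hVdef
  have hV : V⁻¹ ≠ ∞ :=
    ENNReal.inv_ne_top.2 (Metric.measure_closedBall_pos volume _ one_pos).ne'
  set K : ℝ≥0∞ := 4 + (volume annulus)⁻¹ * ENNReal.ofReal (4 * Real.pi) with hKdef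
  have hK : K ≠ ∞ := ENNReal.add_ne_top.2 ⟨by simp, ENNReal.mul_ne_top
    (ENNReal.inv_ne_top.2 volume_annulus_ne_zero) ENNReal.ofReal_ne_top⟩
  have hI₁ := lintegral_sqNorm_ne_top R Q
  have hI₂ := lintegral_sqNorm_ne_top R L
  set I₁ := ∫⁻ s, ENNReal.ofReal (sqNorm s) ∂(complexGaussianVectors R Q) with hI₁def
  set I₂ := ∫⁻ n, ENNReal.ofReal (sqNorm n) ∂(complexGaussianVectors R L) with hI₂def
  set k₀ : ℝ := 2 * Real.log 2 + 4 * ε + 2 * L with hk₀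
  set k₁ : ℝ := 4 + 8 * (R * L * (∑ i, ∑ j, ‖A i j‖) ^ 2) with hk₁
  set k₂ : ℝ := 2 + 2 * ε with hk₂
  have hk₀0 : 0 ≤ k₀ := by
    have := Real.log_nonneg (one_le_two (α := ℝ))
    positivity
  have hk₁0 : 0 ≤ k₁ := by positivity
  have hk₂0 : 0 ≤ k₂ := by positivity
  set H : ℝ≥0∞ := ENNReal.ofReal k₀ + ENNReal.ofReal k₂ * L + ENNReal.ofReal k₁ * I₁ + 2 * I₂
    + 2 * C₁ with hH
  have hHt : H ≠ ∞ := by finiteness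
  have hCt : V⁻¹ * (K * C₂) ≠ ∞ := by finiteness
  refine ⟨H.toReal + (V⁻¹ * (K * C₂)).toReal, by positivity, fun ρ hρ μ hμ => ?_⟩
  have hρ0 : 0 < ρ := by linarith
  obtain ⟨hμp, hμL⟩ := hμ
  have hTm : Measurable fun q : (Fin R → Fin L → ℂ) × (Fin R → Fin Q → ℂ) =>
      ∫⁻ w, referenceWeight A ε ρ i₀ q.2 w q.1 := by
    have : Measurable fun q : ((Fin R → Fin L → ℂ) × (Fin R → Fin Q → ℂ)) × (Fin L → ℂ) =>
      referenceWeight A ε ρ i₀ q.1.2 q.2 q.1.1 :=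
      measurable_referenceWeight A ε ρ i₀ (by fun_prop) (by fun_prop) (by fun_prop)
    exact this.lintegral_prod_right'
  set G : (Fin R → Fin L → ℂ) → ℝ≥0∞ := fun y => V⁻¹ * (K *
    ∫⁻ t : Fin R → Fin Q → ℂ, ∫⁻ w, referenceWeight A ε ρ i₀ t w y) with hG
  have hGm : Measurable G := (hTm.lintegral_prod_right'.const_mul _).const_mul _
  set P : Measure (Randomness L Q R) := μ.prod (((complexGaussianVectors R Q).prod
      (complexGaussianVectors R L)).prod (smearingLaw L)) with hP
  have hmp1 : MeasurePreserving (fun ω : Randomness L Q R => ω.2.1.1) P (complexGaussianVectors R Q) :=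
    measurePreserving_fst.comp (measurePreserving_fst.comp measurePreserving_snd)
  have hmp2 : MeasurePreserving (fun ω : Randomness L Q R => ω.2.1.2) P (complexGaussianVectors R L) :=
    measurePreserving_snd.comp (measurePreserving_fst.comp measurePreserving_snd)
  have hmp3 : MeasurePreserving (fun ω : Randomness L Q R => ω.1) P μ := measurePreserving_fst
  have hm : Measurable fun ω : Randomness L Q R => upperExponent A ε m₀ i₀ ω.1 ω.2.1.1 ω.2.1.2 := by
    unfold upperExponent
    fun_prop
  have key := klDiv_jointLaw_le A ρ μ (smearingLaw L)
    (h := fun ω => upperExponent A ε m₀ i₀ ω.1 ω.2.1.1 ω.2.1.2) hm (fun ω => ?_)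
    (B := (L - 1 + ε : ℝ) * Real.log ρ) (C := (V⁻¹ * (K * C₂)).toReal) (H := H.toReal)
    (by positivity) (by positivity) ?_ (G := G) hGm (fun x y => ?_) ?_
  · refine key.trans (ENNReal.ofReal_le_ofReal ?_)
    linarith
  · have h1 := sqNorm_nonneg ω.2.1.1
    have h2 := sqNorm_nonneg ω.2.1.2
    have h3 : 0 ≤ ∑ i, ‖ω.1 i‖ ^ 2 := Finset.sum_nonneg fun _ _ => sq_nonneg _
    simp only [upperExponent, ← hk₀, ← hk₁, ← hk₂]
    positivity
  · rw [ENNReal.ofReal_toReal hHt]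
    have hm1 : Measurable fun x : Fin L → ℂ => ENNReal.ofReal (∑ i, ‖x i‖ ^ 2) := by fun_prop
    have hm2 : Measurable fun s : Fin R → Fin Q → ℂ => ENNReal.ofReal (sqNorm s) := by fun_prop
    have hm3 : Measurable fun s : Fin R → Fin L → ℂ => ENNReal.ofReal (sqNorm s) := by fun_prop
    have hm4 : Measurable fun s : Fin R → Fin Q → ℂ =>
      ENNReal.ofReal (-Real.log ‖gain A m₀ i₀ s‖) := by fun_prop
    have hx : ∫⁻ x, ENNReal.ofReal (∑ i, ‖x i‖ ^ 2) ∂μ ≤ L := by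
      refine le_trans (le_of_eq (lintegral_congr fun x => ?_)) hμL
      rw [ENNReal.ofReal_sum_of_nonneg fun _ _ => sq_nonneg _]
      refine Finset.sum_congr rfl fun i _ => ?_
      rw [ENNReal.ofReal_pow (norm_nonneg _), ofReal_norm]
    calc _ ≤ ∫⁻ ω, (ENNReal.ofReal k₀ + ENNReal.ofReal k₂ * ENNReal.ofReal (∑ i, ‖ω.1 i‖ ^ 2)
          + ENNReal.ofReal k₁ * ENNReal.ofReal (sqNorm ω.2.1.1)
          + 2 * ENNReal.ofReal (sqNorm ω.2.1.2)
          + 2 * ENNReal.ofReal (-Real.log ‖gain A m₀ i₀ ω.2.1.1‖)) ∂P := by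
          refine lintegral_mono fun ω => ?_
          simp only [upperExponent, ← hk₀, ← hk₁, ← hk₂]
          refine ENNReal.ofReal_add_le.trans (add_le_add (ENNReal.ofReal_add_le.trans (add_le_add
            (ENNReal.ofReal_add_le.trans (add_le_add (ENNReal.ofReal_add_le.trans (add_le_add
            le_rfl ?_)) ?_)) ?_)) ?_)
          · rw [ENNReal.ofReal_mul hk₂0]
          · rw [ENNReal.ofReal_mul hk₁0]
          · rw [ENNReal.ofReal_mul zero_le_two, ENNReal.ofReal_ofNat]
          · rw [ENNReal.ofReal_mul zero_le_two, ENNReal.ofReal_ofNat, ENNReal.ofReal_max,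
              ENNReal.ofReal_zero, max_eq_left zero_le]
      _ = ENNReal.ofReal k₀ + ENNReal.ofReal k₂ * ∫⁻ ω, ENNReal.ofReal (∑ i, ‖ω.1 i‖ ^ 2) ∂P
          + ENNReal.ofReal k₁ * ∫⁻ ω, ENNReal.ofReal (sqNorm ω.2.1.1) ∂P
          + 2 * ∫⁻ ω, ENNReal.ofReal (sqNorm ω.2.1.2) ∂P
          + 2 * ∫⁻ ω, ENNReal.ofReal (-Real.log ‖gain A m₀ i₀ ω.2.1.1‖) ∂P := by
          rw [lintegral_add_right _ (by fun_prop), lintegral_add_right _ (by fun_prop),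
            lintegral_add_right _ (by fun_prop), lintegral_add_right _ (by fun_prop),
            lintegral_const_mul _ (by fun_prop), lintegral_const_mul _ (by fun_prop),
            lintegral_const_mul _ (by fun_prop), lintegral_const_mul _ (by fun_prop)]
          simp
      _ ≤ H := by
          rw [hH]
          refine add_le_add (add_le_add (add_le_add (add_le_add le_rfl ?_) ?_) ?_) ?_
          · exact mul_le_mul_right ((hmp3.lintegral_comp hm1).trans_le hx) _
          · exact mul_le_mul_right (hmp1.lintegral_comp hm2).le _
          · exact mul_le_mul_right (hmp2.lintegral_comp hm3).le _
          · refine mul_le_mul_right ((hmp1.lintegral_comp hm4).trans_le ?_) _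
            simpa using hC₁ 0 (by simp)
  · set T : (Fin R → Fin Q → ℂ) → ℝ≥0∞ := fun t => ∫⁻ w, referenceWeight A ε ρ i₀ t w y with hT
    have hTm' : Measurable T := hTm.comp (f := fun t : Fin R → Fin Q → ℂ => (y, t)) (by fun_prop)
    set η : ℂ := ((Real.sqrt ρ : ℝ) : ℂ) * x i₀ with hη
    -- Of the channel density only the factor of the single observation `(m₀, i₀)` is kept. It
    -- suffices for the integration over `c`.
    calc _ ≤ ∫⁻ s, ENNReal.ofReal (Real.exp (-‖y m₀ i₀ - η * gain A m₀ i₀ s‖ ^ 2)) * (V⁻¹ *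
          ∫⁻ c, ENNReal.ofReal ((1 + ‖η * gain A m₀ i₀ (c⁻¹ • s)‖) ^ 2) * T (c⁻¹ • s)
            ∂(ProbabilityTheory.cond volume annulus)) ∂(complexGaussianVectors R Q) := by
          refine lintegral_mono_ae ?_
          filter_upwards [hne] with s hs
          refine mul_le_mul' ((gaussianDensity_le_exp _).trans (ENNReal.ofReal_le_ofReal
            (Real.exp_le_exp.2 (neg_le_neg ?_)))) (lintegral_smearingLaw_le A hε hρ m₀ i₀ x hs y)
          have h := sq_norm_apply_le_sqNorm (y - signal A ρ x s) m₀ i₀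
          rwa [Pi.sub_apply, Pi.sub_apply, signal, ← mul_assoc] at h
      _ ≤ ∫⁻ s, ENNReal.ofReal (Real.exp (-‖y m₀ i₀ - η * gain A m₀ i₀ s‖ ^ 2)) * (V⁻¹ *
          ∫⁻ c, ENNReal.ofReal ((1 + ‖η * gain A m₀ i₀ (c⁻¹ • s)‖) ^ 2) * T (c⁻¹ • s)
            ∂(ProbabilityTheory.cond volume annulus)) :=
          lintegral_mono' (complexGaussianVectors_le_volume R Q) le_rfl
      _ = V⁻¹ * ∫⁻ s, ENNReal.ofReal (Real.exp (-‖y m₀ i₀ - η * gain A m₀ i₀ s‖ ^ 2)) *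
          ∫⁻ c, ENNReal.ofReal ((1 + ‖η * gain A m₀ i₀ (c⁻¹ • s)‖) ^ 2) * T (c⁻¹ • s)
            ∂(ProbabilityTheory.cond volume annulus) := by
          rw [← lintegral_const_mul' _ _ hV]
          exact lintegral_congr fun s => by ring
      _ ≤ G y := mul_le_mul_right (lintegral_scaled_le A m₀ i₀ η (y m₀ i₀) hTm') _
  · rw [ENNReal.ofReal_toReal hCt, hG, lintegral_const_mul' _ _ hV, lintegral_const_mul' _ _ hK]
    exact mul_le_mul_right (mul_le_mul_right (hC₂ ρ hρ0) _) _

end Upper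

end SIMO

end

noncomputable section

namespace SIMO

/-! ### Bounds of the capacity -/

section Capacity

variable {L Q R : ℕ} (A : Matrix (Fin L) (Fin Q) ℂ)

lemma le_capacity_of_le_klDiv (hL : 0 < L) {ρ b : ℝ} {μ : Measure (Fin L → ℂ)}
    (hμ : μ ∈ admissibleInputs L) (h : ENNReal.ofReal b ≤ InformationTheory.klDiv
      (jointLaw A R ρ μ) ((jointLaw A R ρ μ).fst.prod (jointLaw A R ρ μ).snd)) :
    ENNReal.ofReal (b / Real.log 2 / L) ≤ capacity A R ρ := by
  have hL' : (0 : ℝ) < L := by exact_mod_cast hL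
  rw [ENNReal.ofReal_div_of_pos hL', ENNReal.ofReal_div_of_pos (Real.log_pos one_lt_two),
    ENNReal.ofReal_natCast, capacity]
  refine ENNReal.div_le_div_right ?_ _
  refine le_trans ?_ (le_iSup₂ (f := fun μ (_ : μ ∈ admissibleInputs L) =>
    mutualInformation (jointLaw A R ρ μ)) μ hμ)
  exact ENNReal.div_le_div_right h _

lemma capacity_le_of_klDiv_le (hL : 0 < L) {ρ b : ℝ} (h : ∀ μ ∈ admissibleInputs L,
    InformationTheory.klDiv (jointLaw A R ρ μ)
      ((jointLaw A R ρ μ).fst.prod (jointLaw A R ρ μ).snd) ≤ ENNReal.ofReal b) :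
    capacity A R ρ ≤ ENNReal.ofReal (b / Real.log 2 / L) := by
  have hL' : (0 : ℝ) < L := by exact_mod_cast hL
  rw [ENNReal.ofReal_div_of_pos hL', ENNReal.ofReal_div_of_pos (Real.log_pos one_lt_two),
    ENNReal.ofReal_natCast, capacity]
  exact ENNReal.div_le_div_right (iSup₂_le fun μ hμ => ENNReal.div_le_div_right (h μ hμ) _) _

lemma exists_le_capacity (hL : 0 < L) {P : Finset (Fin L)} {s₀ : Fin R → Fin Q → ℂ}
    (hinj : ∀ (δ : Fin L → ℂ) (t : Fin R → Fin Q → ℂ), (∀ i ∉ P, δ i = 0) →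
      (∀ m i, δ i * (A *ᵥ s₀ m) i + (A *ᵥ t m) i = 0) → δ = 0 ∧ t = 0) :
    ∃ C : ℝ, ∀ ρ : ℝ, 1 ≤ ρ →
      ENNReal.ofReal ((P.card / L : ℝ) * Real.logb 2 ρ - C) ≤ capacity A R ρ := by
  obtain ⟨C, hC⟩ := exists_le_klDiv_inputLaw A P hinj
  refine ⟨C / Real.log 2 / L, fun ρ hρ => ?_⟩
  refine le_trans (ENNReal.ofReal_le_ofReal (le_of_eq ?_))
    (le_capacity_of_le_klDiv A hL (inputLaw_mem_admissibleInputs P) (hC ρ hρ))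
  rw [Real.logb]
  ring

lemma exists_capacity_le (hR : 0 < R) (hL : 0 < L) (hrow : ∀ i, A.row i ≠ 0) {ε : ℝ}
    (hε : 0 < ε) : ∃ C : ℝ, ∀ ρ : ℝ, 1 ≤ ρ →
      capacity A R ρ ≤ ENNReal.ofReal ((1 - 1 / L + ε : ℝ) * Real.logb 2 ρ + C) := by
  have hL' : (0 : ℝ) < L := by exact_mod_cast hL
  obtain ⟨C, -, hC⟩ := exists_klDiv_jointLaw_le A (⟨0, hR⟩ : Fin R) (hrow ⟨0, hL⟩)
    (mul_pos hε hL')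
  refine ⟨C / Real.log 2 / L, fun ρ hρ => ?_⟩
  refine (capacity_le_of_klDiv_le A hL (hC ρ hρ)).trans
    (ENNReal.ofReal_le_ofReal (le_of_eq ?_))
  have hlog : Real.log 2 ≠ 0 := (Real.log_pos one_lt_two).ne'
  rw [Real.logb]
  field_simp

/-- A bound up to an additive constant for large arguments as a bound up to `O(1)`. -/
lemma exists_isBigO_of_le {f : ℝ → ℝ≥0∞} {k C : ℝ}
    (h : ∀ ρ : ℝ, 1 ≤ ρ → ENNReal.ofReal (k * Real.logb 2 ρ - C) ≤ f ρ) :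
    ∃ g : ℝ → ℝ, g =O[atTop] (fun _ => (1 : ℝ)) ∧
      ∀ ρ : ℝ, 0 < ρ → ((k * Real.logb 2 ρ + g ρ : ℝ) : EReal) ≤ (f ρ : EReal) := by
  -- Below `ρ = 1` the remainder cancels the main term, leaving only nonnegativity of `f`. The
  -- condition at infinity does not see this range.
  refine ⟨fun ρ => if 1 ≤ ρ then -C else -(k * Real.logb 2 ρ), ?_, fun ρ _ => ?_⟩
  · refine (isBigO_const_const (-C) one_ne_zero atTop).congr' ?_ EventuallyEq.rfl
    filter_upwards [eventually_ge_atTop 1] with ρ hρ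
    rw [if_pos hρ]
  · beta_reduce
    by_cases hρ : 1 ≤ ρ
    · have h1 : ((ENNReal.ofReal (k * Real.logb 2 ρ - C) : ℝ≥0∞) : EReal) ≤ (f ρ : EReal) :=
        EReal.coe_ennreal_le_coe_ennreal_iff.2 (h ρ hρ)
      refine le_trans ?_ h1
      rw [if_pos hρ, ← sub_eq_add_neg, EReal.coe_ennreal_ofReal]
      exact_mod_cast le_max_left _ _
    · rw [if_neg hρ, add_neg_cancel, EReal.coe_zero]
      exact EReal.coe_ennreal_nonneg _

lemma tendsto_logb_two : Tendsto (Real.logb 2) atTop atTop :=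
  Real.tendsto_logb_atTop one_lt_two

/-- Additive constants disappear on division by `log ρ`. The loss `ε` is harmless because any real
`r > k` may serve as `k + ε`. -/
lemma tendsto_div_logb {f : ℝ → ℝ≥0∞} {k : ℝ} (hk : 0 ≤ k)
    (hlow : ∃ C : ℝ, ∀ ρ : ℝ, 1 ≤ ρ → ENNReal.ofReal (k * Real.logb 2 ρ - C) ≤ f ρ)
    (hup : ∀ ε : ℝ, 0 < ε → ∃ C : ℝ, ∀ ρ : ℝ, 1 ≤ ρ →
      f ρ ≤ ENNReal.ofReal ((k + ε) * Real.logb 2 ρ + C)) :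
    Tendsto (fun ρ : ℝ => f ρ / ENNReal.ofReal (Real.logb 2 ρ)) atTop
      (𝓝 (ENNReal.ofReal k)) := by
  have hlim : ∀ a C : ℝ, Tendsto (fun ρ : ℝ => ENNReal.ofReal (a + C / Real.logb 2 ρ)) atTop
      (𝓝 (ENNReal.ofReal a)) := fun a C => by
    refine ENNReal.tendsto_ofReal ?_
    simpa using tendsto_const_nhds.add (tendsto_logb_two.const_div_atTop C)
  have hlog : ∀ᶠ ρ : ℝ in atTop, 0 < Real.logb 2 ρ := tendsto_logb_two.eventually_gt_atTop 0
  rw [tendsto_order]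
  constructor
  · intro a ha
    obtain ⟨C, hC⟩ := hlow
    filter_upwards [(hlim k (-C)).eventually_const_lt ha, hlog, eventually_ge_atTop 1]
      with ρ h1 h2 h3
    refine h1.trans_le ?_
    refine le_trans (le_of_eq ?_) (ENNReal.div_le_div_right (hC ρ h3) _)
    rw [← ENNReal.ofReal_div_of_pos h2]
    congr 1
    field_simp
    ring
  · intro a ha
    obtain ⟨r, -, hr1, hr2⟩ := ENNReal.lt_iff_exists_real_btwn.1 ha
    have hkr : k < r := (ENNReal.ofReal_lt_ofReal_iff_of_nonneg hk).1 hr1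
    obtain ⟨C, hC⟩ := hup (r - k) (by linarith)
    have h0 := hlim r C
    filter_upwards [h0.eventually_lt_const hr2, hlog, eventually_ge_atTop 1] with ρ h1 h2 h3
    refine lt_of_le_of_lt ?_ h1
    refine le_trans (ENNReal.div_le_div_right (hC ρ h3) _) (le_of_eq ?_)
    rw [← ENNReal.ofReal_div_of_pos h2]
    congr 1
    field_simp
    ring

lemma one_le_of_row_ne_zero (hL : 0 < L) (hrow : ∀ i, A.row i ≠ 0) : 1 ≤ Q := by
  rcases Nat.eq_zero_or_pos Q with rfl | h
  · exact absurd (Subsingleton.elim _ _) (hrow ⟨0, hL⟩)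
  · exact h

lemma exists_le_capacity_of_le (hR : 2 ≤ R) (hL : 0 < L) (hrow : ∀ i, A.row i ≠ 0)
    (hA : PropertyA A R) (h : ((Q : ℝ) * R - 1) / ((R : ℝ) - 1) ≤ L) :
    ∃ C : ℝ, ∀ ρ : ℝ, 1 ≤ ρ →
      ENNReal.ofReal ((1 - 1 / (L : ℝ)) * Real.logb 2 ρ - C) ≤ capacity A R ρ := by
  have hQ := one_le_of_row_ne_zero A hL hrow
  obtain ⟨K, hK, hind⟩ := hA
  set N := ⌈((Q : ℝ) * R - 1) / ((R : ℝ) - 1)⌉₊ with hN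
  rw [min_eq_left (Nat.ceil_le.2 h)] at hK
  have hR1 : (0 : ℝ) < R - 1 := by
    have : (2 : ℝ) ≤ R := by exact_mod_cast hR
    linarith
  have hle : Q * R + N ≤ N * R + 1 := by
    have := (div_le_iff₀ hR1).1 (Nat.le_ceil (((Q : ℝ) * R - 1) / ((R : ℝ) - 1)))
    rw [← hN] at this
    have h2 : (Q * R + N : ℝ) ≤ N * R + 1 := by linarith
    exact_mod_cast h2
  have hQN : Q ≤ N := by
    by_contra! hlt
    have := Nat.mul_le_mul_right R hlt
    rw [Nat.succ_mul] at this
    omega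
  -- Rearranged, this is `N (R - 1) ≥ Q R - 1`: the ceiling is the least number of rows that the
  -- windows of `R` antennas can exhaust.
  have hRN : N - 1 ≤ R * (N - Q) := by
    obtain ⟨d, hd⟩ := Nat.exists_eq_add_of_le hQN
    rw [hd] at hle ⊢
    rw [Nat.add_sub_cancel_left]
    rw [add_mul] at hle
    have : d * R = R * d := mul_comm _ _
    omega
  obtain ⟨P, s₀, hP, hinj⟩ := exists_injective_of_subset A hK hQ hQN (by omega) hRN hrow hind
  obtain ⟨C, hC⟩ := exists_le_capacity A hL hinj
  refine ⟨C, fun ρ hρ => ?_⟩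
  have hcoef : (P.card / L : ℝ) = 1 - 1 / (L : ℝ) := by
    have hL' : (L : ℝ) ≠ 0 := by exact_mod_cast hL.ne'
    rw [hP, Nat.cast_sub hL, Nat.cast_one]
    field_simp
  rw [← hcoef]
  exact hC ρ hρ

lemma exists_le_capacity_of_lt (hR : 2 ≤ R) (hQL : Q < L) (hrow : ∀ i, A.row i ≠ 0)
    (hA : PropertyA A R) (h : (L : ℝ) < ((Q : ℝ) * R - 1) / ((R : ℝ) - 1)) :
    ∃ C : ℝ, ∀ ρ : ℝ, 1 ≤ ρ →
      ENNReal.ofReal ((R : ℝ) * (1 - (Q : ℝ) / (L : ℝ)) * Real.logb 2 ρ - C)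
        ≤ capacity A R ρ := by
  have hL : 0 < L := by omega
  have hQ := one_le_of_row_ne_zero A hL hrow
  obtain ⟨K, hK, hind⟩ := hA
  rw [min_eq_right (Nat.lt_ceil.2 h).le] at hK
  have hKu : K = Finset.univ := by
    rw [← Finset.card_eq_iff_eq_univ, hK, Fintype.card_fin]
  have hR1 : (0 : ℝ) < R - 1 := by
    have : (2 : ℝ) ≤ R := by exact_mod_cast hR
    linarith
  have hlt : R * (L - Q) < L := by
    have h1 := (lt_div_iff₀ hR1).1 h
    have h2 : (R * ((L - Q : ℕ) : ℝ)) < L := by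
      rw [Nat.cast_sub hQL.le]
      linarith
    exact_mod_cast h2
  obtain ⟨P, s₀, hP, hinj⟩ := exists_injective_of_univ A hQ hQL.le (by omega) hlt
    fun S hS => hind S (hKu ▸ Finset.subset_univ S) hS
  obtain ⟨C, hC⟩ := exists_le_capacity A hL hinj
  refine ⟨C, fun ρ hρ => ?_⟩
  have hcoef : (P.card / L : ℝ) = (R : ℝ) * (1 - (Q : ℝ) / (L : ℝ)) := by
    have hL' : (L : ℝ) ≠ 0 := by exact_mod_cast hL.ne'
    rw [hP, Nat.cast_mul, Nat.cast_sub hQL.le]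
    field_simp
  rw [← hcoef]
  exact hC ρ hρ

end Capacity

end SIMO

end

theorem theorem1 (L Q R : ℕ) (hR : 2 ≤ R) (hQL : Q < L)
    (A : Matrix (Fin L) (Fin Q) ℂ) (hrank : A.rank = Q) (hrow : ∀ i, A.row i ≠ 0)
    (hA : SIMO.PropertyA A R) :
    (((Q : ℝ) * R - 1) / ((R : ℝ) - 1) ≤ L →
      ∃ g : ℝ → ℝ, g =O[atTop] (fun _ => (1 : ℝ)) ∧
        ∀ ρ : ℝ, 0 < ρ →
          (((1 - 1 / (L : ℝ)) * Real.logb 2 ρ + g ρ : ℝ) : EReal)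
            ≤ (SIMO.capacity A R ρ : EReal)) ∧
    (¬ ((Q : ℝ) * R - 1) / ((R : ℝ) - 1) ≤ L →
      ∃ g : ℝ → ℝ, g =O[atTop] (fun _ => (1 : ℝ)) ∧
        ∀ ρ : ℝ, 0 < ρ →
          (((R : ℝ) * (1 - (Q : ℝ) / (L : ℝ)) * Real.logb 2 ρ + g ρ : ℝ) : EReal)
            ≤ (SIMO.capacity A R ρ : EReal)) ∧
    (R = 2 → 2 * (Q : ℤ) - 1 ≤ L →
      Tendsto (fun ρ : ℝ => SIMO.capacity A R ρ / ENNReal.ofReal (Real.logb 2 ρ)) atTop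
        (𝓝 (ENNReal.ofReal (1 - 1 / (L : ℝ))))) := by
  have hL : 0 < L := by omega
  refine ⟨fun h => ?_, fun h => ?_, fun hR2 hQL2 => ?_⟩
  · obtain ⟨C, hC⟩ := SIMO.exists_le_capacity_of_le A hR hL hrow hA h
    exact SIMO.exists_isBigO_of_le hC
  · obtain ⟨C, hC⟩ := SIMO.exists_le_capacity_of_lt A hR hQL hrow hA (not_le.1 h)
    exact SIMO.exists_isBigO_of_le hC
  · have hL1 : (1 : ℝ) ≤ L := by exact_mod_cast hL
    -- For `R = 2` the threshold is `2 Q - 1`, so the first lower bound applies and its coefficient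
    -- agrees with the upper bound.
    have h : ((Q : ℝ) * R - 1) / ((R : ℝ) - 1) ≤ L := by
      have h1 : (2 * (Q : ℝ) - 1) ≤ L := by exact_mod_cast hQL2
      rw [hR2]
      norm_num
      linarith
    refine SIMO.tendsto_div_logb (sub_nonneg.2 ?_)
      (SIMO.exists_le_capacity_of_le A hR hL hrow hA h)
      fun ε hε => SIMO.exists_capacity_le A (by omega) hL hrow hε
    rw [div_le_one (by linarith)]
    exact hL1
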